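/- Let $n\ge 2$ and $m\ge 1$ be integers, let $1<p<\infty$ and $p'=p/(p-1)$. Let $\mathbb H^n$ be the hyperbolic space in the ball model, that is, the open unit ball of $\mathbb R^n$ with the Riemannian metric $g=\left(\frac{2}{1-|x|^2}\right)^2dx\otimes dx$ and the volume $dV_g=\left(\frac{2}{1-|x|^2}\right)^n dx$; let $\nabla_g$ be the gradient, $\Delta_g=\operatorname{div}_g\nabla_g$ the Laplace–Beltrami operator, and $\|f\|_p=\left(\int_{\mathbb H^n}|f|^p\,dV_g\right)^{1/p}$. Let $W^{m,p}(\mathbb H^n)$ be the Sobolev space of real functions $u$ which have weak covariant derivatives (for the Levi-Civita connection of $g$) of all orders $k\le m$, with $g$-norms in $L^p(dV_g)$ for $0\le k\le m$. For $u\in W^{m,p}(\mathbb H^n)$ put $$\nabla_g^m u=\begin{cases}\Delta_g^{m/2}u & \text{if } m \text{ is even},\\ \nabla_g\big(\Delta_g^{(m-1)/2}u\big) & \text{if } m\text{ is odd},\end{cases}$$ in the weak sense, and let $\|\nabla_g^m u\|_p$ be the $L^p(dV_g)$ norm of its pointwise $g$-norm $|\nabla_g^m u|_g$. Let $$C(n,m,p)=\begin{cases}\left(\dfrac{pp'}{(n-1)^2}\right)^{m/2}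 & \text{if } m\text{ is even},\\[2mm] \dfrac{p}{n-1}\left(\dfrac{pp'}{(n-1)^2}\right)^{(m-1)/2} & \text{if } m\text{ is odd}.\end{cases}$$ Then every $u\in W^{m,p}(\mathbb H^n)$ has $\nabla_g^m u\in L^p$ and satisfies $$\|u\|_p\le C(n,m,p)\,\|\nabla_g^m u\|_p .$$ The constant is sharp: for every $c<C(n,m,p)$ there is a nonzero $u\in W^{m,p}(\mathbb H^n)$ with $\|u\|_p>c\,\|\nabla_g^m u\|_p$. It is never achieved: no nonzero $u\in W^{m,p}(\mathbb H^n)$ gives equality. -/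

import Mathlib

open MeasureTheory Set
open scoped ENNReal ContDiff

/-! Analysis on the ball model of hyperbolic space: the open unit ball of `ℝⁿ` with the metric
`g = (2 / (1 - |x|²))² dx ⊗ dx`. Functions on hyperbolic space are represented by functions on
`EuclideanSpace ℝ (Fin n)`; every condition below only looks at their restriction to the ball. -/

noncomputable section

namespace HypBall

/-- The model vector space `ℝⁿ` with its Euclidean structure. -/
abbrev E (n : ℕ) : Type := EuclideanSpace ℝ (Fin n)

/-- The underlying set of the ball model: the open unit ball. -/
abbrev ball (n : ℕ) : Set (E n) := Metric.ball (0 : E n) 1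

/-- The square root `2 / (1 - |x|²)` of the conformal factor. -/
def conf {n : ℕ} (x : E n) : ℝ := 2 / (1 - ‖x‖ ^ 2)

/-- The hyperbolic volume `dV_g = (2 / (1 - |x|²))ⁿ dx` on the unit ball. -/
def vol (n : ℕ) : Measure (E n) :=
  ((volume : Measure (E n)).restrict (ball n)).withDensity
    (fun x => ENNReal.ofReal (conf x ^ n))

/-- The classical (Euclidean) partial derivative `∂ᵢ f`. -/
def pd {n : ℕ} (i : Fin n) (f : E n → ℝ) (x : E n) : ℝ :=
  fderiv ℝ f x (EuclideanSpace.single i 1)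

/-- The coefficients `g_{ij}` of the hyperbolic metric. -/
def metric {n : ℕ} (i j : Fin n) (x : E n) : ℝ := if i = j then conf x ^ 2 else 0

/-- The coefficients `g^{ij}` of the inverse metric. -/
def invMetric {n : ℕ} (i j : Fin n) (x : E n) : ℝ := if i = j then (conf x ^ 2)⁻¹ else 0

/-- The Christoffel symbol `Γ^l_{ij}` of the Levi-Civita connection of `g`. -/
def christoffel {n : ℕ} (l i j : Fin n) (x : E n) : ℝ :=
  (1 / 2) * ∑ k, invMetric l k x *
    (pd i (metric j k) x + pd j (metric i k) x - pd k (metric i j) x)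

/-- The hyperbolic gradient `∇_g f`, with components `g^{ij} ∂_j f`. -/
def grad {n : ℕ} (f : E n → ℝ) (x : E n) : E n := (conf x ^ 2)⁻¹ • gradient f x

/-- The hyperbolic divergence `div_g X = |g|^{-1/2} ∑ ∂ᵢ (|g|^{1/2} Xⁱ)`, where
`|g|^{1/2} = (2 / (1 - |x|²))ⁿ`. -/
def div {n : ℕ} (X : E n → E n) (x : E n) : ℝ :=
  (conf x ^ n)⁻¹ * ∑ i, pd i (fun y => conf y ^ n * X y i) x

/-- The Laplace-Beltrami operator `Δ_g = div_g ∘ ∇_g` on smooth functions. -/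
def laplaceBeltrami {n : ℕ} (f : E n → ℝ) : E n → ℝ := div (grad f)

/-- Test functions on hyperbolic space: smooth, with compact support inside the ball. -/
def IsTest {n : ℕ} (φ : E n → ℝ) : Prop :=
  ContDiff ℝ ∞ φ ∧ HasCompactSupport φ ∧ tsupport φ ⊆ ball n

/-- `w` is the weak partial derivative `∂ᵢ v` on the ball. -/
def HasWeakPartial {n : ℕ} (i : Fin n) (v w : E n → ℝ) : Prop :=
  LocallyIntegrableOn v (ball n) volume ∧ LocallyIntegrableOn w (ball n) volume ∧
    ∀ φ : E n → ℝ, IsTest φ → ∫ x in ball n, v x * pd i φ x = -∫ x in ball n, w x * φ x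

/-- The vector field `X` is the weak hyperbolic gradient `∇_g v`, that is, `Xⁱ = g^{ij} ∂_j v`. -/
def HasWeakGrad {n : ℕ} (v : E n → ℝ) (X : E n → E n) : Prop :=
  ∀ i, HasWeakPartial i v (fun x => conf x ^ 2 * X x i)

/-- The function `w` is the weak Laplace-Beltrami operator `Δ_g v` of `v`. -/
def HasWeakLaplacian {n : ℕ} (v w : E n → ℝ) : Prop :=
  LocallyIntegrableOn v (ball n) volume ∧ LocallyIntegrableOn w (ball n) volume ∧
    ∀ φ : E n → ℝ, IsTest φ →
      ∫ x, v x * laplaceBeltrami φ x ∂(vol n) = ∫ x, w x * φ x ∂(vol n)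

/-- `w = Δ_g^k v`, the `k`-fold iterate of the weak Laplace-Beltrami operator. -/
def HasWeakLaplacianPow {n : ℕ} : ℕ → (E n → ℝ) → (E n → ℝ) → Prop
  | 0, v, w => w = v
  | k + 1, v, w => ∃ z, HasWeakLaplacian v z ∧ HasWeakLaplacianPow k z w

/-- `G` is the pointwise norm `|∇_g^m u|_g`, where `∇_g^m u = Δ_g^{m/2} u` for even `m` and
`∇_g^m u = ∇_g (Δ_g^{(m-1)/2} u)` for odd `m`. A tangent vector `X` at `x` has the norm
`|X|_g = 2 / (1 - |x|²) * |X|`. -/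
def IsNormGradPow {n : ℕ} (m : ℕ) (u G : E n → ℝ) : Prop :=
  (Even m ∧ ∃ w, HasWeakLaplacianPow (m / 2) u w ∧ G = fun x => |w x|) ∨
  (Odd m ∧ ∃ v X, HasWeakLaplacianPow ((m - 1) / 2) u v ∧ HasWeakGrad v X ∧
    G = fun x => conf x * ‖X x‖)

/-- Fields of covariant `k`-tensors, given by their coefficients `T_{j₁ … j_k}` in the coordinates
of the ball. -/
abbrev TensorField (n k : ℕ) : Type := E n → EuclideanSpace ℝ (Fin k → Fin n)

/-- `S = ∇T` weakly, for the Levi-Civita connection of `g`: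
`S_{i j₁ … j_k} = ∂ᵢ T_{j₁ … j_k} - ∑ₛ ∑ₗ Γ^l_{i jₛ} T_{j₁ … l … j_k}` (`l` in place `s`). -/
def HasWeakCovDeriv {n k : ℕ} (T : TensorField n k) (S : TensorField n (k + 1)) : Prop :=
  ∀ (i : Fin n) (J : Fin k → Fin n),
    HasWeakPartial i (fun x => T x J)
      (fun x => S x (Fin.cons i J) +
        ∑ s, ∑ l, christoffel l i (J s) x * T x (Function.update J s l))

/-- The Sobolev space `W^{m,p}` of hyperbolic space: `u` has weak covariant derivatives
`∇^k u` of all orders `k ≤ m`, and `|∇^k u|_g` is in `L^p(dV_g)` for `0 ≤ k ≤ m`. The `g`-norm of a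
covariant `k`-tensor at `x` is `(2 / (1 - |x|²))^{-k}` times the Euclidean norm of its
coefficients. -/
def MemSobolev {n : ℕ} (m : ℕ) (p : ℝ) (u : E n → ℝ) : Prop :=
  ∃ T : (k : ℕ) → TensorField n k,
    (∀ x J, T 0 x J = u x) ∧
    (∀ k < m, HasWeakCovDeriv (T k) (T (k + 1))) ∧
    ∀ k ≤ m, MemLp (fun x => (conf x ^ k)⁻¹ • T k x) (ENNReal.ofReal p) (vol n)

/-- The constant `C(n,m,p)`. -/
def sharpConst (n m : ℕ) (p : ℝ) : ℝ :=
  if Even m then (p * Real.conjExponent p / ((n : ℝ) - 1) ^ 2) ^ (m / 2)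
  else p / ((n : ℝ) - 1) * (p * Real.conjExponent p / ((n : ℝ) - 1) ^ 2) ^ ((m - 1) / 2)

end HypBall

end

noncomputable section

namespace HypBall

variable {n : ℕ}

/-! ### Partial derivatives -/

/-! Both basic inequalities (orders one and two) come from a single vector field, `V = ∇_g log cosh
r`, where `r` is the hyperbolic distance to the origin. It is smooth, has length `tanh r ≤ 1`, and
its divergence is `n - 1 + sech² r` (`sum_pd_radialField`). The positive term `sech² r` is carried
through the whole argument and yields strictness at the end.

Order one: integrating `div_g V` against `|φ|^p` and using `|V|_g ≤ 1` gives `∫ (n - 1 + sech² r)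
|φ|^p ≤ p ∫ |φ|^(p-1) |∇φ|` (`integral_grad_bound`).

Order two: pair `-Δφ` with `|φ|^(p-2) φ`, integrate by parts, and bound `|∇φ|²` below by expanding
`|∇φ + κ φ V|² ≥ 0`. The cross term is again an integral of `div_g V` against a multiple of `|φ|^p`.
With `κ = (n - 1) / p` this gives `∫ (p-1)/p² ((n-1)² + (n²-1) sech² r) |φ|^p ≤ ∫ |φ|^(p-1) |Δφ|`
(`integral_laplace_bound`). Since `|s|^(p-2) s` need not be smooth at `0`, it is first replaced by
`(s² + e)^(p/2-1) s`, and then `e → 0`.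

In both cases Hölder turns the bound into `‖(a + b sech² r)^(1/p) φ‖_p^p ≤ C ‖φ‖_p^(p-1) ‖ψ‖_p`,
with `ψ` the gradient or the Laplacian. This form passes to Sobolev functions by density of test
functions (`exists_test_approx_grad`, `exists_test_approx_laplace`). For nonzero `u` the `sech²`
term is positive, so the inequality with constant `C / a` is strict (`lt_of_weight_le`).

Higher orders follow by iteration. The trace of `∇^(k+2) u` in its two innermost indices is `∇^k
(Δu)`, because the metric is parallel; hence `Δ` maps `W^(m+2,p)` to `W^(m,p)`
(`HasWeakCovDeriv.contract`, `MemSobolev.exists_second_partials`). For odd `m` the gradient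
inequality is applied last.

Sharpness is tested on `(1 - |x|²)^β` as `β` decreases to `β₀ = (n - 1) / p`. Up to the higher power
`(1 - |x|²)^(β+1)`, the Laplacian multiplies such a function by `-β (n - 1 - β)`, which at `β₀` is
`-(n-1)² / (p p')`; the gradient contributes a factor `β`. The norm of the function blows up as `β →
β₀`, while that of the higher power stays bounded (`exists_eLpNorm_gt`). -/

theorem pd_eq_of_hasFDerivAt {f : E n → ℝ} {f' : E n →L[ℝ] ℝ} {x : E n} (i : Fin n)
    (h : HasFDerivAt f f' x) : pd i f x = f' (EuclideanSpace.single i 1) := by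
  rw [pd, h.fderiv]

theorem pd_congr {f g : E n → ℝ} {x : E n} (i : Fin n) (h : f =ᶠ[nhds x] g) :
    pd i f x = pd i g x := by
  rw [pd, pd, h.fderiv_eq]

theorem pd_mul {f g : E n → ℝ} {x : E n} (i : Fin n) (hf : DifferentiableAt ℝ f x)
    (hg : DifferentiableAt ℝ g x) :
    pd i (fun y => f y * g y) x = f x * pd i g x + pd i f x * g x := by
  rw [pd_eq_of_hasFDerivAt (f := fun y => f y * g y) i (hf.hasFDerivAt.mul hg.hasFDerivAt)]
  simp [pd]; ring

theorem pd_sum {ι : Type*} {s : Finset ι} {f : ι → E n → ℝ} {x : E n} (i : Fin n)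
    (hf : ∀ j ∈ s, DifferentiableAt ℝ (f j) x) :
    pd i (fun y => ∑ j ∈ s, f j y) x = ∑ j ∈ s, pd i (f j) x := by
  rw [pd_eq_of_hasFDerivAt i (HasFDerivAt.fun_sum fun j hj => (hf j hj).hasFDerivAt)]
  simp [pd]

theorem pd_const (i : Fin n) (c : ℝ) (x : E n) : pd i (fun _ => c) x = 0 := by
  simp [pd]

theorem pd_const_mul {f : E n → ℝ} {x : E n} (i : Fin n) (c : ℝ) (hf : DifferentiableAt ℝ f x) :
    pd i (fun y => c * f y) x = c * pd i f x := by
  rw [pd_mul i (differentiableAt_const c) hf, pd_const]; ring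

theorem pd_comp {f : E n → ℝ} {h : ℝ → ℝ} {h' : ℝ} {x : E n} (i : Fin n)
    (hh : HasDerivAt h h' (f x)) (hf : DifferentiableAt ℝ f x) :
    pd i (fun y => h (f y)) x = h' * pd i f x := by
  have := hh.comp_hasFDerivAt x hf.hasFDerivAt
  rw [pd_eq_of_hasFDerivAt (f := fun y => h (f y)) i this]
  simp [pd]

theorem pd_coord (i j : Fin n) (x : E n) : pd i (fun y : E n => y j) x = if i = j then 1 else 0 := by
  have : HasFDerivAt (fun y : E n => y j) (EuclideanSpace.proj j : E n →L[ℝ] ℝ) x :=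
    (EuclideanSpace.proj j : E n →L[ℝ] ℝ).hasFDerivAt
  rw [pd_eq_of_hasFDerivAt i this]
  simp [eq_comm]

theorem pd_normSq (i : Fin n) (x : E n) : pd i (fun y : E n => ‖y‖ ^ 2) x = 2 * x i := by
  have : HasFDerivAt (fun y : E n => ‖y‖ ^ 2) (2 • (innerSL ℝ x)) x :=
    (hasStrictFDerivAt_norm_sq x).hasFDerivAt
  rw [pd_eq_of_hasFDerivAt i this]
  simp [EuclideanSpace.inner_single_right]

theorem gradient_apply (f : E n → ℝ) (x : E n) (i : Fin n) : gradient f x i = pd i f x := by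
  have : inner ℝ (gradient f x) (EuclideanSpace.single i (1 : ℝ)) = pd i f x := by
    rw [gradient, InnerProductSpace.toDual_symm_apply, pd]
  rw [← this, EuclideanSpace.inner_single_right]
  simp

/-! ### The conformal factor -/

theorem isOpen_ball : IsOpen (ball n) := Metric.isOpen_ball

theorem one_sub_normSq_pos {x : E n} (hx : x ∈ ball n) : 0 < 1 - ‖x‖ ^ 2 := by
  have : ‖x‖ < 1 := by simpa using hx
  nlinarith [norm_nonneg x]

theorem conf_pos {x : E n} (hx : x ∈ ball n) : 0 < conf x :=
  div_pos two_pos (one_sub_normSq_pos hx)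

theorem two_le_conf {x : E n} (hx : x ∈ ball n) : 2 ≤ conf x := by
  rw [conf, le_div_iff₀ (one_sub_normSq_pos hx)]
  nlinarith [sq_nonneg ‖x‖]

theorem contDiffOn_conf : ContDiffOn ℝ ∞ (conf : E n → ℝ) (ball n) := by
  unfold conf
  refine contDiffOn_const.div ?_ fun x hx => (one_sub_normSq_pos hx).ne'
  exact (contDiff_const.sub (contDiff_norm_sq ℝ)).contDiffOn

theorem contDiffOn_conf_inv : ContDiffOn ℝ ∞ (fun x : E n => (conf x)⁻¹) (ball n) :=
  contDiffOn_conf.inv fun _ hx => (conf_pos hx).ne'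

theorem measurable_conf : Measurable (conf : E n → ℝ) := by
  unfold conf; fun_prop

theorem ContDiffOn.differentiableAt_ball {f : E n → ℝ} (hf : ContDiffOn ℝ ∞ f (ball n)) {x : E n}
    (hx : x ∈ ball n) : DifferentiableAt ℝ f x :=
  (hf.contDiffAt (isOpen_ball.mem_nhds hx)).differentiableAt (by simp)

theorem differentiableAt_conf {x : E n} (hx : x ∈ ball n) : DifferentiableAt ℝ (conf : E n → ℝ) x :=
  ContDiffOn.differentiableAt_ball contDiffOn_conf hx

theorem differentiableAt_normSq (x : E n) : DifferentiableAt ℝ (fun y : E n => ‖y‖ ^ 2) x :=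
  (hasStrictFDerivAt_norm_sq x).hasFDerivAt.differentiableAt

theorem pd_conf (i : Fin n) {x : E n} (hx : x ∈ ball n) : pd i conf x = conf x ^ 2 * x i := by
  have hs := one_sub_normSq_pos hx
  have h1 : HasDerivAt (fun t : ℝ => 2 / (1 - t)) (2 / (1 - ‖x‖ ^ 2) ^ 2) (‖x‖ ^ 2) := by
    have := (hasDerivAt_const (‖x‖ ^ 2) (2 : ℝ)).div ((hasDerivAt_id (‖x‖ ^ 2)).const_sub 1) hs.ne'
    exact this.congr_deriv (by simp)
  have h2 := pd_comp i h1 (differentiableAt_normSq x)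
  rw [pd_normSq] at h2
  have h3 : pd i (conf : E n → ℝ) x = _ := h2
  rw [h3, conf]
  field_simp

theorem pd_conf_pow (i : Fin n) (k : ℕ) {x : E n} (hx : x ∈ ball n) :
    pd i (fun y => conf y ^ k) x = k * conf x ^ k * conf x * x i := by
  rw [pd_comp i (hasDerivAt_pow k (conf x)) (differentiableAt_conf hx), pd_conf i hx]
  rcases k with _ | k
  · simp
  · simp; ring

theorem pd_conf_pow_inv (i : Fin n) (k : ℕ) {x : E n} (hx : x ∈ ball n) :
    pd i (fun y => (conf y ^ k)⁻¹) x = - k * (conf x ^ k)⁻¹ * conf x * x i := by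
  have hc := (conf_pos hx).ne'
  rw [pd_comp (h := fun t => (t ^ k)⁻¹) i ((hasDerivAt_pow k (conf x)).inv (pow_ne_zero _ hc))
    (differentiableAt_conf hx), pd_conf i hx]
  rcases k with _ | k
  · simp
  · simp; field_simp; ring

theorem contDiffOn_conf_pow (k : ℕ) : ContDiffOn ℝ ∞ (fun x : E n => conf x ^ k) (ball n) :=
  contDiffOn_conf.pow k

theorem contDiffOn_conf_pow_inv (k : ℕ) :
    ContDiffOn ℝ ∞ (fun x : E n => (conf x ^ k)⁻¹) (ball n) :=
  (contDiffOn_conf_pow k).inv fun _ hx => pow_ne_zero _ (conf_pos hx).ne'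

theorem pd_metric (i j k : Fin n) {x : E n} (hx : x ∈ ball n) :
    pd i (metric j k) x = if j = k then 2 * conf x ^ 3 * x i else 0 := by
  by_cases h : j = k
  · have : (metric j k : E n → ℝ) = fun y => conf y ^ 2 := by ext y; simp [metric, h]
    rw [this, pd_conf_pow i 2 hx, if_pos h]; push_cast; ring
  · have : (metric j k : E n → ℝ) = fun y => 0 := by ext y; simp [metric, h]
    rw [this, pd_const, if_neg h]

/-- The metric is conformally flat, so `Γ` only involves the derivatives of `log conf`, and `∂ᵢ log
conf = conf * xᵢ`. -/
theorem christoffel_eq (l i j : Fin n) {x : E n} (hx : x ∈ ball n) :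
    christoffel l i j x = conf x * ((if l = i then x j else 0) + (if l = j then x i else 0)
      - if i = j then x l else 0) := by
  have hc := (conf_pos hx).ne'
  rw [christoffel, Finset.sum_eq_single l]
  · simp only [pd_metric _ _ _ hx, invMetric, if_true]
    simp only [eq_comm (a := l)]
    split_ifs <;> field_simp <;> ring
  · intro k _ hk
    simp [invMetric, hk.symm]
  · simp

theorem contDiffOn_coord (i : Fin n) (s : Set (E n)) : ContDiffOn ℝ ∞ (fun x : E n => x i) s :=
  ((EuclideanSpace.proj i : E n →L[ℝ] ℝ).contDiff).contDiffOn

theorem contDiffOn_christoffel (l i j : Fin n) : ContDiffOn ℝ ∞ (christoffel l i j) (ball n) := by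
  refine ContDiffOn.congr (f := fun x : E n => conf x * ((if l = i then x j else 0) +
    (if l = j then x i else 0) - if i = j then x l else 0)) ?_ fun x hx => christoffel_eq l i j hx
  refine contDiffOn_conf.mul (ContDiffOn.sub (ContDiffOn.add ?_ ?_) ?_) <;> split_ifs <;>
    first | exact contDiffOn_const | exact contDiffOn_coord _ _

theorem contDiffOn_pd {f : E n → ℝ} (hf : ContDiffOn ℝ ∞ f (ball n)) (i : Fin n) :
    ContDiffOn ℝ ∞ (pd i f) (ball n) := by
  have h : ContDiffOn ℝ ∞ (fderiv ℝ f) (ball n) := hf.fderiv_of_isOpen isOpen_ball (by simp)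
  exact h.clm_apply contDiffOn_const

/-! ### Test functions -/

theorem tsupport_pd_subset (i : Fin n) (f : E n → ℝ) : tsupport (pd i f) ⊆ tsupport f := by
  refine (closure_mono ?_).trans (tsupport_fderiv_subset ℝ (f := f))
  intro x hx h
  exact hx (by simp [pd, h])

theorem IsTest.pd {φ : E n → ℝ} (hφ : IsTest φ) (i : Fin n) : IsTest (pd i φ) := by
  refine ⟨?_, hφ.2.1.of_isClosed_subset (isClosed_tsupport _) (tsupport_pd_subset i φ),
    (tsupport_pd_subset i φ).trans hφ.2.2⟩
  exact (hφ.1.fderiv_right (m := ∞) (by simp)).clm_apply contDiff_const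

/-- The factor `g` may blow up at the unit sphere, but the product vanishes off the compact support
of `φ`. This allows powers of `conf` to be moved onto test functions, which is how hyperbolic
integrals are reduced to Euclidean ones. -/
theorem IsTest.smooth_mul {φ g : E n → ℝ} (hφ : IsTest φ) (hg : ContDiffOn ℝ ∞ g (ball n)) :
    IsTest (fun x => g x * φ x) := by
  have hs : tsupport (fun x => g x * φ x) ⊆ tsupport φ := tsupport_mul_subset_right
  refine ⟨?_, hφ.2.1.mul_left, hs.trans hφ.2.2⟩
  rw [contDiff_iff_contDiffAt]
  intro x
  by_cases hx : x ∈ tsupport φ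
  · exact (hg.contDiffAt (isOpen_ball.mem_nhds (hφ.2.2 hx))).mul hφ.1.contDiffAt
  · have : (fun x => g x * φ x) =ᶠ[nhds x] fun _ => 0 := by
      filter_upwards [(isClosed_tsupport φ).isOpen_compl.mem_nhds hx] with y hy
      simp [image_eq_zero_of_notMem_tsupport hy]
    exact contDiffAt_const.congr_of_eventuallyEq this

theorem IsTest.zero : IsTest (fun _ : E n => (0 : ℝ)) := by
  refine ⟨contDiff_const, HasCompactSupport.zero, ?_⟩
  have : tsupport (fun _ : E n => (0 : ℝ)) = ∅ := by rw [tsupport_eq_empty_iff]; rfl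
  simp [this]

theorem IsTest.add {φ ψ : E n → ℝ} (hφ : IsTest φ) (hψ : IsTest ψ) :
    IsTest (fun x => φ x + ψ x) :=
  ⟨hφ.1.add hψ.1, hφ.2.1.add hψ.2.1, (tsupport_add φ ψ).trans (union_subset hφ.2.2 hψ.2.2)⟩

theorem IsTest.sum {ι : Type*} {s : Finset ι} {φ : ι → E n → ℝ} (h : ∀ j ∈ s, IsTest (φ j)) :
    IsTest (fun x => ∑ j ∈ s, φ j x) := by
  classical
  induction s using Finset.induction_on with
  | empty => simpa using IsTest.zero
  | insert a s ha ih =>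
    simp only [Finset.sum_insert ha]
    exact (h a (by simp)).add (ih fun j hj => h j (by simp [hj]))

theorem IsTest.eq_zero {φ : E n → ℝ} (hφ : IsTest φ) {x : E n} (hx : x ∉ ball n) : φ x = 0 :=
  image_eq_zero_of_notMem_tsupport fun h => hx (hφ.2.2 h)

theorem IsTest.differentiable {φ : E n → ℝ} (hφ : IsTest φ) : Differentiable ℝ φ :=
  hφ.1.differentiable (by simp)

theorem IsTest.continuous {φ : E n → ℝ} (hφ : IsTest φ) : Continuous φ := hφ.1.continuous

theorem IsTest.integrable_mul {φ f : E n → ℝ} (hφ : IsTest φ)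
    (hf : LocallyIntegrableOn f (ball n) volume) :
    IntegrableOn (fun x => f x * φ x) (ball n) := by
  have hK : IsCompact (tsupport φ) := hφ.2.1
  have h1 : IntegrableOn f (tsupport φ) := hf.integrableOn_compact_subset hφ.2.2 hK
  have h2 : IntegrableOn (fun x => f x * φ x) (tsupport φ) :=
    h1.mul_continuousOn hφ.continuous.continuousOn hK
  have h3 : Integrable (fun x => f x * φ x) := by
    rw [← integrableOn_iff_integrable_of_support_subset (s := tsupport φ)]
    · exact h2
    · exact (Function.support_mul_subset_right f φ).trans subset_closure
  exact h3.integrableOn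

theorem IsTest.setIntegral {φ : E n → ℝ} (hφ : IsTest φ) : ∫ x in ball n, φ x = ∫ x, φ x :=
  setIntegral_eq_integral_of_forall_compl_eq_zero fun _ hx => hφ.eq_zero hx

theorem integral_pd_eq_zero {f : E n → ℝ} (i : Fin n) (hf : ContDiff ℝ 1 f)
    (hc : HasCompactSupport f) : ∫ x, pd i f x = 0 := by
  have hd : Continuous (pd i f) := (hf.continuous_fderiv (by simp)).clm_apply continuous_const
  have hdc : HasCompactSupport (pd i f) :=
    hc.of_isClosed_subset (isClosed_tsupport _) (tsupport_pd_subset i f)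
  have := integral_mul_fderiv_eq_neg_fderiv_mul_of_integrable (μ := (volume : Measure (E n)))
    (f := fun _ : E n => (1 : ℝ)) (g := f) (v := EuclideanSpace.single i 1) (by simp)
    (by simpa using! hd.integrable_of_hasCompactSupport hdc)
    (by simpa using hf.continuous.integrable_of_hasCompactSupport hc)
    (fun _ _ => differentiableAt_const _) (fun _ _ => hf.differentiable (by simp) _)
  simpa [pd] using this

/-! ### The hyperbolic volume -/

theorem ae_vol_of_ae {P : E n → Prop} (h : ∀ᵐ x ∂((volume : Measure (E n)).restrict (ball n)), P x) :
    ∀ᵐ x ∂(vol n), P x :=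
  (withDensity_absolutelyContinuous _ _) h

theorem measurable_confDensity : Measurable (fun x : E n => ENNReal.ofReal (conf x ^ n)) :=
  (measurable_conf.pow_const n).ennreal_ofReal

theorem ae_vol_mem_ball : ∀ᵐ x ∂(vol n), x ∈ ball n :=
  ae_vol_of_ae (ae_restrict_mem isOpen_ball.measurableSet)

theorem lintegral_vol (f : E n → ℝ≥0∞) :
    ∫⁻ x, f x ∂(vol n) = ∫⁻ x in ball n, ENNReal.ofReal (conf x ^ n) * f x := by
  rw [vol, lintegral_withDensity_eq_lintegral_mul_non_measurable _ measurable_confDensity]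
  · rfl
  · simp

theorem integral_vol (f : E n → ℝ) :
    ∫ x, f x ∂(vol n) = ∫ x in ball n, conf x ^ n * f x := by
  rw [vol, integral_withDensity_eq_integral_toReal_smul measurable_confDensity (by simp)]
  refine setIntegral_congr_fun isOpen_ball.measurableSet fun x hx => ?_
  simp [ENNReal.toReal_ofReal (pow_nonneg (conf_pos hx).le n)]

theorem volume_restrict_le_vol : (volume : Measure (E n)).restrict (ball n) ≤ vol n := by
  refine Measure.le_intro fun s hs _ => ?_
  rw [vol, withDensity_apply _ hs, ← setLIntegral_one, Measure.restrict_restrict hs]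
  refine setLIntegral_mono_ae' (hs.inter isOpen_ball.measurableSet) (ae_of_all _ fun x hx => ?_)
  rw [← ENNReal.ofReal_one]
  exact ENNReal.ofReal_le_ofReal (one_le_pow₀ (by linarith [two_le_conf hx.2]))

/-! ### The Laplace-Beltrami operator -/

theorem laplaceBeltrami_apply (f : E n → ℝ) (x : E n) :
    laplaceBeltrami f x =
      (conf x ^ n)⁻¹ * ∑ i, pd i (fun y => conf y ^ n * ((conf y ^ 2)⁻¹ * pd i f y)) x := by
  simp [laplaceBeltrami, div, grad, gradient_apply]

/-- The flux is `conf^(n-2) ∂ᵢf`; differentiating the weight produces the drift term with the factor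
`n - 2`. -/
theorem laplaceBeltrami_eq {f : E n → ℝ} {x : E n} (hx : x ∈ ball n)
    (hf : ∀ i, DifferentiableAt ℝ (pd i f) x) :
    laplaceBeltrami f x = (conf x ^ 2)⁻¹ *
      (∑ i, pd i (pd i f) x + (n - 2) * conf x * ∑ i, x i * pd i f x) := by
  have hc := (conf_pos hx).ne'
  have key : ∀ i, pd i (fun y => conf y ^ n * ((conf y ^ 2)⁻¹ * pd i f y)) x =
      conf x ^ n * ((conf x ^ 2)⁻¹ * (pd i (pd i f) x + (n - 2) * conf x * (x i * pd i f x))) := by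
    intro i
    have h1 := ContDiffOn.differentiableAt_ball (contDiffOn_conf_pow n) hx
    have h2 := ContDiffOn.differentiableAt_ball (contDiffOn_conf_pow_inv 2) hx
    rw [pd_mul i h1 (h2.fun_mul (hf i)), pd_mul i h2 (hf i), pd_conf_pow i n hx,
      pd_conf_pow_inv i 2 hx]
    push_cast
    ring
  rw [laplaceBeltrami_apply, Finset.sum_congr rfl fun i _ => key i, ← Finset.mul_sum,
    ← Finset.mul_sum, Finset.sum_add_distrib, ← Finset.mul_sum]
  field_simp

theorem IsTest.laplaceBeltrami {φ : E n → ℝ} (hφ : IsTest φ) : IsTest (laplaceBeltrami φ) := by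
  have h : HypBall.laplaceBeltrami φ = fun x => (conf x ^ n)⁻¹ *
      ∑ i, HypBall.pd i (fun y => conf y ^ n * ((conf y ^ 2)⁻¹ * HypBall.pd i φ y)) x := by
    ext x; exact laplaceBeltrami_apply φ x
  rw [h]
  refine IsTest.smooth_mul (IsTest.sum fun i _ => ?_) (contDiffOn_conf_pow_inv n)
  exact (((hφ.pd i).smooth_mul (contDiffOn_conf_pow_inv 2)).smooth_mul (contDiffOn_conf_pow n)).pd i

/-! ### Weak partial derivatives and the weak Laplacian -/

theorem locallyIntegrableOn_congr_ae {f g : E n → ℝ} (hf : LocallyIntegrableOn f (ball n) volume)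
    (h : f =ᵐ[(volume : Measure (E n)).restrict (ball n)] g) :
    LocallyIntegrableOn g (ball n) volume := by
  rw [locallyIntegrableOn_iff isOpen_ball.isLocallyClosed] at hf ⊢
  intro K hK hc
  exact (hf K hK hc).congr_fun_ae (ae_restrict_of_ae_restrict_of_subset hK h)

theorem locallyIntegrableOn_smooth_mul {f g : E n → ℝ}
    (hf : LocallyIntegrableOn f (ball n) volume) (hg : ContDiffOn ℝ ∞ g (ball n)) :
    LocallyIntegrableOn (fun x => g x * f x) (ball n) volume :=
  hf.continuousOn_mul hg.continuousOn isOpen_ball.isLocallyClosed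

theorem locallyIntegrableOn_add {f g : E n → ℝ}
    (hf : LocallyIntegrableOn f (ball n) volume) (hg : LocallyIntegrableOn g (ball n) volume) :
    LocallyIntegrableOn (fun x => f x + g x) (ball n) volume :=
  hf.add hg

theorem locallyIntegrableOn_sum {ι : Type*} {s : Finset ι} {f : ι → E n → ℝ}
    (hf : ∀ i, LocallyIntegrableOn (f i) (ball n) volume) :
    LocallyIntegrableOn (fun x => ∑ i ∈ s, f i x) (ball n) volume := by
  classical
  induction s using Finset.induction_on with
  | empty => simpa using locallyIntegrableOn_const (0 : ℝ)
  | insert a s ha ih =>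
    simp only [Finset.sum_insert ha]
    exact locallyIntegrableOn_add (hf a) ih

theorem locallyIntegrableOn_of_contDiffOn {f : E n → ℝ} (hf : ContDiffOn ℝ ∞ f (ball n)) :
    LocallyIntegrableOn f (ball n) volume :=
  hf.continuousOn.locallyIntegrableOn isOpen_ball.measurableSet

theorem HasWeakPartial.congr_ae {i : Fin n} {v w v' w' : E n → ℝ} (h : HasWeakPartial i v w)
    (hv : v =ᵐ[(volume : Measure (E n)).restrict (ball n)] v')
    (hw : w =ᵐ[(volume : Measure (E n)).restrict (ball n)] w') : HasWeakPartial i v' w' := by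
  refine ⟨locallyIntegrableOn_congr_ae h.1 hv, locallyIntegrableOn_congr_ae h.2.1 hw,
    fun φ hφ => ?_⟩
  have h1 : ∫ x in ball n, v' x * pd i φ x = ∫ x in ball n, v x * pd i φ x :=
    integral_congr_ae (by filter_upwards [hv] with x hx; rw [hx])
  have h2 : ∫ x in ball n, w' x * φ x = ∫ x in ball n, w x * φ x :=
    integral_congr_ae (by filter_upwards [hw] with x hx; rw [hx])
  rw [h1, h2, h.2.2 φ hφ]

theorem HasWeakPartial.congr_on {i : Fin n} {v w v' w' : E n → ℝ} (h : HasWeakPartial i v w)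
    (hv : ∀ x ∈ ball n, v x = v' x) (hw : ∀ x ∈ ball n, w x = w' x) : HasWeakPartial i v' w' :=
  h.congr_ae
    (by filter_upwards [ae_restrict_mem isOpen_ball.measurableSet] with x hx using hv x hx)
    (by filter_upwards [ae_restrict_mem isOpen_ball.measurableSet] with x hx using hw x hx)

theorem HasWeakPartial.smooth_mul {i : Fin n} {v w g : E n → ℝ} (h : HasWeakPartial i v w)
    (hg : ContDiffOn ℝ ∞ g (ball n)) :
    HasWeakPartial i (fun x => g x * v x) (fun x => g x * w x + pd i g x * v x) := by
  refine ⟨locallyIntegrableOn_smooth_mul h.1 hg, locallyIntegrableOn_add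
    (locallyIntegrableOn_smooth_mul h.2.1 hg)
    (locallyIntegrableOn_smooth_mul h.1 (contDiffOn_pd hg i)), fun φ hφ => ?_⟩
  have hgφ := hφ.smooth_mul hg
  have hdgφ := hφ.smooth_mul (contDiffOn_pd hg i)
  have h1 : ∫ x in ball n, g x * v x * pd i φ x =
      ∫ x in ball n, (v x * pd i (fun y => g y * φ y) x - v x * (pd i g x * φ x)) := by
    refine setIntegral_congr_fun isOpen_ball.measurableSet fun x hx => ?_
    simp only [pd_mul i (ContDiffOn.differentiableAt_ball hg hx) (hφ.differentiable x)]
    ring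
  have h2 : ∫ x in ball n, (g x * w x + pd i g x * v x) * φ x =
      ∫ x in ball n, (w x * (g x * φ x) + v x * (pd i g x * φ x)) := by
    congr 1; ext x; ring
  rw [h1, h2, integral_sub ((hgφ.pd i).integrable_mul h.1) (hdgφ.integrable_mul h.1),
    integral_add (hgφ.integrable_mul h.2.1) (hdgφ.integrable_mul h.1), h.2.2 _ hgφ]
  ring

theorem HasWeakPartial.add {i : Fin n} {v w v' w' : E n → ℝ} (h : HasWeakPartial i v w)
    (h' : HasWeakPartial i v' w') :
    HasWeakPartial i (fun x => v x + v' x) (fun x => w x + w' x) := by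
  refine ⟨locallyIntegrableOn_add h.1 h'.1, locallyIntegrableOn_add h.2.1 h'.2.1, fun φ hφ => ?_⟩
  simp only [add_mul]
  rw [integral_add ((hφ.pd i).integrable_mul h.1) ((hφ.pd i).integrable_mul h'.1),
    integral_add (hφ.integrable_mul h.2.1) (hφ.integrable_mul h'.2.1), h.2.2 φ hφ, h'.2.2 φ hφ]
  ring

theorem HasWeakPartial.zero (i : Fin n) : HasWeakPartial i (fun _ => 0) (fun _ => 0) :=
  ⟨locallyIntegrableOn_of_contDiffOn contDiffOn_const,
    locallyIntegrableOn_of_contDiffOn contDiffOn_const, fun φ _ => by simp⟩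

theorem HasWeakPartial.sum {ι : Type*} {s : Finset ι} {i : Fin n} {v w : ι → E n → ℝ}
    (h : ∀ j ∈ s, HasWeakPartial i (v j) (w j)) :
    HasWeakPartial i (fun x => ∑ j ∈ s, v j x) (fun x => ∑ j ∈ s, w j x) := by
  classical
  induction s using Finset.induction_on with
  | empty => simpa using HasWeakPartial.zero i
  | insert a s ha ih =>
    simp only [Finset.sum_insert ha]
    exact (h a (by simp)).add (ih fun j hj => h j (by simp [hj]))

theorem hasWeakPartial_of_contDiffOn (i : Fin n) {v : E n → ℝ} (hv : ContDiffOn ℝ ∞ v (ball n)) :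
    HasWeakPartial i v (pd i v) := by
  refine ⟨locallyIntegrableOn_of_contDiffOn hv,
    locallyIntegrableOn_of_contDiffOn (contDiffOn_pd hv i), fun φ hφ => ?_⟩
  have h1 := (hφ.pd i).integrable_mul (locallyIntegrableOn_of_contDiffOn hv)
  have h2 := hφ.integrable_mul (locallyIntegrableOn_of_contDiffOn (contDiffOn_pd hv i))
  rw [eq_neg_iff_add_eq_zero, ← integral_add h1 h2]
  have hvφ := hφ.smooth_mul hv
  rw [← integral_pd_eq_zero i (hvφ.1.of_le (by simp)) hvφ.2.1, ← (hvφ.pd i).setIntegral]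
  refine setIntegral_congr_fun isOpen_ball.measurableSet fun x hx => ?_
  simp only [pd_mul i (ContDiffOn.differentiableAt_ball hv hx) (hφ.differentiable x)]

theorem ae_eq_of_forall_integral_test {v w : E n → ℝ}
    (hv : LocallyIntegrableOn v (ball n) volume) (hw : LocallyIntegrableOn w (ball n) volume)
    (h : ∀ φ, IsTest φ → ∫ x in ball n, v x * φ x = ∫ x in ball n, w x * φ x) :
    v =ᵐ[(volume : Measure (E n)).restrict (ball n)] w := by
  have h0 := isOpen_ball.ae_eq_zero_of_integral_contDiff_smul_eq_zero (hv.sub hw)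
    fun g hg hc hs => ?_
  · rw [Filter.EventuallyEq, ae_restrict_iff' isOpen_ball.measurableSet]
    filter_upwards [h0] with x hx hxb
    simpa [sub_eq_zero] using hx hxb
  · have hφ : IsTest g := ⟨hg, hc, hs⟩
    rw [← setIntegral_eq_integral_of_forall_compl_eq_zero (s := ball n)
      fun x hx => by simp [hφ.eq_zero hx]]
    have := h g hφ
    rw [← sub_eq_zero, ← integral_sub (hφ.integrable_mul hv) (hφ.integrable_mul hw)] at this
    rw [← this]
    congr 1; ext x; simp; ring

theorem HasWeakPartial.ae_unique {i : Fin n} {v w w' : E n → ℝ} (h : HasWeakPartial i v w)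
    (h' : HasWeakPartial i v w') : w =ᵐ[(volume : Measure (E n)).restrict (ball n)] w' := by
  refine ae_eq_of_forall_integral_test h.2.1 h'.2.1 fun φ hφ => ?_
  have h1 := h.2.2 φ hφ
  have h2 := h'.2.2 φ hφ
  linarith

theorem hasWeakLaplacian_iff {v w : E n → ℝ} : HasWeakLaplacian v w ↔
    LocallyIntegrableOn v (ball n) volume ∧ LocallyIntegrableOn w (ball n) volume ∧
    ∀ φ : E n → ℝ, IsTest φ → ∫ x in ball n, conf x ^ n * (v x * laplaceBeltrami φ x) =
      ∫ x in ball n, conf x ^ n * (w x * φ x) := by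
  simp only [HasWeakLaplacian, integral_vol]

theorem HasWeakLaplacian.congr_ae {v w v' w' : E n → ℝ} (h : HasWeakLaplacian v w)
    (hv : v =ᵐ[(volume : Measure (E n)).restrict (ball n)] v')
    (hw : w =ᵐ[(volume : Measure (E n)).restrict (ball n)] w') : HasWeakLaplacian v' w' := by
  rw [hasWeakLaplacian_iff] at h ⊢
  refine ⟨locallyIntegrableOn_congr_ae h.1 hv, locallyIntegrableOn_congr_ae h.2.1 hw,
    fun φ hφ => ?_⟩
  have h1 : ∫ x in ball n, conf x ^ n * (v' x * laplaceBeltrami φ x) =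
      ∫ x in ball n, conf x ^ n * (v x * laplaceBeltrami φ x) :=
    integral_congr_ae (by filter_upwards [hv] with x hx; rw [hx])
  have h2 : ∫ x in ball n, conf x ^ n * (w' x * φ x) = ∫ x in ball n, conf x ^ n * (w x * φ x) :=
    integral_congr_ae (by filter_upwards [hw] with x hx; rw [hx])
  rw [h1, h2, h.2.2 φ hφ]

theorem HasWeakLaplacian.ae_unique {v w w' : E n → ℝ} (h : HasWeakLaplacian v w)
    (h' : HasWeakLaplacian v w') : w =ᵐ[(volume : Measure (E n)).restrict (ball n)] w' := by
  rw [hasWeakLaplacian_iff] at h h'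
  refine ae_eq_of_forall_integral_test h.2.1 h'.2.1 fun φ hφ => ?_
  -- Testing with `φ / conf^n` cancels the volume density and leaves the Euclidean fundamental
  -- lemma.
  have hψ := hφ.smooth_mul (contDiffOn_conf_pow_inv n)
  have key : ∀ w : E n → ℝ, ∫ x in ball n, w x * φ x =
      ∫ x in ball n, conf x ^ n * (w x * ((conf x ^ n)⁻¹ * φ x)) := fun w => by
    refine setIntegral_congr_fun isOpen_ball.measurableSet fun x hx => ?_
    have := (pow_pos (conf_pos hx) n).ne'
    field_simp
  rw [key w, key w', ← h.2.2 _ hψ, h'.2.2 _ hψ]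

/-- Weak partial derivatives of order two give the weak Laplacian. -/
theorem hasWeakLaplacian_of_hasWeakPartial {v : E n → ℝ} {w : Fin n → E n → ℝ}
    {z : Fin n → E n → ℝ} (h1 : ∀ i, HasWeakPartial i v (w i))
    (h2 : ∀ i, HasWeakPartial i (w i) (z i)) (hv : LocallyIntegrableOn v (ball n) volume) :
    HasWeakLaplacian v (fun x => (conf x ^ 2)⁻¹ *
      (∑ i, z i x + ((n : ℝ) - 2) * conf x * ∑ i, x i * w i x)) := by
  have hpart : ∀ i, HasWeakPartial i
      (fun x => conf x ^ n * ((conf x ^ 2)⁻¹ * w i x))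
      (fun x => conf x ^ n * (conf x ^ 2)⁻¹ *
        (z i x + ((n : ℝ) - 2) * conf x * (x i * w i x))) := fun i => by
    refine (((h2 i).smooth_mul (contDiffOn_conf_pow_inv 2)).smooth_mul
      (contDiffOn_conf_pow n)).congr_on (fun x _ => rfl) fun x hx => ?_
    rw [pd_conf_pow i n hx, pd_conf_pow_inv i 2 hx]
    push_cast; ring
  have hloc : LocallyIntegrableOn (fun x => (conf x ^ n)⁻¹ * ∑ i, conf x ^ n * (conf x ^ 2)⁻¹ *
        (z i x + ((n : ℝ) - 2) * conf x * (x i * w i x))) (ball n) volume := by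
    refine locallyIntegrableOn_smooth_mul ?_ (contDiffOn_conf_pow_inv n)
    exact locallyIntegrableOn_sum fun i => (hpart i).2.1
  have heq : ∀ x ∈ ball n, (conf x ^ n)⁻¹ * ∑ i, conf x ^ n * (conf x ^ 2)⁻¹ *
        (z i x + ((n : ℝ) - 2) * conf x * (x i * w i x)) = (conf x ^ 2)⁻¹ *
      (∑ i, z i x + ((n : ℝ) - 2) * conf x * ∑ i, x i * w i x) := fun x hx => by
    have := (pow_pos (conf_pos hx) n).ne'
    rw [← Finset.mul_sum, Finset.sum_add_distrib, Finset.mul_sum (a := ((n : ℝ) - 2) * conf x)]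
    field_simp
  rw [hasWeakLaplacian_iff]
  refine ⟨hv, locallyIntegrableOn_congr_ae hloc ?_, fun φ hφ => ?_⟩
  · filter_upwards [ae_restrict_mem isOpen_ball.measurableSet] with x hx using heq x hx
  have e1 : ∫ x in ball n, conf x ^ n * (v x * laplaceBeltrami φ x) =
      ∫ x in ball n, ∑ i, v x * pd i (fun y => conf y ^ n * ((conf y ^ 2)⁻¹ * pd i φ y)) x := by
    refine setIntegral_congr_fun isOpen_ball.measurableSet fun x hx => ?_
    have := (pow_pos (conf_pos hx) n).ne'
    simp only [laplaceBeltrami_apply, ← Finset.mul_sum]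
    field_simp
  have e2 : ∫ x in ball n, conf x ^ n * (((conf x ^ 2)⁻¹ *
      (∑ i, z i x + ((n : ℝ) - 2) * conf x * ∑ i, x i * w i x)) * φ x) =
      ∫ x in ball n, ∑ i, (conf x ^ n * (conf x ^ 2)⁻¹ *
        (z i x + ((n : ℝ) - 2) * conf x * (x i * w i x))) * φ x := by
    refine setIntegral_congr_fun isOpen_ball.measurableSet fun x hx => ?_
    have := (pow_pos (conf_pos hx) n).ne'
    simp only [← heq x hx, ← Finset.sum_mul]
    field_simp
  have ht : ∀ i, IsTest fun y => conf y ^ n * ((conf y ^ 2)⁻¹ * pd i φ y) := fun i =>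
    ((hφ.pd i).smooth_mul (contDiffOn_conf_pow_inv 2)).smooth_mul (contDiffOn_conf_pow n)
  rw [e1, e2, integral_finsetSum _ fun i _ => ((ht i).pd i).integrable_mul hv,
    integral_finsetSum _ fun i _ => hφ.integrable_mul (hpart i).2.1]
  refine Finset.sum_congr rfl fun i _ => ?_
  -- Two weak integrations by parts: `h1` is tested on the flux of `φ`, the weight passes from `∂ᵢφ`
  -- to `w i`, and `hpart` is tested on `φ`.
  rw [(h1 i).2.2 _ (ht i), ← neg_eq_iff_eq_neg.mpr ((hpart i).2.2 φ hφ)]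
  congr 1
  exact integral_congr_ae (ae_of_all _ fun x => by ring)

/-! ### Contraction of tensor fields -/

theorem memLp_tensor_iff {k : ℕ} {T : TensorField n k} {p : ℝ≥0∞} [Fact (1 ≤ p)]
    {μ : Measure (E n)} (c : E n → ℝ) :
    MemLp (fun x => c x • T x) p μ ↔ ∀ J, MemLp (fun x => c x * T x J) p μ := by
  rw [memLp_piLp_iff]; rfl

/-- The `g`-trace of a tensor field in its last two indices. -/
def contract {k : ℕ} (T : TensorField n (k + 2)) : TensorField n k := fun x =>
  WithLp.toLp 2 fun J => (conf x ^ 2)⁻¹ *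
    ∑ a, T x (Fin.snoc (α := fun _ => Fin n) (Fin.snoc (α := fun _ => Fin n) J a) a)

theorem contract_apply {k : ℕ} (T : TensorField n (k + 2)) (x : E n) (J : Fin k → Fin n) :
    contract T x J = (conf x ^ 2)⁻¹ *
      ∑ a, T x (Fin.snoc (α := fun _ => Fin n) (Fin.snoc (α := fun _ => Fin n) J a) a) := rfl

/-- The metric is parallel: Christoffel symbols cancel in the trace up to the derivative of the
conformal factor. -/
theorem sum_christoffel_trace (i : Fin n) (A : Fin n → Fin n → ℝ) {x : E n} (hx : x ∈ ball n) :
    ∑ a, (∑ l, christoffel l i a x * A l a + ∑ l, christoffel l i a x * A a l) =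
      2 * conf x * x i * ∑ a, A a a := by
  rw [Finset.sum_add_distrib, Finset.sum_comm, ← Finset.sum_add_distrib, Finset.mul_sum]
  refine Finset.sum_congr rfl fun a _ => ?_
  rw [← Finset.sum_add_distrib, Finset.sum_eq_single a]
  · simp only [christoffel_eq _ _ _ hx]
    by_cases h : a = i
    · subst h; simp; ring
    · simp [h, Ne.symm h]; ring
  · intro b _ hb
    simp only [christoffel_eq _ _ _ hx, hb, hb.symm, if_false]
    simp only [eq_comm (a := i)]
    split_ifs <;> ring
  · simp

/-- Since `∇g = 0`, traces commute with `∇`. Differentiation adds its index in front, so the last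
two indices of `∇^(k+2) u` belong to the two innermost derivatives, and tracing them gives `∇^k
(Δu)`. -/
theorem HasWeakCovDeriv.contract {k : ℕ} {T : TensorField n (k + 2)} {S : TensorField n (k + 3)}
    (h : HasWeakCovDeriv T S) :
    HasWeakCovDeriv (contract T) (HypBall.contract (k := k + 1) S) := by
  intro i J
  refine ((HasWeakPartial.sum (s := Finset.univ) fun a _ => h i
    (Fin.snoc (α := fun _ => Fin n) (Fin.snoc (α := fun _ => Fin n) J a) a)).smooth_mul
      (contDiffOn_conf_pow_inv 2)).congr_on (fun x _ => rfl) fun x hx => ?_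
  -- The derivative of the factor `conf^(-2)` contributes `-2 conf xᵢ` times the trace; the
  -- Christoffel terms of the two traced indices (`h1`) cancel it.
  rw [pd_conf_pow_inv i 2 hx]
  simp only [contract_apply, Fin.sum_univ_castSucc, Fin.snoc_castSucc, Fin.snoc_last,
    ← Fin.snoc_update, Fin.update_snoc_last, Fin.cons_snoc_eq_snoc_cons]
  have h1 := sum_christoffel_trace i (fun l a => T x
    (Fin.snoc (α := fun _ => Fin n) (Fin.snoc (α := fun _ => Fin n) J l) a)) hx
  have h2 : ∑ a, ∑ s : Fin k, ∑ l, christoffel l i (J s) x * T x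
      (Fin.snoc (α := fun _ => Fin n) (Fin.snoc (α := fun _ => Fin n) (Function.update J s l) a) a) =
      ∑ s : Fin k, ∑ l, christoffel l i (J s) x * ∑ a, T x
      (Fin.snoc (α := fun _ => Fin n) (Fin.snoc (α := fun _ => Fin n) (Function.update J s l) a) a)
      := by
    rw [Finset.sum_comm]
    refine Finset.sum_congr rfl fun s _ => ?_
    rw [Finset.sum_comm]
    refine Finset.sum_congr rfl fun l _ => ?_
    rw [Finset.mul_sum]
  have h3 : ∑ s : Fin k, ∑ l, christoffel l i (J s) x * ((conf x ^ 2)⁻¹ * ∑ a, T x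
      (Fin.snoc (α := fun _ => Fin n) (Fin.snoc (α := fun _ => Fin n) (Function.update J s l) a) a))
      = (conf x ^ 2)⁻¹ * ∑ s : Fin k, ∑ l, christoffel l i (J s) x * ∑ a, T x
      (Fin.snoc (α := fun _ => Fin n) (Fin.snoc (α := fun _ => Fin n) (Function.update J s l) a) a)
      := by
    simp only [Finset.mul_sum]
    refine Finset.sum_congr rfl fun s _ => Finset.sum_congr rfl fun l _ =>
      Finset.sum_congr rfl fun a _ => by ring
  rw [h3, ← h2]
  simp only [add_assoc] at h1 ⊢
  rw [Finset.sum_add_distrib, Finset.sum_add_distrib, h1]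
  push_cast
  ring

theorem memLp_contract {k : ℕ} {T : TensorField n (k + 2)} {p : ℝ≥0∞} [Fact (1 ≤ p)]
    {μ : Measure (E n)} (h : MemLp (fun x => (conf x ^ (k + 2))⁻¹ • T x) p μ) :
    MemLp (fun x => (conf x ^ k)⁻¹ • contract T x) p μ := by
  rw [memLp_tensor_iff] at h ⊢
  intro J
  refine (memLp_finsetSum Finset.univ fun a _ =>
    h (Fin.snoc (α := fun _ => Fin n) (Fin.snoc (α := fun _ => Fin n) J a) a)).ae_eq
    (ae_of_all _ fun x => ?_)
  simp only [contract_apply, Finset.mul_sum]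
  refine Finset.sum_congr rfl fun a _ => ?_
  rw [pow_add, mul_inv]; ring

/-! ### The Sobolev spaces -/

theorem fact_one_le {p : ℝ} (hp : 1 < p) : Fact (1 ≤ ENNReal.ofReal p) :=
  ⟨by rw [← ENNReal.ofReal_one]; exact ENNReal.ofReal_le_ofReal hp.le⟩

theorem aestronglyMeasurable_vol {b : E n → ℝ} (hb : ContinuousOn b (ball n)) :
    AEStronglyMeasurable b (vol n) :=
  (hb.aestronglyMeasurable isOpen_ball.measurableSet).mono_ac (withDensity_absolutelyContinuous _ _)

theorem memLp_bdd_mul {b f : E n → ℝ} {c : ℝ} {p : ℝ≥0∞} (hb : ContinuousOn b (ball n))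
    (hc : ∀ x ∈ ball n, |b x| ≤ c) (hf : MemLp f p (vol n)) :
    MemLp (fun x => b x * f x) p (vol n) := by
  refine hf.of_le_mul (c := c) ((aestronglyMeasurable_vol hb).mul hf.1) ?_
  filter_upwards [ae_vol_mem_ball] with x hx
  rw [norm_mul]
  exact mul_le_mul_of_nonneg_right (hc x hx) (norm_nonneg _)

theorem cons_elim0 (i : Fin n) :
    (Fin.cons i Fin.elim0 : Fin 1 → Fin n) = fun _ => i := by
  funext j
  rw [Fin.eq_zero j]; rfl

theorem update_const (j l : Fin n) (s : Fin 1) :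
    Function.update (fun _ : Fin 1 => j) s l = fun _ => l := by
  funext t
  rw [Subsingleton.elim t s]; simp

/-- `MemSobolev` asks for `T 0 = u` everywhere, so only the tensor of order zero is replaced; the
derivatives can stay. -/
theorem MemSobolev.congr_ae {m : ℕ} {p : ℝ} {u v : E n → ℝ} (h : MemSobolev m p u)
    (huv : u =ᵐ[(volume : Measure (E n)).restrict (ball n)] v) : MemSobolev m p v := by
  classical
  obtain ⟨T, h0, hT, hL⟩ := h
  refine ⟨fun k => match k with
    | 0 => fun x => WithLp.toLp 2 fun _ => v x
    | k + 1 => T (k + 1), fun x J => rfl, ?_, ?_⟩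
  · rintro (_ | k) hk
    · intro i J
      refine (hT 0 hk i J).congr_ae ?_ ?_
      · filter_upwards [huv] with x hx
        simp only [h0, hx]
      · simp
    · exact hT (k + 1) hk
  · rintro (_ | k) hk
    · refine (hL 0 hk).ae_eq (ae_vol_of_ae ?_)
      filter_upwards [huv] with x hx
      congr 1
      ext J
      simp only [h0, hx]
    · exact hL (k + 1) hk

theorem MemSobolev.memLp {m : ℕ} {p : ℝ} (hp : 1 < p) {u : E n → ℝ} (h : MemSobolev m p u) :
    MemLp u (ENNReal.ofReal p) (vol n) := by
  obtain ⟨T, h0, hT, hL⟩ := h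
  have := fact_one_le hp
  have h1 := hL 0 (Nat.zero_le _)
  rw [memLp_tensor_iff] at h1
  exact (h1 Fin.elim0).ae_eq (ae_of_all _ fun x => by simp [h0])

/-- A function of class `W^{1,p}`, with its weak partial derivatives. -/
theorem MemSobolev.exists_partials {p : ℝ} (hp : 1 < p) {u : E n → ℝ} (h : MemSobolev 1 p u) :
    ∃ w : Fin n → E n → ℝ, (∀ i, HasWeakPartial i u (w i)) ∧
      ∀ i, MemLp (fun x => (conf x)⁻¹ * w i x) (ENNReal.ofReal p) (vol n) := by
  obtain ⟨T, h0, hT, hL⟩ := h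
  have := fact_one_le hp
  refine ⟨fun i x => T 1 x (fun _ => i), fun i => ?_, fun i => ?_⟩
  · refine (hT 0 one_pos i Fin.elim0).congr_on (fun x _ => h0 x _) fun x _ => ?_
    simp only [Finset.univ_eq_empty, Finset.sum_empty, add_zero]
    rw [cons_elim0]
  · have h1 := hL 1 le_rfl
    rw [memLp_tensor_iff] at h1
    simpa using h1 fun _ => i

/-- A function of class `W^{2,p}`, with its weak partial derivatives of order at most two. -/
theorem MemSobolev.exists_second_partials {p : ℝ} (hp : 1 < p) {m : ℕ} {u : E n → ℝ}
    (h : MemSobolev (m + 2) p u) :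
    ∃ (w : Fin n → E n → ℝ) (z : Fin n → Fin n → E n → ℝ) (v : E n → ℝ),
      (∀ i, HasWeakPartial i u (w i)) ∧
      (∀ i, MemLp (fun x => (conf x)⁻¹ * w i x) (ENNReal.ofReal p) (vol n)) ∧
      (∀ i j, HasWeakPartial i (w j) (z i j)) ∧
      (∀ i j, MemLp (fun x => (conf x ^ 2)⁻¹ * z i j x) (ENNReal.ofReal p) (vol n)) ∧
      MemSobolev m p v ∧
      ∀ x ∈ ball n, v x = (conf x ^ 2)⁻¹ *
        (∑ i, z i i x + ((n : ℝ) - 2) * conf x * ∑ i, x i * w i x) := by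
  obtain ⟨T, h0, hT, hL⟩ := h
  have := fact_one_le hp
  set ii : Fin n → Fin n → Fin 2 → Fin n := fun i j => Fin.cons i fun _ => j with hii
  have hL1 : ∀ i, MemLp (fun x => (conf x)⁻¹ * T 1 x (fun _ => i)) (ENNReal.ofReal p) (vol n) := by
    intro i
    have h1 := hL 1 (by omega)
    rw [memLp_tensor_iff] at h1
    simpa using h1 fun _ => i
  have hL2 : ∀ J, MemLp (fun x => (conf x ^ 2)⁻¹ * T 2 x J) (ENNReal.ofReal p) (vol n) := by
    have h1 := hL 2 (by omega)
    rwa [memLp_tensor_iff] at h1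
  refine ⟨fun i x => T 1 x (fun _ => i),
    fun i j x => T 2 x (ii i j) + ∑ l, christoffel l i j x * T 1 x (fun _ => l),
    fun x => contract (T 2) x Fin.elim0, fun i => ?_, hL1, fun i j => ?_, fun i j => ?_, ?_, ?_⟩
  · refine (hT 0 (by omega) i Fin.elim0).congr_on (fun x _ => h0 x _) fun x _ => ?_
    simp only [Finset.univ_eq_empty, Finset.sum_empty, add_zero]
    rw [cons_elim0]
  · refine (hT 1 (by omega) i (fun _ => j)).congr_on (fun x _ => rfl) fun x _ => ?_
    simp only [Finset.univ_unique, Finset.sum_singleton, hii]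
    congr 1
    refine Finset.sum_congr rfl fun l _ => ?_
    rw [update_const]
  · have hb : ∀ l, MemLp (fun x => ((conf x)⁻¹ * christoffel l i j x) *
        ((conf x)⁻¹ * T 1 x (fun _ => l))) (ENNReal.ofReal p) (vol n) := by
      intro l
      -- `Γ / conf` is a sum of three terms, each bounded by a coordinate of `x`, hence by `1`.
      refine memLp_bdd_mul (c := 3)
        (contDiffOn_conf_inv.mul (contDiffOn_christoffel l i j)).continuousOn (fun x hx => ?_) (hL1 l)
      · rw [christoffel_eq _ _ _ hx, inv_mul_cancel_left₀ (conf_pos hx).ne']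
        have hx1 : ‖x‖ < 1 := by simpa using hx
        have hxi : ∀ i, |x i| ≤ 1 := fun i => (PiLp.norm_apply_le x i).trans hx1.le
        have e1 : |if l = i then x j else 0| ≤ 1 := by split_ifs <;> simp [hxi]
        have e2 : |if l = j then x i else 0| ≤ 1 := by split_ifs <;> simp [hxi]
        have e3 : |if i = j then x l else 0| ≤ 1 := by split_ifs <;> simp [hxi]
        rw [abs_le] at *
        constructor <;> linarith
    refine ((hL2 (ii i j)).add (memLp_finsetSum Finset.univ fun l _ => hb l)).ae_eq
      (ae_of_all _ fun x => ?_)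
    simp only [Pi.add_apply, mul_add, Finset.mul_sum]
    congr 1
    refine Finset.sum_congr rfl fun l _ => by rw [pow_two, mul_inv]; ring
  -- The derivatives of the Laplacian are the traced derivatives of `u`, shifted by two orders.
  · refine ⟨fun k => contract (T (k + 2)), fun x J => ?_, fun k hk => ?_, fun k hk => ?_⟩
    · rw [Subsingleton.elim J Fin.elim0]
    · exact (hT (k + 2) (by omega)).contract
    · exact memLp_contract (hL (k + 2) (by omega))
  · intro x hx
    simp only [contract_apply]
    congr 1
    have e1 : ∀ a, T 2 x (Fin.snoc (α := fun _ => Fin n)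
        (Fin.snoc (α := fun _ => Fin n) Fin.elim0 a) a) = T 2 x (ii a a) := by
      intro a
      refine congrArg (T 2 x) (funext fun j => ?_)
      fin_cases j <;> rfl
    -- `∑ᵢ Γ^l_{ii} = (1 + 1 - n) conf x_l`; this is the drift term of `laplaceBeltrami_eq` with the
    -- opposite sign.
    have e2 : ∑ i, ∑ l, christoffel l i i x * T 1 x (fun _ => l) =
        -(((n : ℝ) - 2) * conf x * ∑ i, x i * T 1 x (fun _ => i)) := by
      rw [Finset.sum_comm, Finset.mul_sum, ← Finset.sum_neg_distrib]
      refine Finset.sum_congr rfl fun l _ => ?_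
      rw [← Finset.sum_mul]
      simp only [christoffel_eq _ _ _ hx, ← Finset.mul_sum, Finset.sum_sub_distrib,
        Finset.sum_add_distrib, if_true, Finset.sum_const, Finset.sum_ite_eq, Finset.mem_univ,
        Finset.card_univ, Fintype.card_fin, nsmul_eq_mul]
      ring
    simp only [e1]
    rw [Finset.sum_add_distrib, e2]
    ring

/-! ### Compactly supported functions of finite smoothness -/

/-- Functions of class `C^k` with compact support inside the ball. -/
def IsTestOf (k : ℕ∞) (φ : E n → ℝ) : Prop :=
  ContDiff ℝ k φ ∧ HasCompactSupport φ ∧ tsupport φ ⊆ ball n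

theorem IsTest.isTestOf {φ : E n → ℝ} (hφ : IsTest φ) (k : ℕ∞) : IsTestOf k φ :=
  ⟨hφ.1.of_le (by exact_mod_cast le_top), hφ.2⟩

theorem contDiff_of_contDiffOn_tsupport {k : ℕ∞} {f φ : E n → ℝ} (hf : ContDiffOn ℝ k f (ball n))
    (hφ : tsupport φ ⊆ ball n) (h0 : ∀ x ∉ tsupport φ, f x = 0) : ContDiff ℝ k f := by
  rw [contDiff_iff_contDiffAt]
  intro x
  by_cases hx : x ∈ tsupport φ
  · exact hf.contDiffAt (isOpen_ball.mem_nhds (hφ hx))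
  · have : f =ᶠ[nhds x] fun _ => 0 := by
      filter_upwards [(isClosed_tsupport φ).isOpen_compl.mem_nhds hx] with y hy using h0 y hy
    exact contDiffAt_const.congr_of_eventuallyEq this

theorem IsTestOf.of_contDiffOn {k l : ℕ∞} {f φ : E n → ℝ} (hφ : IsTestOf l φ)
    (hf : ContDiffOn ℝ k f (ball n)) (h0 : ∀ x, φ x = 0 → f x = 0) : IsTestOf k f := by
  have hs : tsupport f ⊆ tsupport φ := closure_mono fun x hx h => hx (h0 x h)
  exact ⟨contDiff_of_contDiffOn_tsupport hf hφ.2.2 fun x hx =>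
    h0 x (image_eq_zero_of_notMem_tsupport hx),
    hφ.2.1.of_isClosed_subset (isClosed_tsupport _) hs, hs.trans hφ.2.2⟩

theorem IsTestOf.smooth_mul {k : ℕ∞} {φ g : E n → ℝ} (hφ : IsTestOf k φ)
    (hg : ContDiffOn ℝ ∞ g (ball n)) : IsTestOf k (fun x => g x * φ x) :=
  hφ.of_contDiffOn ((hg.of_le (by exact_mod_cast le_top)).mul hφ.1.contDiffOn)
    fun x hx => by simp [hx]

theorem IsTestOf.integrable_vol {k : ℕ∞} {φ : E n → ℝ} (hφ : IsTestOf k φ) :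
    Integrable φ (vol n) := by
  have h1 := hφ.smooth_mul (contDiffOn_conf_pow n)
  have h2 : Integrable (fun x => conf x ^ n * φ x) :=
    h1.1.continuous.integrable_of_hasCompactSupport h1.2.1
  rw [vol, integrable_withDensity_iff_integrable_smul' measurable_confDensity (by simp)]
  refine h2.restrict.congr ?_
  filter_upwards [ae_restrict_mem isOpen_ball.measurableSet] with x hx
  simp [ENNReal.toReal_ofReal (pow_nonneg (conf_pos hx).le n)]

theorem vol_lt_top_of_isCompact {K : Set (E n)} (hK : IsCompact K) (hKb : K ⊆ ball n) :
    vol n K < (⊤ : ℝ≥0∞) := by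
  have h : IntegrableOn (fun x : E n => conf x ^ n) K :=
    ((contDiffOn_conf_pow n).continuousOn.mono hKb).integrableOn_compact hK
  rw [vol, withDensity_apply _ hK.measurableSet, Measure.restrict_restrict hK.measurableSet,
    inter_eq_left.mpr hKb]
  exact Integrable.lintegral_lt_top h

/-- Dominated convergence with the bound `C` on `K`, whose hyperbolic volume is finite. It serves to
remove the regularization parameter. -/
theorem tendsto_integral_vol {G : ℝ → E n → ℝ} {G₀ : E n → ℝ} {K : Set (E n)} {C : ℝ}
    (hK : IsCompact K) (hKb : K ⊆ ball n) (hc : ∀ e ∈ Ioo (0 : ℝ) 1, ContinuousOn (G e) (ball n))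
    (hC : ∀ e ∈ Ioo (0 : ℝ) 1, ∀ x ∈ K, |G e x| ≤ C) (h0 : ∀ e, ∀ x ∉ K, G e x = 0)
    (hl : ∀ x ∈ ball n, Filter.Tendsto (fun e => G e x) (nhdsWithin 0 (Ioi 0)) (nhds (G₀ x))) :
    Filter.Tendsto (fun e => ∫ x, G e x ∂(vol n)) (nhdsWithin 0 (Ioi 0))
      (nhds (∫ x, G₀ x ∂(vol n))) := by
  have hev : ∀ᶠ e : ℝ in nhdsWithin 0 (Ioi 0), e ∈ Ioo (0 : ℝ) 1 :=
    Ioo_mem_nhdsGT one_pos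
  refine tendsto_integral_filter_of_dominated_convergence (K.indicator fun _ => C) ?_ ?_ ?_ ?_
  · filter_upwards [hev] with e he using aestronglyMeasurable_vol (hc e he)
  · filter_upwards [hev] with e he
    refine ae_of_all _ fun x => ?_
    by_cases hx : x ∈ K
    · simpa [hx] using hC e he x hx
    · simp [hx, h0 e x hx]
  · rw [integrable_indicator_iff hK.measurableSet]
    exact integrableOn_const (vol_lt_top_of_isCompact hK hKb).ne
  · filter_upwards [ae_vol_mem_ball] with x hx using hl x hx

/-! ### The vector field `∇ log cosh r` -/

/-- The function `1 / cosh² r`, where `r` is the hyperbolic distance to the origin. -/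
def sechSq (x : E n) : ℝ := ((1 - ‖x‖ ^ 2) / (1 + ‖x‖ ^ 2)) ^ 2

theorem sechSq_nonneg (x : E n) : 0 ≤ sechSq x := sq_nonneg _

theorem sechSq_pos {x : E n} (hx : x ∈ ball n) : 0 < sechSq x := by
  have := one_sub_normSq_pos hx
  unfold sechSq; positivity

theorem sechSq_le_one (x : E n) : sechSq x ≤ 1 := by
  rw [sechSq, sq_le_one_iff_abs_le_one, abs_div, abs_of_nonneg (by positivity : 0 ≤ 1 + ‖x‖ ^ 2),
    div_le_one (by positivity), abs_le]
  constructor <;> nlinarith [sq_nonneg ‖x‖]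

theorem continuous_sechSq : Continuous (sechSq : E n → ℝ) := by
  unfold sechSq
  refine Continuous.pow (Continuous.div (by fun_prop) (by fun_prop) fun x => ?_) 2
  positivity

/-- The components of `∇_g log cosh r`, multiplied by the volume density. -/
def radialField (i : Fin n) (x : E n) : ℝ :=
  conf x ^ n * ((1 - ‖x‖ ^ 2) / (1 + ‖x‖ ^ 2) * x i)

theorem contDiffOn_radialFactor (s : Set (E n)) :
    ContDiffOn ℝ ∞ (fun x : E n => (1 - ‖x‖ ^ 2) / (1 + ‖x‖ ^ 2)) s := by
  refine ContDiff.contDiffOn (ContDiff.div ?_ ?_ fun x => by positivity)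
  · exact contDiff_const.sub (contDiff_norm_sq ℝ)
  · exact contDiff_const.add (contDiff_norm_sq ℝ)

theorem contDiffOn_radialField (i : Fin n) : ContDiffOn ℝ ∞ (radialField i) (ball n) :=
  (contDiffOn_conf_pow n).mul ((contDiffOn_radialFactor _).mul (contDiffOn_coord i _))

/-- In polar coordinates `Δ_g log cosh r = (n - 1) coth r tanh r + sech² r`. -/
theorem sum_pd_radialField {x : E n} (hx : x ∈ ball n) :
    ∑ i, pd i (radialField i) x = conf x ^ n * ((n : ℝ) - 1 + sechSq x) := by
  have hs := one_sub_normSq_pos hx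
  have hp : 0 < 1 + ‖x‖ ^ 2 := by positivity
  have hq : ∀ i, pd i (fun y : E n => (1 - ‖y‖ ^ 2) / (1 + ‖y‖ ^ 2)) x =
      -2 / (1 + ‖x‖ ^ 2) ^ 2 * (2 * x i) := fun i => by
    have h1 : HasDerivAt (fun t : ℝ => (1 - t) / (1 + t)) (-2 / (1 + ‖x‖ ^ 2) ^ 2) (‖x‖ ^ 2) :=
      (((hasDerivAt_id (‖x‖ ^ 2)).const_sub 1).div ((hasDerivAt_id (‖x‖ ^ 2)).const_add 1)
        hp.ne').congr_deriv (by simp; ring)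
    rw [← pd_normSq i x]
    exact pd_comp i h1 (differentiableAt_normSq x)
  have hd : ∀ i, pd i (radialField i) x = conf x ^ n * ((1 - ‖x‖ ^ 2) / (1 + ‖x‖ ^ 2)
      - 4 / (1 + ‖x‖ ^ 2) ^ 2 * x i ^ 2 + 2 * n / (1 + ‖x‖ ^ 2) * x i ^ 2) := fun i => by
    have d1 := ContDiffOn.differentiableAt_ball (contDiffOn_conf_pow n) hx
    have d2 := ContDiffOn.differentiableAt_ball (contDiffOn_radialFactor (ball n)) hx
    have d3 := ContDiffOn.differentiableAt_ball (contDiffOn_coord i (ball n)) hx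
    unfold radialField
    rw [pd_mul i d1 (d2.fun_mul d3), pd_mul i d2 d3, hq, pd_conf_pow i n hx, pd_coord, if_pos rfl]
    have : conf x = 2 / (1 - ‖x‖ ^ 2) := rfl
    have h2 : conf x * ((1 - ‖x‖ ^ 2) / (1 + ‖x‖ ^ 2)) = 2 / (1 + ‖x‖ ^ 2) := by
      rw [this]; field_simp
    linear_combination (n * conf x ^ n * x i ^ 2) * h2
  have hsum : ∑ i, x i ^ 2 = ‖x‖ ^ 2 := by
    rw [EuclideanSpace.norm_sq_eq]; simp
  simp only [hd, ← Finset.mul_sum, Finset.sum_add_distrib, Finset.sum_sub_distrib, hsum,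
    Finset.sum_const, Finset.card_univ, Fintype.card_fin, nsmul_eq_mul, sechSq]
  congr 1
  field_simp
  ring

/-- The divergence theorem for `g V`. Class `C¹` is the right generality because `g = |φ|^p` is no
smoother in general. -/
theorem integral_div_radialField {g : E n → ℝ} (hg : IsTestOf 1 g) :
    ∫ x, ((n : ℝ) - 1 + sechSq x) * g x ∂(vol n) =
      -∫ x in ball n, ∑ i, radialField i x * pd i g x := by
  have hgd : Differentiable ℝ g := hg.1.differentiable (by simp)
  have ht : ∀ i, IsTestOf 1 (fun x => radialField i x * g x) := fun i =>
    hg.smooth_mul (contDiffOn_radialField i)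
  have hz : ∀ i, IntegrableOn (pd i fun x => radialField i x * g x) (ball n) := fun i => by
    have hc : Continuous (pd i fun x => radialField i x * g x) :=
      ((ht i).1.continuous_fderiv (by simp)).clm_apply continuous_const
    exact (hc.integrable_of_hasCompactSupport ((ht i).2.1.of_isClosed_subset (isClosed_tsupport _)
      (tsupport_pd_subset i _))).integrableOn
  have h0 : ∀ i, ∫ x in ball n, pd i (fun x => radialField i x * g x) x = 0 := fun i => by
    rw [setIntegral_eq_integral_of_forall_compl_eq_zero fun x hx => ?_]
    · exact integral_pd_eq_zero i (ht i).1 (ht i).2.1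
    · exact image_eq_zero_of_notMem_tsupport fun h =>
        hx ((tsupport_pd_subset i _).trans (ht i).2.2 h)
  have hr : ∀ i, IntegrableOn (fun x => radialField i x * pd i g x) (ball n) := fun i => by
    have hc : Continuous (pd i g) := (hg.1.continuous_fderiv (by simp)).clm_apply continuous_const
    have h1 : IsTestOf 0 (pd i g) := ⟨contDiff_zero.mpr hc, hg.2.1.of_isClosed_subset
      (isClosed_tsupport _) (tsupport_pd_subset i _), (tsupport_pd_subset i _).trans hg.2.2⟩
    have h2 := h1.smooth_mul (contDiffOn_radialField i)
    exact (h2.1.continuous.integrable_of_hasCompactSupport h2.2.1).integrableOn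
  have h1 : ∫ x in ball n, ∑ i, pd i (fun x => radialField i x * g x) x = 0 := by
    rw [integral_finsetSum _ fun i _ => hz i]
    simp [h0]
  rw [integral_vol, eq_neg_iff_add_eq_zero, ← h1, ← integral_add]
  · refine setIntegral_congr_fun isOpen_ball.measurableSet fun x hx => ?_
    simp only [pd_mul _ (ContDiffOn.differentiableAt_ball (contDiffOn_radialField _) hx) (hgd x),
      Finset.sum_add_distrib, ← Finset.sum_mul, sum_pd_radialField hx]
    ring
  · refine (integrable_finsetSum Finset.univ fun i _ => (hz i).sub (hr i)).congr ?_
    filter_upwards [ae_restrict_mem isOpen_ball.measurableSet] with x hx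
    simp only [Pi.sub_apply,
      pd_mul _ (ContDiffOn.differentiableAt_ball (contDiffOn_radialField _) hx) (hgd x),
      Finset.sum_sub_distrib, Finset.sum_add_distrib, ← Finset.sum_mul, sum_pd_radialField hx]
    ring
  · exact integrable_finsetSum _ fun i _ => hr i

theorem sum_radialField_mul (v : E n) (x : E n) :
    ∑ i, radialField i x * v i = conf x ^ n * ((1 - ‖x‖ ^ 2) / (1 + ‖x‖ ^ 2)) * inner ℝ x v := by
  rw [PiLp.inner_apply, Finset.mul_sum]
  refine Finset.sum_congr rfl fun i _ => ?_
  simp [radialField]; ring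

theorem abs_sum_radialField_mul_le (v : E n) {x : E n} (hx : x ∈ ball n) :
    |∑ i, radialField i x * v i| ≤ conf x ^ n * ((conf x)⁻¹ * ‖v‖) := by
  have hs := one_sub_normSq_pos hx
  have hp : 0 < 1 + ‖x‖ ^ 2 := by positivity
  rw [sum_radialField_mul, abs_mul, abs_mul, abs_of_pos (pow_pos (conf_pos hx) n),
    abs_of_pos (div_pos hs hp), mul_assoc]
  refine mul_le_mul_of_nonneg_left ?_ (pow_pos (conf_pos hx) n).le
  calc (1 - ‖x‖ ^ 2) / (1 + ‖x‖ ^ 2) * |inner ℝ x v|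
      ≤ (1 - ‖x‖ ^ 2) / (1 + ‖x‖ ^ 2) * (‖x‖ * ‖v‖) := by
        gcongr; exact abs_real_inner_le_norm x v
    _ = (1 - ‖x‖ ^ 2) / (1 + ‖x‖ ^ 2) * ‖x‖ * ‖v‖ := by ring
    _ ≤ (conf x)⁻¹ * ‖v‖ := by
        gcongr
        rw [conf, inv_div, div_mul_eq_mul_div, div_le_div_iff₀ hp two_pos]
        -- What remains is `2|x| / (1 + |x|²) ≤ 1`, that is, `tanh r ≤ 1`.
        nlinarith [sq_nonneg (‖x‖ - 1)]

/-! ### Integral inequalities for test functions -/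

theorem IsTest.continuous_gradient {φ : E n → ℝ} (hφ : IsTest φ) : Continuous (gradient φ) :=
  (InnerProductSpace.toDual ℝ (E n)).symm.continuous.comp (hφ.1.continuous_fderiv (by simp))

theorem IsTest.norm_grad {φ : E n → ℝ} (hφ : IsTest φ) :
    IsTestOf 0 (fun x => ‖(conf x)⁻¹ • gradient φ x‖) := by
  have hs : tsupport (gradient φ) ⊆ tsupport φ := by
    refine (closure_mono ?_).trans (tsupport_fderiv_subset ℝ (f := φ))
    intro x hx h
    exact hx (by simp [gradient, h])
  have h1 : IsTestOf 0 (fun x => ‖gradient φ x‖) := by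
    have hs' : tsupport (fun x => ‖gradient φ x‖) ⊆ tsupport φ := by
      refine (closure_mono ?_).trans hs
      intro x hx h
      exact hx (by simp [h])
    exact ⟨contDiff_zero.mpr hφ.continuous_gradient.norm,
      hφ.2.1.of_isClosed_subset (isClosed_tsupport _) hs', hs'.trans hφ.2.2⟩
  refine h1.of_contDiffOn ?_ fun x hx => by simp [norm_smul, hx]
  exact contDiffOn_zero.mpr (contDiffOn_conf_inv.continuousOn.smul
    hφ.continuous_gradient.continuousOn).norm

/-- The divergence identity is applied to `|φ|^p`, which is `C¹` because `p > 1`; then `|V|_g ≤ 1`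
bounds the pairing of `V` with `∇|φ|^p = p |φ|^(p-2) φ ∇φ`. -/
theorem integral_grad_bound {p : ℝ} (hp : 1 < p) {φ : E n → ℝ} (hφ : IsTest φ) :
    ∫ x, ((n : ℝ) - 1 + sechSq x) * |φ x| ^ p ∂(vol n) ≤
      ∫ x, p * (|φ x| ^ (p - 1) * ‖(conf x)⁻¹ • gradient φ x‖) ∂(vol n) := by
  have hg : IsTestOf 1 (fun x => |φ x| ^ p) := by
    refine (hφ.isTestOf 1).of_contDiffOn ?_ fun x hx => by
      simp [hx, Real.zero_rpow (by linarith : p ≠ 0)]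
    exact ((contDiff_norm_rpow hp).comp (hφ.isTestOf 1).1).contDiffOn
  have hi : IsTestOf 0 (fun x => p * (|φ x| ^ (p - 1) * ‖(conf x)⁻¹ • gradient φ x‖)) := by
    refine hφ.norm_grad.of_contDiffOn (contDiffOn_zero.mpr ?_) fun x hx => by simp [hx]
    refine continuousOn_const.mul (ContinuousOn.mul ?_ hφ.norm_grad.1.continuous.continuousOn)
    exact (hφ.continuous.abs.rpow_const fun x => Or.inr (by linarith)).continuousOn
  have hpd : ∀ i x, pd i (fun x => |φ x| ^ p) x = p * |φ x| ^ (p - 2) * φ x * pd i φ x :=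
    fun i x => pd_comp i (hasDerivAt_abs_rpow (φ x) hp) (hφ.differentiable x)
  have hint : IntegrableOn (fun x => conf x ^ n *
      (p * (|φ x| ^ (p - 1) * ‖(conf x)⁻¹ • gradient φ x‖))) (ball n) := by
    have := hi.smooth_mul (contDiffOn_conf_pow n)
    exact (this.1.continuous.integrable_of_hasCompactSupport this.2.1).integrableOn
  rw [integral_div_radialField hg, integral_vol]
  refine (neg_le_abs _).trans ((Real.norm_eq_abs _).symm.le.trans
    (norm_integral_le_of_norm_le hint ?_))
  filter_upwards [ae_restrict_mem isOpen_ball.measurableSet] with x hx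
  have e1 : ∑ i, radialField i x * pd i (fun x => |φ x| ^ p) x =
      (p * |φ x| ^ (p - 2) * φ x) * ∑ i, radialField i x * gradient φ x i := by
    rw [Finset.mul_sum]
    exact Finset.sum_congr rfl fun i _ => by rw [hpd, gradient_apply]; ring
  have e2 : |p * |φ x| ^ (p - 2) * φ x| = p * |φ x| ^ (p - 1) := by
    rw [abs_mul, abs_mul, abs_of_pos (by linarith : 0 < p), abs_of_nonneg (by positivity),
      mul_assoc]
    congr 1
    by_cases h : φ x = 0
    · simp [h, Real.zero_rpow (by linarith : p - 1 ≠ 0)]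
    · rw [← Real.rpow_add_one (abs_pos.mpr h).ne']; congr 1; ring
  rw [e1, Real.norm_eq_abs, abs_mul, e2, norm_smul, Real.norm_of_nonneg (inv_pos.mpr (conf_pos hx)).le]
  calc _ ≤ p * |φ x| ^ (p - 1) * (conf x ^ n * ((conf x)⁻¹ * ‖gradient φ x‖)) := by
        gcongr; exact abs_sum_radialField_mul_le _ hx
    _ = _ := by ring

theorem IsTest.comp {φ : E n → ℝ} (hφ : IsTest φ) {h : ℝ → ℝ} (hh : ContDiff ℝ ∞ h)
    (h0 : h 0 = 0) : IsTest (fun x => h (φ x)) :=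
  (hφ.isTestOf 0).of_contDiffOn (k := ⊤) (hh.comp hφ.1).contDiffOn fun x hx => by simp [hx, h0]

theorem integral_comp_laplaceBeltrami {φ : E n → ℝ} (hφ : IsTest φ) {h h' : ℝ → ℝ}
    (hh : ContDiff ℝ ∞ h) (hd : ∀ s, HasDerivAt h (h' s) s) :
    ∫ x, h (φ x) * laplaceBeltrami φ x ∂(vol n) =
      -∫ x, h' (φ x) * ‖(conf x)⁻¹ • gradient φ x‖ ^ 2 ∂(vol n) := by
  have hv : ContDiffOn ℝ ∞ (fun x => h (φ x)) (ball n) := (hh.comp hφ.1).contDiffOn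
  have ht : ∀ i, IsTest fun y => conf y ^ n * ((conf y ^ 2)⁻¹ * pd i φ y) := fun i =>
    ((hφ.pd i).smooth_mul (contDiffOn_conf_pow_inv 2)).smooth_mul (contDiffOn_conf_pow n)
  have e1 : ∫ x, h (φ x) * laplaceBeltrami φ x ∂(vol n) =
      ∫ x in ball n, ∑ i, h (φ x) * pd i (fun y => conf y ^ n * ((conf y ^ 2)⁻¹ * pd i φ y)) x := by
    rw [integral_vol]
    refine setIntegral_congr_fun isOpen_ball.measurableSet fun x hx => ?_
    have := (pow_pos (conf_pos hx) n).ne'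
    simp only [laplaceBeltrami_apply, ← Finset.mul_sum]
    field_simp
  have e2 : ∫ x, h' (φ x) * ‖(conf x)⁻¹ • gradient φ x‖ ^ 2 ∂(vol n) =
      ∫ x in ball n, ∑ i, pd i (fun x => h (φ x)) x *
        (conf x ^ n * ((conf x ^ 2)⁻¹ * pd i φ x)) := by
    rw [integral_vol]
    refine setIntegral_congr_fun isOpen_ball.measurableSet fun x hx => ?_
    simp only [pd_comp _ (hd (φ x)) (hφ.differentiable x)]
    rw [norm_smul, mul_pow, EuclideanSpace.norm_sq_eq]
    simp only [gradient_apply, Real.norm_eq_abs, sq_abs, Finset.mul_sum]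
    refine Finset.sum_congr rfl fun i _ => ?_
    rw [inv_pow]; ring
  rw [e1, e2, integral_finsetSum _ fun i _ => ((ht i).pd i).integrable_mul
      (locallyIntegrableOn_of_contDiffOn hv), integral_finsetSum _ fun i _ => (ht i).integrable_mul
      (locallyIntegrableOn_of_contDiffOn (contDiffOn_pd hv i)), ← Finset.sum_neg_distrib]
  exact Finset.sum_congr rfl fun i _ => (hasWeakPartial_of_contDiffOn i hv).2.2 _ (ht i)

/-- Expand `|∇φ + κ s V|_g² ≥ 0` with `s = φ x`, using `|V|_g² = tanh² r = 1 - sech² r`. -/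
theorem neg_two_mul_inner_sub_le (κ s : ℝ) (v : E n) {x : E n} (hx : x ∈ ball n) :
    -2 * κ * s * ((1 - ‖x‖ ^ 2) / (1 + ‖x‖ ^ 2) * inner ℝ x v) - κ ^ 2 * (1 - sechSq x) * s ^ 2 ≤
      ‖(conf x)⁻¹ • v‖ ^ 2 := by
  have hs := one_sub_normSq_pos hx
  have hp : 0 < 1 + ‖x‖ ^ 2 := by positivity
  -- In the orthonormal frame `conf⁻¹ ∂ᵢ` the field `V` is `2 x / (1 + |x|²)`, and the gradient is
  -- `conf⁻¹` times the Euclidean one.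
  have h := sq_nonneg ‖(conf x)⁻¹ • v + (κ * s * (2 / (1 + ‖x‖ ^ 2))) • x‖
  rw [norm_add_sq_real, inner_smul_left, inner_smul_right, norm_smul (_ * _ * _), mul_pow,
    Real.norm_eq_abs, sq_abs, real_inner_comm] at h
  have h1 : (1 - sechSq x) = (2 / (1 + ‖x‖ ^ 2)) ^ 2 * ‖x‖ ^ 2 := by
    rw [sechSq]; field_simp; ring
  have h2 : (conf x)⁻¹ * (2 / (1 + ‖x‖ ^ 2)) = (1 - ‖x‖ ^ 2) / (1 + ‖x‖ ^ 2) := by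
    rw [conf]; field_simp
  rw [h1, ← h2]
  simp only [conj_trivial] at h
  linarith

/-- The function `Ψ` is a primitive of `s h'(s)`, so the cross term `φ h'(φ) ∇φ` of the completed
square is `∇(Ψ ∘ φ)` and can be integrated against `V` by the divergence identity. The square is
multiplied by `h'(φ)`, whence `h' ≥ 0`. -/
theorem integral_comp_bound {φ : E n → ℝ} (hφ : IsTest φ) {h h' Ψ : ℝ → ℝ} (κ : ℝ)
    (hh : ContDiff ℝ ∞ h) (hd : ∀ s, HasDerivAt h (h' s) s) (hd0 : ∀ s, 0 ≤ h' s)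
    (hc : Continuous h') (hΨ : ContDiff ℝ ∞ Ψ) (hΨ0 : Ψ 0 = 0)
    (hdΨ : ∀ s, HasDerivAt Ψ (s * h' s) s) :
    ∫ x, (2 * κ * (((n : ℝ) - 1 + sechSq x) * Ψ (φ x)) -
      κ ^ 2 * (1 - sechSq x) * (h' (φ x) * φ x ^ 2)) ∂(vol n) ≤
      -∫ x, h (φ x) * laplaceBeltrami φ x ∂(vol n) := by
  set B : E n → ℝ := fun x => (1 - ‖x‖ ^ 2) / (1 + ‖x‖ ^ 2) * inner ℝ x (gradient φ x) with hB
  have hBc : Continuous B := by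
    refine Continuous.mul ?_ (continuous_id.inner hφ.continuous_gradient)
    exact continuousOn_univ.mp (contDiffOn_radialFactor univ).continuousOn
  have e1 : ∫ x, ((n : ℝ) - 1 + sechSq x) * Ψ (φ x) ∂(vol n) =
      -∫ x, φ x * h' (φ x) * B x ∂(vol n) := by
    rw [integral_div_radialField ((hφ.comp hΨ hΨ0).isTestOf 1), integral_vol]
    congr 1
    refine integral_congr_ae (ae_of_all _ fun x => ?_)
    simp only [pd_comp _ (hdΨ (φ x)) (hφ.differentiable x), hB]
    have := sum_radialField_mul (gradient φ x) x
    simp only [gradient_apply] at this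
    rw [show ∑ i, radialField i x * (φ x * h' (φ x) * pd i φ x) =
      φ x * h' (φ x) * ∑ i, radialField i x * pd i φ x by
        rw [Finset.mul_sum]; exact Finset.sum_congr rfl fun i _ => by ring, this]
    ring
  have iB : Integrable (fun x => φ x * h' (φ x) * B x) (vol n) := by
    refine ((hφ.isTestOf 0).of_contDiffOn (k := 0) (contDiffOn_zero.mpr ?_)
      fun x hx => by simp [hx]).integrable_vol
    exact ((hφ.continuous.mul (hc.comp hφ.continuous)).mul hBc).continuousOn
  have iA : Integrable (fun x => h' (φ x) * ‖(conf x)⁻¹ • gradient φ x‖ ^ 2) (vol n) := by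
    refine (hφ.norm_grad.of_contDiffOn (k := 0) (contDiffOn_zero.mpr ?_)
      fun x hx => by simp [hx]).integrable_vol
    exact ((hc.comp hφ.continuous).mul (hφ.norm_grad.1.continuous.pow 2)).continuousOn
  have iΨ : Integrable (fun x => ((n : ℝ) - 1 + sechSq x) * Ψ (φ x)) (vol n) := by
    refine ((hφ.isTestOf 0).of_contDiffOn (k := 0) (contDiffOn_zero.mpr ?_)
      fun x hx => by simp [hx, hΨ0]).integrable_vol
    exact ((continuous_const.add continuous_sechSq).mul
      (hΨ.continuous.comp hφ.continuous)).continuousOn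
  have iS : Integrable (fun x => κ ^ 2 * (1 - sechSq x) * (h' (φ x) * φ x ^ 2)) (vol n) := by
    refine ((hφ.isTestOf 0).of_contDiffOn (k := 0) (contDiffOn_zero.mpr ?_)
      fun x hx => by simp [hx]).integrable_vol
    exact ((continuous_const.mul (continuous_const.sub continuous_sechSq)).mul
      ((hc.comp hφ.continuous).mul (hφ.continuous.pow 2))).continuousOn
  rw [integral_comp_laplaceBeltrami hφ hh hd, neg_neg, integral_sub (iΨ.const_mul _) iS,
    integral_const_mul, e1, sub_le_iff_le_add, ← integral_add iA iS, mul_neg, ← integral_const_mul,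
    ← integral_neg]
  refine integral_mono_ae ((iB.const_mul _).neg) (iA.add iS) ?_
  filter_upwards [ae_vol_mem_ball] with x hx
  have h1 := mul_le_mul_of_nonneg_left
    (neg_two_mul_inner_sub_le κ (φ x) (gradient φ x) hx) (hd0 (φ x))
  simp only [hB]
  linarith

/-! ### Smooth regularization of `|s|^(p-2) s` and its limits -/

section Regularization

variable {p e : ℝ}

theorem hasDerivAt_regPow (he : 0 < e) (a s : ℝ) :
    HasDerivAt (fun s : ℝ => (s ^ 2 + e) ^ a) (2 * a * s * (s ^ 2 + e) ^ (a - 1)) s := by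
  have hN : 0 < s ^ 2 + e := by positivity
  have := ((hasDerivAt_pow 2 s).add_const e).rpow_const (p := a) (Or.inl hN.ne')
  exact this.congr_deriv (by push_cast; ring_nf)

theorem contDiff_regPow (he : 0 < e) (a : ℝ) :
    ContDiff ℝ ∞ (fun s : ℝ => (s ^ 2 + e) ^ a) :=
  ((contDiff_id.pow 2).add contDiff_const).rpow_const_of_ne fun s =>
    (by positivity : 0 < s ^ 2 + e).ne'

theorem regPow_sub_one (he : 0 < e) (a s : ℝ) :
    (s ^ 2 + e) ^ (a - 1) * (s ^ 2 + e) = (s ^ 2 + e) ^ a := by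
  have hN : 0 < s ^ 2 + e := by positivity
  rw [← Real.rpow_add_one hN.ne']; congr 1; ring

theorem regPow_sub_two (he : 0 < e) (p s : ℝ) :
    (s ^ 2 + e) ^ (p / 2 - 2) * (s ^ 2 + e) = (s ^ 2 + e) ^ (p / 2 - 1) := by
  rw [← regPow_sub_one he (p / 2 - 1)]; congr 2; ring

theorem hasDerivAt_regF (he : 0 < e) (p s : ℝ) :
    HasDerivAt (fun s : ℝ => (s ^ 2 + e) ^ (p / 2 - 1) * s)
      ((s ^ 2 + e) ^ (p / 2 - 2) * ((p - 1) * s ^ 2 + e)) s := by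
  refine ((hasDerivAt_regPow he (p / 2 - 1) s).mul (hasDerivAt_id s)).congr_deriv ?_
  have h := regPow_sub_two he p s
  rw [show p / 2 - 1 - 1 = p / 2 - 2 by ring]
  simp only [id]
  linear_combination -h

/-- Integration by parts: with `h` the regularized power, a primitive of `s h'` is `s h - ∫ h`, and
`∫ h = (s² + e)^(p/2) / p`. The constant `e^(p/2)` makes it vanish at `s = 0`, which keeps the
composition with `φ` compactly supported. -/
theorem hasDerivAt_regPsi (he : 0 < e) (hp : p ≠ 0) (s : ℝ) :
    HasDerivAt (fun s : ℝ => s ^ 2 * (s ^ 2 + e) ^ (p / 2 - 1) -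
      1 / p * ((s ^ 2 + e) ^ (p / 2) - e ^ (p / 2)))
      (s * ((s ^ 2 + e) ^ (p / 2 - 2) * ((p - 1) * s ^ 2 + e))) s := by
  refine (((hasDerivAt_pow 2 s).mul (hasDerivAt_regPow he (p / 2 - 1) s)).sub
    (((hasDerivAt_regPow he (p / 2) s).sub_const _).const_mul (1 / p))).congr_deriv ?_
  have h := regPow_sub_two he p s
  rw [show p / 2 - 1 - 1 = p / 2 - 2 by ring]
  have hq : 1 / p * (2 * (p / 2) * s * (s ^ 2 + e) ^ (p / 2 - 1)) =
      s * (s ^ 2 + e) ^ (p / 2 - 1) := by field_simp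
  rw [hq]
  norm_num
  linear_combination -s * h

theorem sq_rpow (s a : ℝ) : (s ^ 2) ^ a = |s| ^ (2 * a) := by
  rw [← sq_abs, ← Real.rpow_natCast, ← Real.rpow_mul (abs_nonneg s)]; norm_num

theorem tendsto_regPow {s : ℝ} (hs : s ≠ 0) (a : ℝ) :
    Filter.Tendsto (fun e : ℝ => (s ^ 2 + e) ^ a) (nhdsWithin 0 (Ioi 0))
      (nhds (|s| ^ (2 * a))) := by
  have h1 : ContinuousAt (fun e : ℝ => (s ^ 2 + e) ^ a) 0 :=
    (continuousAt_const.add continuousAt_id).rpow_const (Or.inl (by simpa using hs))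
  have h2 := h1.tendsto
  simp only [add_zero, sq_rpow] at h2
  exact h2.mono_left nhdsWithin_le_nhds

theorem tendsto_id_zero : Filter.Tendsto (fun e : ℝ => e) (nhdsWithin 0 (Ioi 0)) (nhds 0) :=
  nhdsWithin_le_nhds

theorem tendsto_regPsi (hp : 1 < p) (s : ℝ) :
    Filter.Tendsto (fun e : ℝ => s ^ 2 * (s ^ 2 + e) ^ (p / 2 - 1) -
      1 / p * ((s ^ 2 + e) ^ (p / 2) - e ^ (p / 2))) (nhdsWithin 0 (Ioi 0))
      (nhds ((1 - 1 / p) * |s| ^ p)) := by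
  by_cases hs : s = 0
  · simp [hs, Real.zero_rpow (by linarith : p ≠ 0)]
  have h0 : Filter.Tendsto (fun e : ℝ => e ^ (p / 2)) (nhdsWithin 0 (Ioi 0)) (nhds 0) := by
    have := (Real.continuousAt_rpow_const 0 (p / 2) (Or.inr (by linarith))).tendsto
    rw [Real.zero_rpow (by linarith : p / 2 ≠ 0)] at this
    exact this.mono_left nhdsWithin_le_nhds
  have h := ((tendsto_regPow hs (p / 2 - 1)).const_mul (s ^ 2)).sub
    (((tendsto_regPow hs (p / 2)).sub h0).const_mul (1 / p))
  convert h using 2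
  rw [← sq_abs, ← Real.rpow_natCast, ← Real.rpow_add (abs_pos.mpr hs)]
  norm_num
  ring_nf

theorem tendsto_regF' (hp : 1 < p) (s : ℝ) :
    Filter.Tendsto (fun e : ℝ => (s ^ 2 + e) ^ (p / 2 - 2) * ((p - 1) * s ^ 2 + e) * s ^ 2)
      (nhdsWithin 0 (Ioi 0)) (nhds ((p - 1) * |s| ^ p)) := by
  by_cases hs : s = 0
  · simp [hs, Real.zero_rpow (by linarith : p ≠ 0)]
  have h := ((tendsto_regPow hs (p / 2 - 2)).mul
    (tendsto_id_zero.const_add ((p - 1) * s ^ 2))).mul_const (s ^ 2)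
  convert h using 2
  have : |s| ^ p = |s| ^ (2 * (p / 2 - 2)) * (|s| ^ 2 * |s| ^ 2) := by
    rw [← Real.rpow_natCast, ← Real.rpow_add (abs_pos.mpr hs), ← Real.rpow_add (abs_pos.mpr hs)]
    congr 1; push_cast; ring
  rw [this, sq_abs]; ring

theorem tendsto_regF (hp : 1 < p) (s : ℝ) :
    Filter.Tendsto (fun e : ℝ => |(s ^ 2 + e) ^ (p / 2 - 1) * s|)
      (nhdsWithin 0 (Ioi 0)) (nhds (|s| ^ (p - 1))) := by
  by_cases hs : s = 0
  · simp [hs, Real.zero_rpow (by linarith : p - 1 ≠ 0)]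
  have h := ((tendsto_regPow hs (p / 2 - 1)).mul_const s).abs
  convert h using 1
  rw [abs_mul, abs_of_nonneg (Real.rpow_nonneg (abs_nonneg s) _),
    ← Real.rpow_add_one (abs_pos.mpr hs).ne']
  ring_nf

theorem regPow_le (he : e ∈ Ioo (0 : ℝ) 1) {s S a : ℝ} (hs : |s| ≤ S) (ha : 0 ≤ a) :
    (s ^ 2 + e) ^ a ≤ (S ^ 2 + 1) ^ a := by
  have h1 : s ^ 2 ≤ S ^ 2 := sq_le_sq' (by linarith [neg_le_of_abs_le hs]) (le_of_abs_le hs)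
  exact Real.rpow_le_rpow (by have := he.1; positivity) (by linarith [he.2]) ha

theorem abs_regPsi_le (hp : 1 < p) (he : e ∈ Ioo (0 : ℝ) 1) {s S : ℝ} (hs : |s| ≤ S) :
    |s ^ 2 * (s ^ 2 + e) ^ (p / 2 - 1) - 1 / p * ((s ^ 2 + e) ^ (p / 2) - e ^ (p / 2))| ≤
      3 * (S ^ 2 + 1) ^ (p / 2) := by
  have hb := regPow_le he hs (by linarith : 0 ≤ p / 2)
  have hN := regPow_sub_one he.1 (p / 2) s
  have h1 : 0 ≤ (s ^ 2 + e) ^ (p / 2 - 1) := by have := he.1; positivity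
  have h2 : e ^ (p / 2) ≤ (s ^ 2 + e) ^ (p / 2) :=
    Real.rpow_le_rpow he.1.le (by nlinarith) (by linarith)
  have h3 : 0 ≤ e ^ (p / 2) := by have := he.1; positivity
  have h4 : 0 < 1 / p := by positivity
  have h5 : 1 / p ≤ 1 := by rw [div_le_one (by linarith)]; linarith
  have h6 := he.1
  have h7 : 0 ≤ s ^ 2 * (s ^ 2 + e) ^ (p / 2 - 1) := by positivity
  have h8 : s ^ 2 * (s ^ 2 + e) ^ (p / 2 - 1) ≤ (s ^ 2 + e) ^ (p / 2) := by nlinarith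
  have h9 : 1 / p * ((s ^ 2 + e) ^ (p / 2) - e ^ (p / 2)) ≤ (s ^ 2 + e) ^ (p / 2) := by nlinarith
  have h10 : 0 ≤ 1 / p * ((s ^ 2 + e) ^ (p / 2) - e ^ (p / 2)) :=
    mul_nonneg h4.le (by linarith)
  rw [abs_le]; constructor <;> linarith

theorem regF'_nonneg (hp : 1 < p) (he : 0 < e) (s : ℝ) :
    0 ≤ (s ^ 2 + e) ^ (p / 2 - 2) * ((p - 1) * s ^ 2 + e) := by
  have : 0 ≤ p - 1 := by linarith
  positivity

/-- The exponent `p/2 - 2` may be negative. Two factors `s² + e`, one dominating `s²` and one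
dominating `((p-1) s² + e) / p`, raise it to `p/2` and make the bound uniform in `e`. -/
theorem abs_regF'_le (hp : 1 < p) (he : e ∈ Ioo (0 : ℝ) 1) {s S : ℝ} (hs : |s| ≤ S) :
    |(s ^ 2 + e) ^ (p / 2 - 2) * ((p - 1) * s ^ 2 + e) * s ^ 2| ≤
      p * (S ^ 2 + 1) ^ (p / 2) := by
  have h6 := he.1
  have hb := regPow_le he hs (by linarith : 0 ≤ p / 2)
  have hN : (s ^ 2 + e) ^ (p / 2 - 2) * (s ^ 2 + e) * (s ^ 2 + e) = (s ^ 2 + e) ^ (p / 2) := by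
    rw [regPow_sub_two he.1, regPow_sub_one he.1]
  rw [abs_of_nonneg (mul_nonneg (regF'_nonneg hp he.1 s) (sq_nonneg s))]
  calc _ ≤ (s ^ 2 + e) ^ (p / 2 - 2) * (p * (s ^ 2 + e)) * (s ^ 2 + e) := by
        have : (p - 1) * s ^ 2 + e ≤ p * (s ^ 2 + e) := by nlinarith [sq_nonneg s]
        have : 0 ≤ (p - 1) * s ^ 2 + e := by nlinarith [sq_nonneg s]
        gcongr
        linarith
    _ = p * (s ^ 2 + e) ^ (p / 2) := by rw [← hN]; ring
    _ ≤ _ := by gcongr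

theorem abs_regF_le (hp : 1 < p) (he : e ∈ Ioo (0 : ℝ) 1) {s S : ℝ} (hs : |s| ≤ S) :
    |(s ^ 2 + e) ^ (p / 2 - 1) * s| ≤ (S ^ 2 + 1) ^ ((p - 1) / 2) := by
  have h6 := he.1
  have hN : 0 < s ^ 2 + e := by positivity
  refine le_trans ?_ (regPow_le he hs (by linarith : 0 ≤ (p - 1) / 2))
  rw [abs_mul, abs_of_nonneg (by positivity : 0 ≤ (s ^ 2 + e) ^ (p / 2 - 1)),
    show (p - 1) / 2 = (p / 2 - 1) + 1 / 2 by ring, Real.rpow_add hN, ← Real.sqrt_eq_rpow]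
  gcongr
  exact Real.abs_le_sqrt (by linarith)

end Regularization

theorem IsTest.exists_abs_le {φ : E n → ℝ} (hφ : IsTest φ) : ∃ S, ∀ x, |φ x| ≤ S := by
  obtain ⟨S, hS⟩ := hφ.continuous.norm.bddAbove_range_of_hasCompactSupport hφ.2.1.norm
  exact ⟨S, fun x => hS ⟨x, rfl⟩⟩

theorem integral_laplace_bound {p : ℝ} (hp : 1 < p) (hn : 1 ≤ n) {φ : E n → ℝ} (hφ : IsTest φ) :
    ∫ x, (p - 1) / p ^ 2 * (((n : ℝ) - 1) ^ 2 + ((n : ℝ) ^ 2 - 1) * sechSq x) * |φ x| ^ p ∂(vol n)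
      ≤ ∫ x, |φ x| ^ (p - 1) * |laplaceBeltrami φ x| ∂(vol n) := by
  obtain ⟨S, hS⟩ := hφ.exists_abs_le
  obtain ⟨D, hD⟩ := hφ.laplaceBeltrami.exists_abs_le
  have hnR : (1 : ℝ) ≤ n := by exact_mod_cast hn
  -- This value maximizes `2 κ (n - 1) / p - κ²`, the limit coefficient without `sech²`, up to the
  -- factor `p - 1`.
  set κ : ℝ := ((n : ℝ) - 1) / p with hκ
  set h : ℝ → ℝ → ℝ := fun e s => (s ^ 2 + e) ^ (p / 2 - 1) * s with hh
  set h' : ℝ → ℝ → ℝ := fun e s => (s ^ 2 + e) ^ (p / 2 - 2) * ((p - 1) * s ^ 2 + e) with hh'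
  set Ψ : ℝ → ℝ → ℝ := fun e s => s ^ 2 * (s ^ 2 + e) ^ (p / 2 - 1) -
      1 / p * ((s ^ 2 + e) ^ (p / 2) - e ^ (p / 2)) with hΨ
  have cΨ : ∀ e, 0 < e → ContDiff ℝ ∞ (Ψ e) := fun e he =>
    ((contDiff_id.pow 2).mul (contDiff_regPow he _)).sub
      (contDiff_const.mul ((contDiff_regPow he _).sub contDiff_const))
  have ch : ∀ e, 0 < e → ContDiff ℝ ∞ (h e) := fun e he => (contDiff_regPow he _).mul contDiff_id
  have ch' : ∀ e, 0 < e → Continuous (h' e) := fun e he =>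
    (contDiff_regPow he _).continuous.mul (by fun_prop)
  have l1 := tendsto_integral_vol (n := n) (K := tsupport φ)
    (G := fun e x => 2 * κ * (((n : ℝ) - 1 + sechSq x) * Ψ e (φ x)) -
      κ ^ 2 * (1 - sechSq x) * (h' e (φ x) * φ x ^ 2))
    (G₀ := fun x => 2 * κ * (((n : ℝ) - 1 + sechSq x) * ((1 - 1 / p) * |φ x| ^ p)) -
      κ ^ 2 * (1 - sechSq x) * ((p - 1) * |φ x| ^ p))
    (C := |2 * κ| * (n * (3 * (S ^ 2 + 1) ^ (p / 2))) + κ ^ 2 * (p * (S ^ 2 + 1) ^ (p / 2)))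
    hφ.2.1 hφ.2.2 ?_ ?_ ?_ ?_
  rotate_left
  · intro e he
    refine Continuous.continuousOn ?_
    exact (continuous_const.mul ((continuous_const.add continuous_sechSq).mul
      ((cΨ e he.1).continuous.comp hφ.continuous))).sub
      ((continuous_const.mul (continuous_const.sub continuous_sechSq)).mul
      (((ch' e he.1).comp hφ.continuous).mul (hφ.continuous.pow 2)))
  · intro e he x _
    have b1 := abs_regPsi_le hp he (hS x)
    have b2 := abs_regF'_le hp he (hS x)
    have s0 := sechSq_nonneg x
    have s1 := sechSq_le_one x
    refine (abs_sub _ _).trans (add_le_add ?_ ?_)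
    · rw [abs_mul, abs_mul ((n : ℝ) - 1 + sechSq x)]
      gcongr
      · rw [abs_le]; constructor <;> linarith
    · rw [abs_mul, abs_mul, abs_of_nonneg (sq_nonneg κ), abs_of_nonneg (by linarith)]
      calc _ ≤ κ ^ 2 * 1 * (p * (S ^ 2 + 1) ^ (p / 2)) := by
            gcongr
            linarith
        _ = _ := by ring
  · intro e x hx
    simp [image_eq_zero_of_notMem_tsupport hx, hΨ]
  · intro x _
    exact (((tendsto_regPsi hp (φ x)).const_mul _).const_mul _).sub
      ((tendsto_regF' hp (φ x)).const_mul _)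
  have l2 := tendsto_integral_vol (n := n) (K := tsupport φ)
    (G := fun e x => |h e (φ x)| * |laplaceBeltrami φ x|)
    (G₀ := fun x => |φ x| ^ (p - 1) * |laplaceBeltrami φ x|)
    (C := (S ^ 2 + 1) ^ ((p - 1) / 2) * D) hφ.2.1 hφ.2.2
    (fun e he => (((ch e he.1).continuous.comp hφ.continuous).abs.mul
      hφ.laplaceBeltrami.continuous.abs).continuousOn)
    (fun e he x _ => by
      rw [abs_mul, abs_abs, abs_abs]
      have := abs_regF_le hp he (hS x)
      gcongr
      exact hD x)
    (fun e x hx => by simp [image_eq_zero_of_notMem_tsupport hx, hh])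
    (fun x _ => (tendsto_regF hp (φ x)).mul_const _)
  refine le_of_eq_of_le (integral_congr_ae (ae_of_all _ fun x => ?_))
    (le_of_tendsto_of_tendsto l1 l2 ?_)
  -- Inserting `κ`, the constant part is `(p-1)/p² (n-1)²` and the coefficient of `sech²` is
  -- `(p-1)/p² (2(n-1) + (n-1)²) = (p-1)/p² (n² - 1)`.
  · simp only [hκ]; field_simp; ring
  · filter_upwards [Ioo_mem_nhdsGT (one_pos : (0 : ℝ) < 1)] with e he
    have hb := integral_comp_bound hφ (h := h e) (h' := h' e) (Ψ := Ψ e) κ (ch e he.1)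
      (hasDerivAt_regF he.1 p) (regF'_nonneg hp he.1) (ch' e he.1) (cΨ e he.1) (by simp [hΨ])
      (hasDerivAt_regPsi he.1 (by linarith))
    refine hb.trans ((neg_le_abs _).trans ((abs_integral_le_integral_abs).trans_eq ?_))
    simp only [abs_mul]

/-! ### Convergence in `L^p` -/

theorem eLpNorm_ofReal {α F : Type*} [MeasurableSpace α] [NormedAddCommGroup F] {p : ℝ} (hp : 1 < p)
    (f : α → F) (μ : Measure α) :
    eLpNorm f (ENNReal.ofReal p) μ = (∫⁻ x, ‖f x‖ₑ ^ p ∂μ) ^ (1 / p) := by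
  rw [eLpNorm_eq_lintegral_rpow_enorm_toReal (by simpa using by linarith) ENNReal.ofReal_ne_top,
    ENNReal.toReal_ofReal (by linarith)]

theorem eLpNorm_rpow {α F : Type*} [MeasurableSpace α] [NormedAddCommGroup F] {p : ℝ} (hp : 1 < p)
    (f : α → F) (μ : Measure α) :
    eLpNorm f (ENNReal.ofReal p) μ ^ p = ∫⁻ x, ‖f x‖ₑ ^ p ∂μ := by
  rw [eLpNorm_ofReal hp, ← ENNReal.rpow_mul, one_div_mul_cancel (by linarith), ENNReal.rpow_one]

theorem tendsto_eLpNorm_zero_of_dominated {μ : Measure (E n)} {p : ℝ} (hp : 1 < p)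
    {f : ℕ → E n → ℝ} {F : E n → ℝ} (hm : ∀ k, AEStronglyMeasurable (f k) μ)
    (hF : MemLp F (ENNReal.ofReal p) μ) (hb : ∀ᶠ k in Filter.atTop, ∀ᵐ x ∂μ, |f k x| ≤ F x)
    (hl : ∀ᵐ x ∂μ, Filter.Tendsto (fun k => f k x) Filter.atTop (nhds 0)) :
    Filter.Tendsto (fun k => eLpNorm (f k) (ENNReal.ofReal p) μ) Filter.atTop (nhds 0) := by
  have hp0 : 0 < p := by linarith
  have h : Filter.Tendsto (fun k => ∫⁻ x, ‖f k x‖ₑ ^ p ∂μ) Filter.atTop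
      (nhds (∫⁻ _, 0 ∂μ)) := by
    refine tendsto_lintegral_filter_of_dominated_convergence' (fun x => ‖F x‖ₑ ^ p) ?_ ?_ ?_ ?_
    · exact Filter.Eventually.of_forall fun k => (hm k).enorm.pow_const p
    · filter_upwards [hb] with k hk
      filter_upwards [hk] with x hx
      refine ENNReal.rpow_le_rpow ?_ hp0.le
      rw [← ofReal_norm, ← ofReal_norm]
      exact ENNReal.ofReal_le_ofReal (hx.trans (le_abs_self _))
    · rw [← eLpNorm_rpow hp]
      exact (ENNReal.rpow_lt_top_of_nonneg hp0.le hF.2.ne).ne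
    · filter_upwards [hl] with x hx
      have h1 : Filter.Tendsto (fun k => ‖f k x‖ₑ) Filter.atTop (nhds 0) := by
        simpa only [enorm_zero] using! (continuous_enorm.tendsto (0 : ℝ)).comp hx
      have h2 := (ENNReal.continuous_rpow_const (y := p)).tendsto 0
      rw [ENNReal.zero_rpow_of_pos hp0] at h2
      exact h2.comp h1
  rw [lintegral_zero] at h
  simp only [eLpNorm_ofReal hp]
  have h2 := (ENNReal.continuous_rpow_const (y := 1 / p)).tendsto 0
  rw [ENNReal.zero_rpow_of_pos (by positivity)] at h2
  exact h2.comp h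

/-! ### Mollification -/

/-- A sequence of bump functions shrinking to the origin. -/
def bump (n k : ℕ) : ContDiffBump (0 : E n) where
  rIn := 1 / (2 * (k + 1))
  rOut := 1 / (k + 1)
  rIn_pos := by positivity
  rIn_lt_rOut := by
    rw [div_lt_div_iff₀ (by positivity) (by positivity)]
    have : (0 : ℝ) ≤ k := k.cast_nonneg
    linarith

/-- The smooth probability density on a ball of radius `1 / (k + 1)`. -/
def bumpDensity (k : ℕ) (x : E n) : ℝ := (bump n k).normed volume x

theorem tendsto_bump_rOut :
    Filter.Tendsto (fun k => (bump n k).rOut) Filter.atTop (nhds 0) :=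
  tendsto_one_div_add_atTop_nhds_zero_nat

theorem contDiff_bumpDensity (k : ℕ) : ContDiff ℝ ∞ (bumpDensity k : E n → ℝ) :=
  (bump n k).contDiff_normed

theorem hasCompactSupport_bumpDensity (k : ℕ) : HasCompactSupport (bumpDensity k : E n → ℝ) :=
  (bump n k).hasCompactSupport_normed

theorem bumpDensity_nonneg (k : ℕ) (x : E n) : 0 ≤ bumpDensity k x :=
  (bump n k).nonneg_normed x

theorem bumpDensity_eq_zero {k : ℕ} {x : E n} (hx : 1 / ((k : ℝ) + 1) ≤ ‖x‖) :
    bumpDensity k x = 0 := by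
  have h : x ∉ Function.support ((bump n k).normed volume) := by
    rw [ContDiffBump.support_normed_eq]
    simpa [bump] using hx
  exact Function.notMem_support.mp h

theorem lintegral_bumpDensity (k : ℕ) :
    ∫⁻ x : E n, ENNReal.ofReal (bumpDensity k x) = 1 := by
  have h := (bump n k).integral_normed (μ := volume)
  have hi : Integrable (bumpDensity k : E n → ℝ) := (bump n k).integrable_normed
  change ∫ x, bumpDensity k x = 1 at h
  rw [← ofReal_integral_eq_lintegral_ofReal hi (ae_of_all _ (bumpDensity_nonneg k)), h]
  simp

/-- The mollification of a function. -/
def mollify (k : ℕ) (f : E n → ℝ) (x : E n) : ℝ := ∫ t, bumpDensity k (x - t) * f t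

theorem mollify_eq_convolution (k : ℕ) (f : E n → ℝ) :
    mollify k f = convolution (bumpDensity k) f (ContinuousLinearMap.lsmul ℝ ℝ) volume := by
  ext x
  rw [convolution_eq_swap]
  rfl

theorem contDiff_mollify (k : ℕ) {f : E n → ℝ} (hf : LocallyIntegrable f) :
    ContDiff ℝ ∞ (mollify k f) := by
  rw [mollify_eq_convolution]
  exact (hasCompactSupport_bumpDensity k).contDiff_convolution_left _ (contDiff_bumpDensity k) hf

theorem integrable_bumpDensity_mul (k : ℕ) {f : E n → ℝ} (hf : LocallyIntegrable f) (x : E n) :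
    Integrable fun t => bumpDensity k (x - t) * f t :=
  ((hasCompactSupport_bumpDensity k).convolutionExists_left (ContinuousLinearMap.lsmul ℝ ℝ)
    (contDiff_bumpDensity k).continuous hf x).integrable_swap

theorem mollify_sub (k : ℕ) {f g : E n → ℝ} (hf : LocallyIntegrable f) (hg : LocallyIntegrable g) :
    mollify k (f - g) = mollify k f - mollify k g := by
  ext x
  rw [Pi.sub_apply, mollify, mollify, mollify, ← integral_sub (integrable_bumpDensity_mul k hf x)
    (integrable_bumpDensity_mul k hg x)]
  congr 1; ext t; simp [mul_sub]

theorem mollify_eq_zero {k : ℕ} {f : E n → ℝ} {r : ℝ} (hf : ∀ x, r < ‖x‖ → f x = 0) {x : E n}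
    (hx : r + 1 / ((k : ℝ) + 1) < ‖x‖) : mollify k f x = 0 := by
  rw [mollify, integral_eq_zero_of_ae]
  refine ae_of_all _ fun t => ?_
  by_cases ht : r < ‖t‖
  · simp [hf t ht]
  · have : 1 / ((k : ℝ) + 1) ≤ ‖x - t‖ := by
      have := norm_sub_norm_le x t
      linarith
    simp [bumpDensity_eq_zero this]

/-- Weak partial derivatives on the whole space. -/
def HasGlobalWeakPartial (i : Fin n) (f g : E n → ℝ) : Prop :=
  ∀ ψ : E n → ℝ, ContDiff ℝ ∞ ψ → HasCompactSupport ψ → ∫ x, f x * pd i ψ x = -∫ x, g x * ψ x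

/-- Differentiation falls on the kernel, and `t ↦ ρ (x - t)` is itself an admissible test function,
whose derivative in `t` is minus its derivative in `x`. -/
theorem pd_mollify (i : Fin n) (k : ℕ) {f g : E n → ℝ} (hf : LocallyIntegrable f)
    (h : HasGlobalWeakPartial i f g) : pd i (mollify k f) = mollify k g := by
  ext x
  set L := ContinuousLinearMap.lsmul ℝ ℝ (E := ℝ)
  have hd := (hasCompactSupport_bumpDensity k).hasFDerivAt_convolution_left L
    ((contDiff_bumpDensity k).of_le (by simp)) hf x
  rw [← mollify_eq_convolution] at hd
  have hi := (((hasCompactSupport_bumpDensity k).fderiv ℝ).convolutionExists_left (L.precompL (E n))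
    ((contDiff_bumpDensity k).continuous_fderiv (by simp)) hf x).integrable_swap
  rw [pd_eq_of_hasFDerivAt i hd, convolution_eq_swap, ContinuousLinearMap.integral_apply hi]
  have hψ := h (fun t => bumpDensity k (x - t)) ((contDiff_bumpDensity k).comp
    (contDiff_const.sub contDiff_id))
    ((hasCompactSupport_bumpDensity k).comp_homeomorph (Homeomorph.subLeft x))
  have hpd : ∀ t, pd i (fun t => bumpDensity k (x - t)) t = -pd i (bumpDensity k) (x - t) := by
    intro t
    have h1 : HasFDerivAt (fun t => bumpDensity k (x - t))
        ((fderiv ℝ (bumpDensity k) (x - t)).comp (-ContinuousLinearMap.id ℝ (E n))) t :=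
      HasFDerivAt.comp t (((contDiff_bumpDensity k).differentiable (by simp)) (x - t)).hasFDerivAt
        ((hasFDerivAt_id t).const_sub x)
    rw [pd_eq_of_hasFDerivAt i h1]
    simp [pd]
  have e1 : ∫ t, f t * pd i (fun t => bumpDensity k (x - t)) t =
      -∫ t, ((L.precompL (E n)) (fderiv ℝ (bumpDensity k) (x - t)) (f t))
        (EuclideanSpace.single i 1) := by
    rw [← integral_neg]
    refine integral_congr_ae (ae_of_all _ fun t => ?_)
    simp only [hpd]
    simp [pd, L, mul_comm]
  rw [e1, neg_inj] at hψ
  rw [hψ, mollify]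
  exact integral_congr_ae (ae_of_all _ fun t => mul_comm _ _)

/-- Young's inequality for mollifications. -/
theorem eLpNorm_mollify_le {p : ℝ} (hp : 1 < p) (k : ℕ) {f : E n → ℝ}
    (hf : AEStronglyMeasurable f volume) :
    eLpNorm (mollify k f) (ENNReal.ofReal p) volume ≤ eLpNorm f (ENNReal.ofReal p) volume := by
  have hp0 : 0 < p := by linarith
  have hpq := Real.HolderConjugate.conjExponent hp
  set q := Real.conjExponent p
  have hq0 : 0 < q := hpq.symm.pos
  set ρ : E n → ℝ≥0∞ := fun x => ENNReal.ofReal (bumpDensity k x) with hρ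
  have hρm : Measurable ρ := (contDiff_bumpDensity k).continuous.measurable.ennreal_ofReal
  have hsum : 1 / q + 1 / p = 1 := by
    rw [one_div, one_div, add_comm]; exact hpq.inv_add_inv_eq_one
  have hpt : ∀ x, ‖mollify k f x‖ₑ ^ p ≤ ∫⁻ t, ρ (x - t) * ‖f t‖ₑ ^ p := by
    intro x
    have hρx : Measurable fun t => ρ (x - t) := hρm.comp (measurable_const.sub measurable_id)
    have h1 : ‖mollify k f x‖ₑ ≤ ∫⁻ t, ρ (x - t) * ‖f t‖ₑ := by
      refine (enorm_integral_le_lintegral_enorm _).trans_eq ?_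
      refine lintegral_congr fun t => ?_
      rw [enorm_mul, Real.enorm_of_nonneg (bumpDensity_nonneg k _)]
    -- Hölder after the splitting `ρ = ρ^(1/q) ρ^(1/p)`; the first factor has unit `L^q` norm
    -- because `ρ` is a probability density.
    have h2 := ENNReal.lintegral_mul_le_Lp_mul_Lq volume hpq.symm
      (f := fun t => ρ (x - t) ^ (1 / q)) (g := fun t => ρ (x - t) ^ (1 / p) * ‖f t‖ₑ)
      (hρx.pow_const _).aemeasurable ((hρx.pow_const _).aemeasurable.mul hf.enorm)
    have h3 : ∀ t, ((fun t => ρ (x - t) ^ (1 / q)) * fun t => ρ (x - t) ^ (1 / p) * ‖f t‖ₑ) t =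
        ρ (x - t) * ‖f t‖ₑ := by
      intro t
      rw [Pi.mul_apply, ← mul_assoc, ← ENNReal.rpow_add_of_nonneg _ _ (by positivity)
        (by positivity), hsum, ENNReal.rpow_one]
    have h4 : ∫⁻ t, (ρ (x - t) ^ (1 / q)) ^ q = 1 := by
      simp_rw [← ENNReal.rpow_mul, one_div_mul_cancel hq0.ne', ENNReal.rpow_one]
      rw [lintegral_sub_left_eq_self ρ x]
      exact lintegral_bumpDensity k
    have h5 : ∀ t, (ρ (x - t) ^ (1 / p) * ‖f t‖ₑ) ^ p = ρ (x - t) * ‖f t‖ₑ ^ p := by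
      intro t
      rw [ENNReal.mul_rpow_of_nonneg _ _ hp0.le, ← ENNReal.rpow_mul,
        one_div_mul_cancel hp0.ne', ENNReal.rpow_one]
    simp only [h3, h4, h5, ENNReal.one_rpow, one_mul] at h2
    calc ‖mollify k f x‖ₑ ^ p ≤ ((∫⁻ t, ρ (x - t) * ‖f t‖ₑ ^ p) ^ (1 / p)) ^ p := by
          gcongr; exact h1.trans h2
      _ = _ := by rw [← ENNReal.rpow_mul, one_div_mul_cancel hp0.ne', ENNReal.rpow_one]
  rw [eLpNorm_ofReal hp, eLpNorm_ofReal hp]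
  refine ENNReal.rpow_le_rpow ?_ (by positivity)
  calc ∫⁻ x, ‖mollify k f x‖ₑ ^ p ≤ ∫⁻ x, ∫⁻ t, ρ (x - t) * ‖f t‖ₑ ^ p := lintegral_mono hpt
    _ = ∫⁻ t, ∫⁻ x, ρ (x - t) * ‖f t‖ₑ ^ p := by
        refine lintegral_lintegral_swap ?_
        refine AEMeasurable.mul (hρm.comp (measurable_fst.sub measurable_snd)).aemeasurable ?_
        exact (hf.enorm.pow_const p).comp_snd
    _ = ∫⁻ t, ‖f t‖ₑ ^ p := by
        refine lintegral_congr fun t => ?_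
        have hρt : Measurable fun x => ρ (x - t) := hρm.comp (measurable_id.sub measurable_const)
        rw [lintegral_mul_const _ hρt, lintegral_sub_right_eq_self ρ t]
        rw [show ∫⁻ x, ρ x = 1 from lintegral_bumpDensity k, one_mul]

theorem locallyIntegrable_of_memLp {p : ℝ} (hp : 1 < p) {f : E n → ℝ}
    (hf : MemLp f (ENNReal.ofReal p) volume) : LocallyIntegrable f :=
  hf.locallyIntegrable (fact_one_le hp).out

theorem tendsto_mollify_of_continuous {p : ℝ} (hp : 1 < p) {g : E n → ℝ} (hg : Continuous g)
    (hc : HasCompactSupport g) :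
    Filter.Tendsto (fun k => eLpNorm (mollify k g - g) (ENNReal.ofReal p) volume) Filter.atTop
      (nhds 0) := by
  have hK : IsCompact (Metric.cthickening 1 (tsupport g)) := hc.isCompact.cthickening
  have hli : LocallyIntegrable g := hg.locallyIntegrable
  refine tendsto_eLpNorm_zero_of_dominated hp
    -- The bound `1` comes from uniform continuity of `g` at a single scale; smallness is supplied
    -- by pointwise convergence.
    (F := (Metric.cthickening 1 (tsupport g)).indicator fun _ => 1) (fun k => ?_) ?_ ?_ ?_
  · exact ((contDiff_mollify k hli).continuous.sub hg).aestronglyMeasurable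
  · exact memLp_indicator_const _ hK.measurableSet _ (Or.inr hK.measure_lt_top.ne)
  · have hu := hc.uniformContinuous_of_continuous hg
    rw [Metric.uniformContinuous_iff] at hu
    obtain ⟨δ, hδ, hu⟩ := hu 1 one_pos
    filter_upwards [tendsto_bump_rOut.eventually (gt_mem_nhds hδ),
      (tendsto_bump_rOut (n := n)).eventually (gt_mem_nhds one_pos)] with k hk hk1
    refine ae_of_all _ fun x => ?_
    by_cases hx : x ∈ Metric.cthickening 1 (tsupport g)
    · simp only [Pi.sub_apply, hx, indicator_of_mem]
      have h1 := (bump n k).dist_normed_convolution_le (μ := volume) (x₀ := x) (ε := 1)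
        hg.aestronglyMeasurable fun y hy => (hu ((Metric.mem_ball.mp hy).trans hk)).le
      have h2 : mollify k g x = _ := congrFun (mollify_eq_convolution k g) x
      rw [h2]
      exact h1
    · have h0 : mollify k g x = 0 := by
        rw [mollify, integral_eq_zero_of_ae]
        refine ae_of_all _ fun t => ?_
        by_cases ht : t ∈ tsupport g
        · have : 1 / ((k : ℝ) + 1) ≤ ‖x - t‖ := by
            by_contra hlt
            refine hx (Metric.mem_cthickening_of_dist_le x t 1 _ ht ?_)
            rw [dist_eq_norm]
            have : 1 / ((k : ℝ) + 1) < 1 := hk1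
            linarith
          simp [bumpDensity_eq_zero this]
        · simp [image_eq_zero_of_notMem_tsupport ht]
      have h1 : g x = 0 := image_eq_zero_of_notMem_tsupport fun h =>
        hx (Metric.self_subset_cthickening _ h)
      simp [hx, h0, h1]
  · refine ae_of_all _ fun x => ?_
    have h := ContDiffBump.convolution_tendsto_right_of_continuous (μ := volume)
      (tendsto_bump_rOut (n := n)) hg x
    have h2 := h.sub_const (g x)
    rw [sub_self] at h2
    refine h2.congr fun k => ?_
    rw [Pi.sub_apply, mollify_eq_convolution]
    rfl

/-- Approximate `f` in `L^p` by a continuous compactly supported `g`; Young's inequality controls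
the mollification of `f - g` uniformly in `k`. -/
theorem tendsto_mollify {p : ℝ} (hp : 1 < p) {f : E n → ℝ}
    (hf : MemLp f (ENNReal.ofReal p) volume) :
    Filter.Tendsto (fun k => eLpNorm (mollify k f - f) (ENNReal.ofReal p) volume) Filter.atTop
      (nhds 0) := by
  have h1p := (fact_one_le hp).out
  rw [ENNReal.tendsto_nhds_zero]
  intro ε hε
  have hε3 : ε / 3 ≠ 0 := (ENNReal.div_pos hε.ne' (by simp)).ne'
  obtain ⟨g, hgc, hfg, hg, hgL⟩ := hf.exists_hasCompactSupport_eLpNorm_sub_le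
    ENNReal.ofReal_ne_top hε3
  have hli := locallyIntegrable_of_memLp hp hf
  have hgi : LocallyIntegrable g := hg.locallyIntegrable
  filter_upwards [ENNReal.tendsto_nhds_zero.mp (tendsto_mollify_of_continuous hp hg hgc) (ε / 3)
    (pos_iff_ne_zero.mpr hε3)] with k hk
  have hfgL := hf.sub hgL
  have e : mollify k f - f = (mollify k (f - g) + (mollify k g - g)) + (g - f) := by
    rw [mollify_sub k hli hgi]; abel
  have m1 : AEStronglyMeasurable (mollify k (f - g)) volume :=
    (contDiff_mollify k (hli.sub hgi)).continuous.aestronglyMeasurable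
  have m2 : AEStronglyMeasurable (mollify k g - g) volume :=
    ((contDiff_mollify k hgi).continuous.sub hg).aestronglyMeasurable
  rw [e]
  calc _ ≤ eLpNorm (mollify k (f - g)) (ENNReal.ofReal p) volume +
        eLpNorm (mollify k g - g) (ENNReal.ofReal p) volume +
        eLpNorm (g - f) (ENNReal.ofReal p) volume :=
      (eLpNorm_add_le (m1.add m2) (hgL.sub hf).1 h1p).trans
        (add_le_add_left (eLpNorm_add_le m1 m2 h1p) _)
    _ ≤ ε / 3 + ε / 3 + ε / 3 := by
        gcongr
        · exact (eLpNorm_mollify_le hp k hfgL.1).trans hfg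
        · rw [eLpNorm_sub_comm]; exact hfg
    _ = ε := ENNReal.add_thirds ε

/-! ### Localization -/

/-- After multiplication by `χ` the function extends by zero to all of `ℝⁿ`, where it can be
mollified by convolution. Testing with `ψ χ` is legitimate even if `ψ` is not supported in the ball.
-/
theorem HasWeakPartial.cutoff {i : Fin n} {u w χ : E n → ℝ} (h : HasWeakPartial i u w)
    (hχ : IsTest χ) :
    HasGlobalWeakPartial i (fun x => χ x * u x) (fun x => χ x * w x + pd i χ x * u x) := by
  intro ψ hψ _
  have hχψ : IsTest fun x => ψ x * χ x := hχ.smooth_mul hψ.contDiffOn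
  have hdχψ : IsTest fun x => ψ x * pd i χ x := (hχ.pd i).smooth_mul hψ.contDiffOn
  have z1 : ∫ x in ball n, χ x * u x * pd i ψ x = ∫ x, χ x * u x * pd i ψ x :=
    setIntegral_eq_integral_of_forall_compl_eq_zero fun x hx => by simp [hχ.eq_zero hx]
  have z2 : ∫ x in ball n, (χ x * w x + pd i χ x * u x) * ψ x =
      ∫ x, (χ x * w x + pd i χ x * u x) * ψ x :=
    setIntegral_eq_integral_of_forall_compl_eq_zero fun x hx => by
      simp [hχ.eq_zero hx, (hχ.pd i).eq_zero hx]
  have h1 : ∫ x in ball n, χ x * u x * pd i ψ x =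
      ∫ x in ball n, (u x * pd i (fun y => ψ y * χ y) x - u x * (ψ x * pd i χ x)) := by
    refine setIntegral_congr_fun isOpen_ball.measurableSet fun x hx => ?_
    simp only [pd_mul i (hψ.differentiable (by simp) x) (hχ.differentiable x)]
    ring
  have h2 : ∫ x in ball n, (χ x * w x + pd i χ x * u x) * ψ x =
      ∫ x in ball n, (w x * (ψ x * χ x) + u x * (ψ x * pd i χ x)) := by
    congr 1; ext x; ring
  rw [← z1, ← z2, h1, h2, integral_sub ((hχψ.pd i).integrable_mul h.1) (hdχψ.integrable_mul h.1),
    integral_add (hχψ.integrable_mul h.2.1) (hdχψ.integrable_mul h.1), h.2.2 _ hχψ]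
  ring

theorem HasGlobalWeakPartial.add {i : Fin n} {f g f' g' : E n → ℝ}
    (h : HasGlobalWeakPartial i f g) (h' : HasGlobalWeakPartial i f' g')
    (hf : LocallyIntegrable f) (hg : LocallyIntegrable g) (hf' : LocallyIntegrable f')
    (hg' : LocallyIntegrable g') :
    HasGlobalWeakPartial i (fun x => f x + f' x) (fun x => g x + g' x) := by
  intro ψ hψ hc
  have key : ∀ {a b : E n → ℝ}, LocallyIntegrable a → Continuous b → HasCompactSupport b →
      Integrable fun x => a x * b x := fun ha hb hbc =>
    (ha.integrable_smul_left_of_hasCompactSupport hb hbc).congr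
      (ae_of_all _ fun x => by simp [mul_comm])
  have hd : Continuous (pd i ψ) := (hψ.continuous_fderiv (by simp)).clm_apply continuous_const
  have hdc : HasCompactSupport (pd i ψ) :=
    hc.of_isClosed_subset (isClosed_tsupport _) (tsupport_pd_subset i ψ)
  simp only [add_mul]
  rw [integral_add (key hf hd hdc) (key hf' hd hdc),
    integral_add (key hg hψ.continuous hc) (key hg' hψ.continuous hc), h ψ hψ hc, h' ψ hψ hc]
  ring

theorem memLp_volume_of_vol {p : ℝ≥0∞} {f : E n → ℝ} (hf : MemLp f p (vol n))
    (h0 : ∀ x ∉ ball n, f x = 0) : MemLp f p volume := by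
  have h1 := hf.mono_measure volume_restrict_le_vol
  rw [← memLp_indicator_iff_restrict isOpen_ball.measurableSet] at h1
  have : (ball n).indicator f = f := by
    rw [indicator_eq_self]
    intro x hx
    by_contra h
    exact hx (h0 x h)
  rwa [this] at h1

theorem IsTest.memLp_mul {p : ℝ≥0∞} {χ f : E n → ℝ} (hχ : IsTest χ) (k : ℕ)
    (hf : MemLp (fun x => (conf x ^ k)⁻¹ * f x) p (vol n)) :
    MemLp (fun x => χ x * f x) p volume := by
  refine memLp_volume_of_vol ?_ fun x hx => by simp [hχ.eq_zero hx]
  have h1 := hχ.smooth_mul (contDiffOn_conf_pow k)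
  obtain ⟨S, hS⟩ := h1.exists_abs_le
  refine (memLp_bdd_mul h1.continuous.continuousOn (fun x _ => hS x) hf).ae_eq ?_
  filter_upwards [ae_vol_mem_ball] with x hx
  have := (pow_pos (conf_pos hx) k).ne'
  field_simp

theorem IsTest.exists_radius {χ : E n → ℝ} (hχ : IsTest χ) :
    ∃ r < 1, 0 ≤ r ∧ ∀ x, r < ‖x‖ → χ x = 0 := by
  rcases (tsupport χ).eq_empty_or_nonempty with h | h
  · refine ⟨0, one_pos, le_rfl, fun x _ => image_eq_zero_of_notMem_tsupport (by simp [h])⟩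
  · obtain ⟨y, hy, hmax⟩ := hχ.2.1.isCompact.exists_isMaxOn h continuous_norm.continuousOn
    refine ⟨‖y‖, by simpa using hχ.2.2 hy, norm_nonneg _, fun x hx =>
      image_eq_zero_of_notMem_tsupport fun hxs => ?_⟩
    exact absurd (hmax hxs) (not_le.mpr hx)

/-- On the compact ball of radius `r < 1` both `b` and the density `conf^n` are bounded, so
Euclidean `L^p` convergence of functions supported there gives hyperbolic convergence. -/
theorem exists_eLpNorm_vol_le {p : ℝ} (hp : 1 < p) {r : ℝ} (hr : r < 1) {b : E n → ℝ}
    (hb : ContinuousOn b (ball n)) :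
    ∃ C : ℝ≥0∞, C ≠ ⊤ ∧ ∀ f : E n → ℝ, (∀ x, r < ‖x‖ → f x = 0) →
      eLpNorm (fun x => b x * f x) (ENNReal.ofReal p) (vol n) ≤
        C * eLpNorm f (ENNReal.ofReal p) volume := by
  have hp0 : 0 < p := by linarith
  have hK : IsCompact (Metric.closedBall (0 : E n) r) := isCompact_closedBall 0 r
  have hKb : Metric.closedBall (0 : E n) r ⊆ ball n := Metric.closedBall_subset_ball hr
  obtain ⟨B, hB⟩ := hK.exists_bound_of_continuousOn (hb.mono hKb)
  obtain ⟨D, hD⟩ := hK.exists_bound_of_continuousOn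
    ((contDiffOn_conf_pow (n := n) n).continuousOn.mono hKb)
  refine ⟨(ENNReal.ofReal D * ENNReal.ofReal B ^ p) ^ (1 / p), ?_, fun f hf => ?_⟩
  · refine (ENNReal.rpow_lt_top_of_nonneg (by positivity) ?_).ne
    exact ENNReal.mul_ne_top ENNReal.ofReal_ne_top
      (ENNReal.rpow_lt_top_of_nonneg hp0.le ENNReal.ofReal_ne_top).ne
  · rw [eLpNorm_ofReal hp, eLpNorm_ofReal hp, ← ENNReal.mul_rpow_of_nonneg _ _ (by positivity)]
    refine ENNReal.rpow_le_rpow ?_ (by positivity)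
    rw [lintegral_vol, ← lintegral_const_mul' _ _ (ENNReal.mul_ne_top ENNReal.ofReal_ne_top
      (ENNReal.rpow_lt_top_of_nonneg hp0.le ENNReal.ofReal_ne_top).ne)]
    refine (setLIntegral_le_lintegral _ _).trans (lintegral_mono fun x => ?_)
    by_cases hx : r < ‖x‖
    · simp [hf x hx, hp0]
    · have hxK : x ∈ Metric.closedBall (0 : E n) r := by simpa using hx
      rw [enorm_mul, ENNReal.mul_rpow_of_nonneg _ _ hp0.le, ← mul_assoc]
      gcongr
      · exact (le_abs_self _).trans (hD x hxK)
      · rw [← ofReal_norm]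
        exact ENNReal.ofReal_le_ofReal (hB x hxK)

theorem tendsto_mollify_vol {p : ℝ} (hp : 1 < p) {r : ℝ} (hr : r < 1) {b f : E n → ℝ}
    (hb : ContinuousOn b (ball n)) (hf : MemLp f (ENNReal.ofReal p) volume)
    (h0 : ∀ x, r < ‖x‖ → f x = 0) :
    Filter.Tendsto (fun k => eLpNorm (fun x => b x * (mollify k f x - f x)) (ENNReal.ofReal p)
      (vol n)) Filter.atTop (nhds 0) := by
  -- The radius `(1 + r) / 2` leaves room for mollification, which enlarges the support by less than
  -- `(1 - r) / 2` for large `k`.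
  obtain ⟨C, hC, hle⟩ := exists_eLpNorm_vol_le hp (show (1 + r) / 2 < 1 by linarith) hb
  have h1 := ENNReal.Tendsto.const_mul (a := C) (tendsto_mollify hp hf) (Or.inr hC)
  rw [mul_zero] at h1
  refine tendsto_of_tendsto_of_tendsto_of_le_of_le' tendsto_const_nhds h1
    (Filter.Eventually.of_forall fun _ => zero_le) ?_
  filter_upwards [tendsto_one_div_add_atTop_nhds_zero_nat.eventually
    (gt_mem_nhds (show 0 < (1 - r) / 2 by linarith))] with k hk
  refine hle _ fun x hx => ?_
  rw [mollify_eq_zero h0 (by linarith), h0 x (by linarith), sub_zero]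

theorem eventually_isTest_mollify {r : ℝ} (hr : r < 1) {f : E n → ℝ} (hf : LocallyIntegrable f)
    (h0 : ∀ x, r < ‖x‖ → f x = 0) : ∀ᶠ k in Filter.atTop, IsTest (mollify k f) := by
  filter_upwards [tendsto_one_div_add_atTop_nhds_zero_nat.eventually
    (gt_mem_nhds (show 0 < (1 - r) / 2 by linarith))] with k hk
  have hs : tsupport (mollify k f) ⊆ Metric.closedBall 0 ((1 + r) / 2) := by
    refine closure_minimal (fun x hx => ?_) Metric.isClosed_closedBall
    by_contra h
    refine hx (mollify_eq_zero h0 ?_)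
    have : (1 + r) / 2 < ‖x‖ := by simpa using h
    linarith
  exact ⟨contDiff_mollify k hf, (isCompact_closedBall 0 _).of_isClosed_subset
    (isClosed_tsupport _) hs, hs.trans (Metric.closedBall_subset_ball (by linarith))⟩

/-! ### Cutoff functions -/

/-- A smooth step from `0` on `(-∞, 1]` to `1` on `[2, ∞)`. -/
def step (t : ℝ) : ℝ := Real.smoothTransition (t - 1)

theorem contDiff_step : ContDiff ℝ ∞ step :=
  Real.smoothTransition.contDiff.comp (contDiff_id.sub contDiff_const)

theorem contDiff_deriv_step : ContDiff ℝ ∞ (deriv step) :=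
  ((contDiff_infty_iff_deriv).mp contDiff_step).2

theorem contDiff_deriv_deriv_step : ContDiff ℝ ∞ (deriv (deriv step)) :=
  ((contDiff_infty_iff_deriv).mp contDiff_deriv_step).2

theorem step_of_le {t : ℝ} (ht : t ≤ 1) : step t = 0 :=
  Real.smoothTransition.zero_of_nonpos (by linarith)

theorem step_of_ge {t : ℝ} (ht : 2 ≤ t) : step t = 1 :=
  Real.smoothTransition.one_of_one_le (by linarith)

theorem deriv_step_of_notMem {t : ℝ} (ht : t ∉ Icc (1 : ℝ) 2) : deriv step t = 0 := by
  rw [mem_Icc, not_and_or, not_le, not_le] at ht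
  rcases ht with ht | ht
  · have : step =ᶠ[nhds t] fun _ => 0 := by
      filter_upwards [gt_mem_nhds ht] with y hy using step_of_le hy.le
    rw [this.deriv_eq, deriv_const]
  · have : step =ᶠ[nhds t] fun _ => 1 := by
      filter_upwards [lt_mem_nhds ht] with y hy using step_of_ge hy.le
    rw [this.deriv_eq, deriv_const]

theorem deriv_deriv_step_of_notMem {t : ℝ} (ht : t ∉ Icc (1 : ℝ) 2) :
    deriv (deriv step) t = 0 := by
  have : deriv step =ᶠ[nhds t] fun _ => 0 := by
    filter_upwards [isClosed_Icc.isOpen_compl.mem_nhds ht] with y hy using deriv_step_of_notMem hy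
  rw [this.deriv_eq, deriv_const]

/-- Both functions are continuous with support in `[1, 2]`. They are the scale invariant
combinations that occur in the hyperbolic derivatives of the cutoffs. -/
theorem exists_step_bound : ∃ C, 0 ≤ C ∧ (∀ t, |t * deriv step t| ≤ C) ∧
    ∀ t, |t ^ 2 * deriv (deriv step) t| ≤ C := by
  have key : ∀ f : ℝ → ℝ, Continuous f → (∀ t ∉ Icc (1 : ℝ) 2, f t = 0) → ∃ C, ∀ t, |f t| ≤ C := by
    intro f hf h0
    have hc : HasCompactSupport f := HasCompactSupport.intro isCompact_Icc fun t ht => h0 t ht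
    obtain ⟨C, hC⟩ := hf.norm.bddAbove_range_of_hasCompactSupport hc.norm
    exact ⟨C, fun t => hC ⟨t, rfl⟩⟩
  obtain ⟨C1, h1⟩ := key (fun t => t * deriv step t)
    (continuous_id.mul contDiff_deriv_step.continuous)
    fun t ht => by simp [deriv_step_of_notMem ht]
  obtain ⟨C2, h2⟩ := key (fun t => t ^ 2 * deriv (deriv step) t)
    ((continuous_id.pow 2).mul contDiff_deriv_deriv_step.continuous)
    fun t ht => by simp [deriv_deriv_step_of_notMem ht]
  exact ⟨max C1 C2, (abs_nonneg _).trans ((h1 0).trans (le_max_left _ _)),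
    fun t => (h1 t).trans (le_max_left _ _), fun t => (h2 t).trans (le_max_right _ _)⟩

/-- Cutoff functions exhausting the ball. -/
def cutoff (R : ℕ) (x : E n) : ℝ := step (R * (1 - ‖x‖ ^ 2))

theorem isTest_cutoff (R : ℕ) : IsTest (cutoff R : E n → ℝ) := by
  have hcl : IsClosed {x : E n | (1 : ℝ) ≤ R * (1 - ‖x‖ ^ 2)} :=
    isClosed_le continuous_const (by fun_prop)
  have hsub : {x : E n | (1 : ℝ) ≤ R * (1 - ‖x‖ ^ 2)} ⊆ ball n := by
    intro x hx
    have hx' : (1 : ℝ) ≤ R * (1 - ‖x‖ ^ 2) := hx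
    have hR : (0 : ℝ) ≤ R := R.cast_nonneg
    have : 0 < 1 - ‖x‖ ^ 2 := by
      by_contra h
      nlinarith
    rw [mem_ball_zero_iff]
    nlinarith [norm_nonneg x]
  have hs : tsupport (cutoff R : E n → ℝ) ⊆ {x : E n | (1 : ℝ) ≤ R * (1 - ‖x‖ ^ 2)} := by
    refine closure_minimal (fun x hx => ?_) hcl
    by_contra h
    exact hx (step_of_le (not_le.mp h).le)
  refine ⟨contDiff_step.comp (contDiff_const.mul (contDiff_const.sub (contDiff_norm_sq ℝ))), ?_,
    hs.trans hsub⟩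
  exact (isCompact_closedBall (0 : E n) 1).of_isClosed_subset (isClosed_tsupport _)
    ((hs.trans hsub).trans Metric.ball_subset_closedBall)

theorem abs_one_sub_cutoff_le (R : ℕ) (x : E n) : |1 - cutoff R x| ≤ 1 := by
  have h0 := Real.smoothTransition.nonneg (R * (1 - ‖x‖ ^ 2) - 1)
  have h1 := Real.smoothTransition.le_one (R * (1 - ‖x‖ ^ 2) - 1)
  rw [cutoff, step, abs_le]; constructor <;> linarith

theorem differentiableAt_cutoffArg (R : ℕ) (x : E n) :
    DifferentiableAt ℝ (fun y : E n => (R : ℝ) * (1 - ‖y‖ ^ 2)) x :=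
  ((differentiableAt_normSq x).const_sub 1).const_mul _

theorem pd_cutoffArg (i : Fin n) (R : ℕ) (x : E n) :
    pd i (fun y : E n => (R : ℝ) * (1 - ‖y‖ ^ 2)) x = -2 * R * x i := by
  have h1 : HasDerivAt (fun t : ℝ => (R : ℝ) * (1 - t)) (-R) (‖x‖ ^ 2) :=
    (((hasDerivAt_id (‖x‖ ^ 2)).const_sub 1).const_mul (R : ℝ)).congr_deriv (by simp)
  rw [pd_comp (h := fun t : ℝ => (R : ℝ) * (1 - t)) i h1 (differentiableAt_normSq x), pd_normSq]
  ring

theorem pd_cutoff (i : Fin n) (R : ℕ) :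
    pd i (cutoff R) = fun x : E n => deriv step (R * (1 - ‖x‖ ^ 2)) * (-2 * R * x i) := by
  ext x
  rw [← pd_cutoffArg i R x]
  exact pd_comp i (contDiff_step.differentiable (by simp) _).hasDerivAt
    (differentiableAt_cutoffArg R x)

theorem pd_pd_cutoff (i : Fin n) (R : ℕ) (x : E n) :
    pd i (pd i (cutoff R)) x = deriv (deriv step) (R * (1 - ‖x‖ ^ 2)) * (-2 * R * x i) ^ 2 +
      deriv step (R * (1 - ‖x‖ ^ 2)) * (-2 * R) := by
  have hd := contDiff_deriv_step.differentiable (by simp)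
  have hc : DifferentiableAt ℝ (fun y : E n => y i) x :=
    (EuclideanSpace.proj i : E n →L[ℝ] ℝ).differentiableAt
  have hdc : DifferentiableAt ℝ (fun y : E n => deriv step (R * (1 - ‖y‖ ^ 2))) x :=
    DifferentiableAt.comp x (hd _) (differentiableAt_cutoffArg R x)
  rw [pd_cutoff, pd_mul i hdc (hc.const_mul _),
    pd_const_mul i _ hc, pd_coord, if_pos rfl,
    pd_comp i (hd _).hasDerivAt (differentiableAt_cutoffArg R x), pd_cutoffArg]
  ring

/-- A hyperbolic derivative carries a factor `1 - |x|²`, so with `t = R (1 - |x|²)` only `t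
step'(t)` and `t² step''(t)` appear, with coefficients bounded on the ball. Hence the bound does not
depend on `R`. -/
theorem exists_cutoff_bound : ∃ C, ∀ (R : ℕ), ∀ x ∈ ball n,
    (∀ i, |(conf x)⁻¹ * pd i (cutoff R) x| ≤ C) ∧ |laplaceBeltrami (cutoff R) x| ≤ C := by
  obtain ⟨C, hC, h1, h2⟩ := exists_step_bound
  refine ⟨(2 * n + 3) * C, fun R x hx => ?_⟩
  have hs := one_sub_normSq_pos hx
  have hsn := sq_nonneg ‖x‖
  have h1' := h1 (R * (1 - ‖x‖ ^ 2))
  have h2' := h2 (R * (1 - ‖x‖ ^ 2))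
  have hn0 : (0 : ℝ) ≤ n := n.cast_nonneg
  set A := deriv step (R * (1 - ‖x‖ ^ 2)) with hA
  set B := deriv (deriv step) (R * (1 - ‖x‖ ^ 2)) with hB
  constructor
  · intro i
    have hxi : |x i| ≤ 1 := (PiLp.norm_apply_le x i).trans (by nlinarith [norm_nonneg x])
    have e : (conf x)⁻¹ * pd i (cutoff R) x = -(R * (1 - ‖x‖ ^ 2) * A * x i) := by
      simp only [pd_cutoff, conf, ← hA]; field_simp
    rw [e, abs_neg, abs_mul]
    calc _ ≤ C * 1 := by gcongr
      _ ≤ _ := by nlinarith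
  · have hsum : ∑ i, x i ^ 2 = ‖x‖ ^ 2 := by
      rw [EuclideanSpace.norm_sq_eq]; simp
    have e : laplaceBeltrami (cutoff R) x = ‖x‖ ^ 2 * ((R * (1 - ‖x‖ ^ 2)) ^ 2 * B) -
        (n / 2 * (1 - ‖x‖ ^ 2) + (n - 2) * ‖x‖ ^ 2) * (R * (1 - ‖x‖ ^ 2) * A) := by
      rw [laplaceBeltrami_eq hx fun i => ((isTest_cutoff R).pd i).differentiable x]
      have e1 : ∑ i, pd i (pd i (cutoff R)) x = B * (4 * R ^ 2 * ‖x‖ ^ 2) + n * (A * (-2 * R)) := by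
        simp only [pd_pd_cutoff, Finset.sum_add_distrib, ← hA, ← hB, Finset.sum_const,
          Finset.card_univ, Fintype.card_fin, nsmul_eq_mul, ← Finset.mul_sum, mul_pow, hsum]
        ring
      have e2 : ∑ i, x i * pd i (cutoff R) x = A * (-2 * R) * ‖x‖ ^ 2 := by
        simp only [pd_cutoff, ← hA]
        rw [← hsum, Finset.mul_sum]
        exact Finset.sum_congr rfl fun i _ => by ring
      rw [e1, e2, conf]
      field_simp
      ring
    rw [e]
    refine (abs_sub _ _).trans ?_
    rw [abs_mul, abs_mul (_ + _), abs_of_nonneg hsn]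
    have b1 : ‖x‖ ^ 2 * |(R * (1 - ‖x‖ ^ 2)) ^ 2 * B| ≤ 1 * C := by
      gcongr; linarith
    have b2 : |(n : ℝ) / 2 * (1 - ‖x‖ ^ 2) + ((n : ℝ) - 2) * ‖x‖ ^ 2| ≤ 2 * (n : ℝ) + 2 := by
      rw [abs_le]; constructor <;> nlinarith
    calc _ ≤ 1 * C + (2 * (n : ℝ) + 2) * C := by gcongr
      _ = _ := by ring

theorem eventually_cutoff_arg {x : E n} (hx : x ∈ ball n) :
    ∀ᶠ R : ℕ in Filter.atTop, 2 < (R : ℝ) * (1 - ‖x‖ ^ 2) := by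
  have h : Filter.Tendsto (fun R : ℕ => (R : ℝ) * (1 - ‖x‖ ^ 2)) Filter.atTop Filter.atTop :=
    tendsto_natCast_atTop_atTop.atTop_mul_const (one_sub_normSq_pos hx)
  exact h.eventually_gt_atTop 2

theorem eventually_cutoff_eq {x : E n} (hx : x ∈ ball n) : ∀ᶠ R : ℕ in Filter.atTop,
    cutoff R x = 1 ∧ (∀ i, pd i (cutoff R) x = 0) ∧ laplaceBeltrami (cutoff R) x = 0 := by
  filter_upwards [eventually_cutoff_arg hx] with R hR
  have hR' : (R : ℝ) * (1 - ‖x‖ ^ 2) ∉ Icc (1 : ℝ) 2 := fun h => absurd h.2 (not_le.mpr hR)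
  have h1 : ∀ i, pd i (cutoff R) x = 0 := fun i => by
    rw [pd_cutoff]; simp [deriv_step_of_notMem hR']
  refine ⟨step_of_ge hR.le, h1, ?_⟩
  rw [laplaceBeltrami_eq hx fun i => ((isTest_cutoff R).pd i).differentiable x]
  simp [h1, pd_pd_cutoff, deriv_step_of_notMem hR', deriv_deriv_step_of_notMem hR']

/-- Dominated convergence: uniformly bounded multipliers that are eventually zero at each point
suffice. Thus the derivatives of the cutoffs need no decay in `R`. -/
theorem tendsto_eLpNorm_bdd_mul {p : ℝ} (hp : 1 < p) {b : ℕ → E n → ℝ} {f : E n → ℝ} {C : ℝ}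
    (hb : ∀ R, ContinuousOn (b R) (ball n)) (hC : ∀ R, ∀ x ∈ ball n, |b R x| ≤ C)
    (h0 : ∀ x ∈ ball n, ∀ᶠ R in Filter.atTop, b R x = 0)
    (hf : MemLp f (ENNReal.ofReal p) (vol n)) :
    Filter.Tendsto (fun R => eLpNorm (fun x => b R x * f x) (ENNReal.ofReal p) (vol n))
      Filter.atTop (nhds 0) := by
  refine tendsto_eLpNorm_zero_of_dominated hp
    (fun R => (aestronglyMeasurable_vol (hb R)).mul hf.1) (hf.norm.const_mul C) ?_ ?_
  · refine Filter.Eventually.of_forall fun R => ?_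
    filter_upwards [ae_vol_mem_ball] with x hx
    rw [abs_mul]
    exact mul_le_mul_of_nonneg_right (hC R x hx) (abs_nonneg _)
  · filter_upwards [ae_vol_mem_ball] with x hx
    refine tendsto_const_nhds.congr' ?_
    filter_upwards [h0 x hx] with R hR
    simp [hR]

/-! ### Density of test functions -/

theorem exists_natCast_mul_le (m : ℕ) {ε : ℝ≥0∞} (hε : ε ≠ 0) : ∃ δ : ℝ≥0∞, δ ≠ 0 ∧ m * δ ≤ ε :=
  ⟨ε / m, (ENNReal.div_pos hε (ENNReal.natCast_ne_top m)).ne', ENNReal.mul_div_le⟩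

theorem tendsto_eLpNorm_add_zero {p : ℝ} (hp : 1 < p) {μ : Measure (E n)} {f g : ℕ → E n → ℝ}
    (hfm : ∀ k, AEStronglyMeasurable (f k) μ) (hgm : ∀ k, AEStronglyMeasurable (g k) μ)
    (hf : Filter.Tendsto (fun k => eLpNorm (f k) (ENNReal.ofReal p) μ) Filter.atTop (nhds 0))
    (hg : Filter.Tendsto (fun k => eLpNorm (g k) (ENNReal.ofReal p) μ) Filter.atTop (nhds 0)) :
    Filter.Tendsto (fun k => eLpNorm (fun x => f k x + g k x) (ENNReal.ofReal p) μ) Filter.atTop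
      (nhds 0) := by
  have h := hf.add hg
  rw [add_zero] at h
  exact tendsto_of_tendsto_of_tendsto_of_le_of_le tendsto_const_nhds h (fun _ => zero_le)
    fun k => eLpNorm_add_le (hfm k) (hgm k) (fact_one_le hp).out

theorem tendsto_eLpNorm_sum_zero {ι : Type*} {s : Finset ι} {p : ℝ} (hp : 1 < p)
    {μ : Measure (E n)} {f : ι → ℕ → E n → ℝ} (hm : ∀ j ∈ s, ∀ k, AEStronglyMeasurable (f j k) μ)
    (h : ∀ j ∈ s, Filter.Tendsto (fun k => eLpNorm (f j k) (ENNReal.ofReal p) μ) Filter.atTop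
      (nhds 0)) :
    Filter.Tendsto (fun k => eLpNorm (fun x => ∑ j ∈ s, f j k x) (ENNReal.ofReal p) μ)
      Filter.atTop (nhds 0) := by
  have h1 := tendsto_finsetSum s h
  rw [Finset.sum_const_zero] at h1
  refine tendsto_of_tendsto_of_tendsto_of_le_of_le tendsto_const_nhds h1 (fun _ => zero_le)
    fun k => ?_
  have h2 := eLpNorm_sum_le (f := fun j => f j k) (fun j hj => hm j hj k) (fact_one_le hp).out
  refine le_of_eq_of_le ?_ h2
  congr 1; ext x; simp

theorem tendsto_cutoff_sub {p : ℝ} (hp : 1 < p) {f : E n → ℝ}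
    (hf : MemLp f (ENNReal.ofReal p) (vol n)) :
    Filter.Tendsto (fun R => eLpNorm (fun x => (1 - cutoff R x) * f x) (ENNReal.ofReal p) (vol n))
      Filter.atTop (nhds 0) :=
  tendsto_eLpNorm_bdd_mul hp (b := fun R x => 1 - cutoff R x)
    (fun R => (continuous_const.sub (isTest_cutoff R).continuous).continuousOn)
    (fun R x _ => abs_one_sub_cutoff_le R x)
    (fun x hx => (eventually_cutoff_eq hx).mono fun R h => by rw [h.1, sub_self]) hf

theorem tendsto_pd_cutoff_mul {p : ℝ} (hp : 1 < p) (i : Fin n) {f : E n → ℝ}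
    (hf : MemLp f (ENNReal.ofReal p) (vol n)) :
    Filter.Tendsto (fun R => eLpNorm (fun x => ((conf x)⁻¹ * pd i (cutoff R) x) * f x)
      (ENNReal.ofReal p) (vol n)) Filter.atTop (nhds 0) := by
  obtain ⟨C, hC⟩ := exists_cutoff_bound (n := n)
  exact tendsto_eLpNorm_bdd_mul hp (b := fun R x => (conf x)⁻¹ * pd i (cutoff R) x)
    (fun R => contDiffOn_conf_inv.continuousOn.mul
      ((isTest_cutoff R).pd i).continuous.continuousOn)
    (fun R x hx => (hC R x hx).1 i)
    (fun x hx => (eventually_cutoff_eq hx).mono fun R h => by rw [h.2.1 i, mul_zero]) hf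

theorem tendsto_laplace_cutoff_mul {p : ℝ} (hp : 1 < p) {f : E n → ℝ}
    (hf : MemLp f (ENNReal.ofReal p) (vol n)) :
    Filter.Tendsto (fun R => eLpNorm (fun x => laplaceBeltrami (cutoff R) x * f x)
      (ENNReal.ofReal p) (vol n)) Filter.atTop (nhds 0) := by
  obtain ⟨C, hC⟩ := exists_cutoff_bound (n := n)
  exact tendsto_eLpNorm_bdd_mul hp (b := fun R x => laplaceBeltrami (cutoff R) x)
    (fun R => (isTest_cutoff R).laplaceBeltrami.continuous.continuousOn)
    (fun R x hx => (hC R x hx).2)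
    (fun x hx => (eventually_cutoff_eq hx).mono fun R h => h.2.2) hf

theorem eLpNorm_euclidean_le_sum {p : ℝ} (hp : 1 < p) {μ : Measure (E n)} {f : E n → E n}
    (hm : ∀ i, AEStronglyMeasurable (fun x => f x i) μ) :
    eLpNorm f (ENNReal.ofReal p) μ ≤ ∑ i, eLpNorm (fun x => f x i) (ENNReal.ofReal p) μ := by
  have h1 : eLpNorm f (ENNReal.ofReal p) μ ≤
      eLpNorm (∑ i, fun x => ‖f x i‖) (ENNReal.ofReal p) μ := by
    refine eLpNorm_mono fun x => ?_
    rw [Finset.sum_apply, Real.norm_of_nonneg (Finset.sum_nonneg fun i _ => norm_nonneg _),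
      EuclideanSpace.norm_eq]
    refine Real.sqrt_le_sqrt (Finset.sum_sq_le_sq_sum_of_nonneg ?_) |>.trans ?_
    · exact fun i _ => norm_nonneg _
    · rw [Real.sqrt_sq (Finset.sum_nonneg fun i _ => norm_nonneg _)]
  refine h1.trans ((eLpNorm_sum_le (fun i _ => (hm i).norm) (fact_one_le hp).out).trans_eq ?_)
  exact Finset.sum_congr rfl fun i _ => eLpNorm_norm _

theorem aestronglyMeasurable_of_conf_mul {k : ℕ} {f : E n → ℝ}
    (h : AEStronglyMeasurable (fun x => (conf x ^ k)⁻¹ * f x) (vol n)) :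
    AEStronglyMeasurable f (vol n) := by
  refine ((aestronglyMeasurable_vol (contDiffOn_conf_pow k).continuousOn).mul h).congr ?_
  filter_upwards [ae_vol_mem_ball] with x hx
  have := (pow_pos (conf_pos hx) k).ne'
  simp only [Pi.mul_apply]
  field_simp

theorem eLpNorm_le_of_add {p : ℝ} (hp : 1 < p) {f g h : E n → ℝ} {δ : ℝ≥0∞}
    (hg : AEStronglyMeasurable g (vol n)) (hh : AEStronglyMeasurable h (vol n))
    (he : ∀ x ∈ ball n, f x = g x - h x)
    (hgδ : eLpNorm g (ENNReal.ofReal p) (vol n) ≤ δ)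
    (hhδ : eLpNorm h (ENNReal.ofReal p) (vol n) ≤ δ) :
    eLpNorm f (ENNReal.ofReal p) (vol n) ≤ 2 * δ := by
  have e : eLpNorm f (ENNReal.ofReal p) (vol n) = eLpNorm (g - h) (ENNReal.ofReal p) (vol n) := by
    refine eLpNorm_congr_ae ?_
    filter_upwards [ae_vol_mem_ball] with x hx using he x hx
  rw [e, two_mul]
  exact (eLpNorm_sub_le hg hh (fact_one_le hp).out).trans (add_le_add hgδ hhδ)

/-- Test functions are dense in `W^{1,p}`. -/
theorem exists_test_approx_grad {p : ℝ} (hp : 1 < p) {u : E n → ℝ} {w : Fin n → E n → ℝ}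
    (hu : MemLp u (ENNReal.ofReal p) (vol n)) (h1 : ∀ i, HasWeakPartial i u (w i))
    (hw : ∀ i, MemLp (fun x => (conf x)⁻¹ * w i x) (ENNReal.ofReal p) (vol n)) {ε : ℝ≥0∞}
    (hε : ε ≠ 0) :
    ∃ φ, IsTest φ ∧ eLpNorm (u - φ) (ENNReal.ofReal p) (vol n) ≤ ε ∧
      eLpNorm (fun x => (conf x)⁻¹ • (WithLp.toLp 2 fun i => w i x : E n) -
        (conf x)⁻¹ • gradient φ x) (ENNReal.ofReal p) (vol n) ≤ ε := by
  -- Each function has two errors, from the cutoff and from the mollification; there are `n`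
  -- components of the gradient. The extra `1` also covers `u` itself.
  obtain ⟨δ, hδ, hδε⟩ := exists_natCast_mul_le (2 * (n + 1)) hε
  have hδ0 : 0 < δ := pos_iff_ne_zero.mpr hδ
  have hwm : ∀ i, AEStronglyMeasurable (w i) (vol n) := fun i =>
    aestronglyMeasurable_of_conf_mul (k := 1) (by simpa using (hw i).1)
  have mc : ∀ {χ : E n → ℝ}, IsTest χ → AEStronglyMeasurable χ (vol n) := fun hχ =>
    hχ.continuous.aestronglyMeasurable
  have mi : AEStronglyMeasurable (fun x : E n => (conf x)⁻¹) (vol n) :=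
    aestronglyMeasurable_vol contDiffOn_conf_inv.continuousOn
  -- The cutoff error is `∇u - ∇(χu) = (1 - χ) ∇u - u ∇χ`.
  have hcut : ∀ i, Filter.Tendsto (fun R => eLpNorm (fun x => (1 - cutoff R x) *
      ((conf x)⁻¹ * w i x) + -(((conf x)⁻¹ * pd i (cutoff R) x) * u x)) (ENNReal.ofReal p) (vol n))
      Filter.atTop (nhds 0) := fun i => by
    refine tendsto_eLpNorm_add_zero hp
      (fun R => ((aestronglyMeasurable_const.sub (mc (isTest_cutoff R))).mul (hw i).1))
      (fun R => ((mi.mul (mc ((isTest_cutoff R).pd i))).mul hu.1).neg)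
      (tendsto_cutoff_sub hp (hw i)) ?_
    refine (tendsto_pd_cutoff_mul hp i hu).congr fun R => ?_
    exact (eLpNorm_neg _ _ _).symm
  obtain ⟨R, hR0, hR1⟩ := ((ENNReal.tendsto_nhds_zero.mp (tendsto_cutoff_sub hp hu) δ hδ0).and
    (Filter.eventually_all.mpr fun i => ENNReal.tendsto_nhds_zero.mp (hcut i) δ hδ0)).exists
  set χ : E n → ℝ := cutoff R
  have hχ : IsTest χ := isTest_cutoff R
  set W : Fin n → E n → ℝ := fun i x => χ x * w i x + pd i χ x * u x with hW
  obtain ⟨r, hr1, -, hr⟩ := hχ.exists_radius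
  have hri : ∀ i x, r < ‖x‖ → pd i χ x = 0 := fun i x hx => by
    have : χ =ᶠ[nhds x] fun _ => 0 := by
      filter_upwards [(isOpen_lt continuous_const continuous_norm).mem_nhds hx] with y hy
        using hr y hy
    rw [pd_congr i this, pd_const]
  have Lu : MemLp (fun x => χ x * u x) (ENNReal.ofReal p) volume :=
    hχ.memLp_mul 0 (by simpa using hu)
  have LW : ∀ i, MemLp (W i) (ENNReal.ofReal p) volume := fun i =>
    (hχ.memLp_mul 1 (by simpa using hw i)).add ((hχ.pd i).memLp_mul 0 (by simpa using hu))
  have hLu := locallyIntegrable_of_memLp hp Lu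
  have zu : ∀ x, r < ‖x‖ → χ x * u x = 0 := fun x hx => by rw [hr x hx, zero_mul]
  have zW : ∀ i x, r < ‖x‖ → W i x = 0 := fun i x hx => by simp [hW, hr x hx, hri i x hx]
  obtain ⟨k, hk, hk0, hk1⟩ := ((eventually_isTest_mollify hr1 hLu zu).and
    ((ENNReal.tendsto_nhds_zero.mp (tendsto_mollify_vol hp hr1 (b := fun _ => 1)
      continuousOn_const Lu zu) δ hδ0).and (Filter.eventually_all.mpr fun i =>
      ENNReal.tendsto_nhds_zero.mp (tendsto_mollify_vol hp hr1
        contDiffOn_conf_inv.continuousOn (LW i) (zW i)) δ hδ0))).exists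
  have hpd : ∀ i, pd i (mollify k fun x => χ x * u x) = mollify k (W i) := fun i =>
    pd_mollify i k hLu ((h1 i).cutoff hχ)
  have mW : ∀ i, AEStronglyMeasurable (W i) (vol n) := fun i =>
    ((mc hχ).mul (hwm i)).add ((mc (hχ.pd i)).mul hu.1)
  have mM : ∀ i, AEStronglyMeasurable (mollify k (W i)) (vol n) := fun i =>
    (contDiff_mollify k (locallyIntegrable_of_memLp hp (LW i))).continuous.aestronglyMeasurable
  refine ⟨mollify k fun x => χ x * u x, hk, ?_, ?_⟩
  · refine (eLpNorm_le_of_add hp ?_ ?_ (fun x _ => ?_) hR0 hk0).trans (le_trans ?_ hδε)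
    · exact (aestronglyMeasurable_const.sub (mc hχ)).mul hu.1
    · exact aestronglyMeasurable_const.mul ((mc hk).sub ((mc hχ).mul hu.1))
    · simp only [Pi.sub_apply]; ring
    · gcongr; norm_cast; omega
  · have hi : ∀ i, eLpNorm (fun x => ((conf x)⁻¹ • (WithLp.toLp 2 fun i => w i x : E n) -
        (conf x)⁻¹ • gradient (mollify k fun x => χ x * u x) x) i) (ENNReal.ofReal p) (vol n) ≤
        2 * δ := fun i => by
      refine eLpNorm_le_of_add hp ?_ ?_ (fun x _ => ?_) (hR1 i) (hk1 i)
      · exact ((aestronglyMeasurable_const.sub (mc hχ)).mul (hw i).1).add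
          ((mi.mul (mc (hχ.pd i))).mul hu.1).neg
      · exact mi.mul ((mM i).sub (mW i))
      · simp only [PiLp.sub_apply, PiLp.smul_apply, gradient_apply, smul_eq_mul, hpd, hW]
        ring
    refine (eLpNorm_euclidean_le_sum hp fun i => ?_).trans
      ((Finset.sum_le_sum fun i _ => hi i).trans (le_trans ?_ hδε))
    · simp only [PiLp.sub_apply, PiLp.smul_apply, gradient_apply, smul_eq_mul, hpd]
      exact (mi.mul (hwm i)).sub (mi.mul (mM i))
    · rw [Finset.sum_const, Finset.card_univ, Fintype.card_fin, nsmul_eq_mul, ← mul_assoc]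
      gcongr
      norm_cast
      omega

/-- Test functions are dense in `W^{2,p}`, for the norm of the function and its Laplacian. -/
theorem exists_test_approx_laplace {p : ℝ} (hp : 1 < p) {u v : E n → ℝ} {w : Fin n → E n → ℝ}
    {z : Fin n → Fin n → E n → ℝ}
    (hu : MemLp u (ENNReal.ofReal p) (vol n)) (h1 : ∀ i, HasWeakPartial i u (w i))
    (hw : ∀ i, MemLp (fun x => (conf x)⁻¹ * w i x) (ENNReal.ofReal p) (vol n))
    (h2 : ∀ i j, HasWeakPartial i (w j) (z i j))
    (hz : ∀ i j, MemLp (fun x => (conf x ^ 2)⁻¹ * z i j x) (ENNReal.ofReal p) (vol n))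
    (hv : MemLp v (ENNReal.ofReal p) (vol n))
    (hvz : ∀ x ∈ ball n, v x = (conf x ^ 2)⁻¹ *
        (∑ i, z i i x + ((n : ℝ) - 2) * conf x * ∑ i, x i * w i x)) {ε : ℝ≥0∞} (hε : ε ≠ 0) :
    ∃ φ, IsTest φ ∧ eLpNorm (u - φ) (ENNReal.ofReal p) (vol n) ≤ ε ∧
      eLpNorm (v - laplaceBeltrami φ) (ENNReal.ofReal p) (vol n) ≤ ε := by
  obtain ⟨δ, hδ, hδε⟩ := exists_natCast_mul_le 2 hε
  rw [Nat.cast_ofNat] at hδε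
  have hδ0 : 0 < δ := pos_iff_ne_zero.mpr hδ
  have hwm : ∀ i, AEStronglyMeasurable (w i) (vol n) := fun i =>
    aestronglyMeasurable_of_conf_mul (k := 1) (by simpa using (hw i).1)
  have hzm : ∀ i j, AEStronglyMeasurable (z i j) (vol n) := fun i j =>
    aestronglyMeasurable_of_conf_mul (hz i j).1
  have mc : ∀ {χ : E n → ℝ}, IsTest χ → AEStronglyMeasurable χ (vol n) := fun hχ =>
    hχ.continuous.aestronglyMeasurable
  have mi : AEStronglyMeasurable (fun x : E n => (conf x)⁻¹) (vol n) :=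
    aestronglyMeasurable_vol contDiffOn_conf_inv.continuousOn
  -- The cutoff error is `Δu - Δ(χu) = (1 - χ) Δu - u Δχ - 2 ⟨∇χ, ∇u⟩_g`.
  have hcut : Filter.Tendsto (fun R => eLpNorm (fun x => ((1 - cutoff R x) * v x +
      -(laplaceBeltrami (cutoff R) x * u x)) + ∑ i, (-2) * (((conf x)⁻¹ * pd i (cutoff R) x) *
        ((conf x)⁻¹ * w i x))) (ENNReal.ofReal p) (vol n)) Filter.atTop (nhds 0) := by
    have m1 : ∀ R : ℕ, AEStronglyMeasurable (fun x => (1 - cutoff R x) * v x) (vol n) := fun R =>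
      (aestronglyMeasurable_const.sub (mc (isTest_cutoff R))).mul hv.1
    have m2 : ∀ R : ℕ, AEStronglyMeasurable (fun x => -(laplaceBeltrami (cutoff R) x * u x))
      (vol n) := fun R => ((mc (isTest_cutoff R).laplaceBeltrami).mul hu.1).neg
    have m3 : ∀ (i : Fin n) (R : ℕ), AEStronglyMeasurable (fun x => (-2) *
        (((conf x)⁻¹ * pd i (cutoff R) x) * ((conf x)⁻¹ * w i x))) (vol n) := fun i R =>
      aestronglyMeasurable_const.mul ((mi.mul (mc ((isTest_cutoff R).pd i))).mul (hw i).1)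
    refine tendsto_eLpNorm_add_zero hp (fun R => (m1 R).add (m2 R))
      (fun R => Finset.aestronglyMeasurable_fun_sum _ fun i _ => m3 i R)
      (tendsto_eLpNorm_add_zero hp m1 m2 (tendsto_cutoff_sub hp hv) ?_)
      (tendsto_eLpNorm_sum_zero hp (fun i _ => m3 i) fun i _ => ?_)
    · refine (tendsto_laplace_cutoff_mul hp hu).congr fun R => ?_
      exact (eLpNorm_neg _ _ _).symm
    · have := ENNReal.Tendsto.const_mul (a := ‖(-2 : ℝ)‖ₑ) (tendsto_pd_cutoff_mul hp i (hw i))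
        (Or.inr (by simp))
      rw [mul_zero] at this
      refine this.congr fun R => ?_
      exact (eLpNorm_const_smul (-2 : ℝ) _ _ _).symm
  obtain ⟨R, hR0, hR1⟩ := ((ENNReal.tendsto_nhds_zero.mp (tendsto_cutoff_sub hp hu) δ hδ0).and
    (ENNReal.tendsto_nhds_zero.mp hcut δ hδ0)).exists
  set χ : E n → ℝ := cutoff R
  have hχ : IsTest χ := isTest_cutoff R
  set W : Fin n → E n → ℝ := fun i x => χ x * w i x + pd i χ x * u x with hW
  set Z : Fin n → E n → ℝ := fun i x => (χ x * z i i x + pd i χ x * w i x) +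
    (pd i χ x * w i x + pd i (pd i χ) x * u x) with hZ
  obtain ⟨r, hr1, -, hr⟩ := hχ.exists_radius
  have hri : ∀ {g : E n → ℝ}, (∀ x, r < ‖x‖ → g x = 0) → ∀ i x, r < ‖x‖ → pd i g x = 0 := by
    intro g hg i x hx
    have : g =ᶠ[nhds x] fun _ => 0 := by
      filter_upwards [(isOpen_lt continuous_const continuous_norm).mem_nhds hx] with y hy
        using hg y hy
    rw [pd_congr i this, pd_const]
  have L0 : ∀ {g : E n → ℝ}, IsTest g → MemLp (fun x => g x * u x) (ENNReal.ofReal p) volume :=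
    fun hg => hg.memLp_mul 0 (by simpa using hu)
  have L1 : ∀ {g : E n → ℝ}, IsTest g → ∀ i,
      MemLp (fun x => g x * w i x) (ENNReal.ofReal p) volume :=
    fun hg i => hg.memLp_mul 1 (by simpa using hw i)
  have L2 : ∀ i, MemLp (fun x => χ x * z i i x) (ENNReal.ofReal p) volume :=
    fun i => hχ.memLp_mul 2 (hz i i)
  have LW : ∀ i, MemLp (W i) (ENNReal.ofReal p) volume := fun i => (L1 hχ i).add (L0 (hχ.pd i))
  have LZ : ∀ i, MemLp (Z i) (ENNReal.ofReal p) volume := fun i =>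
    ((L2 i).add (L1 (hχ.pd i) i)).add ((L1 (hχ.pd i) i).add (L0 ((hχ.pd i).pd i)))
  have hLu := locallyIntegrable_of_memLp hp (L0 hχ)
  have zu : ∀ x, r < ‖x‖ → χ x * u x = 0 := fun x hx => by rw [hr x hx, zero_mul]
  have zW : ∀ i x, r < ‖x‖ → W i x = 0 := fun i x hx => by
    simp [hW, hr x hx, hri hr i x hx]
  have zZ : ∀ i x, r < ‖x‖ → Z i x = 0 := fun i x hx => by
    simp [hZ, hr x hx, hri hr i x hx, hri (hri hr i) i x hx]
  have mW : ∀ i, AEStronglyMeasurable (W i) (vol n) := fun i =>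
    ((mc hχ).mul (hwm i)).add ((mc (hχ.pd i)).mul hu.1)
  have mZ : ∀ i, AEStronglyMeasurable (Z i) (vol n) := fun i =>
    (((mc hχ).mul (hzm i i)).add ((mc (hχ.pd i)).mul (hwm i))).add
      (((mc (hχ.pd i)).mul (hwm i)).add ((mc ((hχ.pd i).pd i)).mul hu.1))
  have mMW : ∀ i k, AEStronglyMeasurable (mollify k (W i)) (vol n) := fun i k =>
    (contDiff_mollify k (locallyIntegrable_of_memLp hp (LW i))).continuous.aestronglyMeasurable
  have mMZ : ∀ i k, AEStronglyMeasurable (mollify k (Z i)) (vol n) := fun i k =>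
    (contDiff_mollify k (locallyIntegrable_of_memLp hp (LZ i))).continuous.aestronglyMeasurable
  set a : E n → ℝ := fun x => (conf x ^ 2)⁻¹ with ha
  set b : Fin n → E n → ℝ := fun i x => (conf x)⁻¹ * (((n : ℝ) - 2) * x i) with hb
  have ca : ContinuousOn a (ball n) := (contDiffOn_conf_pow_inv 2).continuousOn
  have cb : ∀ i, ContinuousOn (b i) (ball n) := fun i => contDiffOn_conf_inv.continuousOn.mul
    (continuousOn_const.mul (contDiffOn_coord i _).continuousOn)
  have m1 : ∀ i k, AEStronglyMeasurable (fun x => a x * (mollify k (Z i) x - Z i x)) (vol n) :=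
    fun i k => (aestronglyMeasurable_vol ca).mul ((mMZ i k).sub (mZ i))
  have m2 : ∀ i k, AEStronglyMeasurable (fun x => b i x * (mollify k (W i) x - W i x)) (vol n) :=
    fun i k => (aestronglyMeasurable_vol (cb i)).mul ((mMW i k).sub (mW i))
  -- In coordinates `Δ_g = ∑ᵢ (a ∂ᵢ² + bᵢ ∂ᵢ)`, and `W`, `Z` are the derivatives `∂ᵢ`, `∂ᵢ²` of the
  -- cut-off function, so this is the mollification error of the Laplacian.
  have hmol : Filter.Tendsto (fun k => eLpNorm (fun x => ∑ i, a x * (mollify k (Z i) x - Z i x) +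
      ∑ i, b i x * (mollify k (W i) x - W i x)) (ENNReal.ofReal p) (vol n))
      Filter.atTop (nhds 0) := by
    refine tendsto_eLpNorm_add_zero hp
      (fun k => Finset.aestronglyMeasurable_fun_sum _ fun i _ => m1 i k)
      (fun k => Finset.aestronglyMeasurable_fun_sum _ fun i _ => m2 i k)
      (tendsto_eLpNorm_sum_zero hp (fun i _ => m1 i) fun i _ => ?_)
      (tendsto_eLpNorm_sum_zero hp (fun i _ => m2 i) fun i _ => ?_)
    · exact tendsto_mollify_vol hp hr1 ca (LZ i) (zZ i)
    · exact tendsto_mollify_vol hp hr1 (cb i) (LW i) (zW i)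
  obtain ⟨k, hk, hk0, hk1⟩ := ((eventually_isTest_mollify hr1 hLu zu).and
    ((ENNReal.tendsto_nhds_zero.mp (tendsto_mollify_vol hp hr1 (b := fun _ => 1)
      continuousOn_const (L0 hχ) zu) δ hδ0).and
      (ENNReal.tendsto_nhds_zero.mp hmol δ hδ0))).exists
  have hpd : ∀ i, pd i (mollify k fun x => χ x * u x) = mollify k (W i) := fun i =>
    pd_mollify i k hLu ((h1 i).cutoff hχ)
  have hpd2 : ∀ i, pd i (mollify k (W i)) = mollify k (Z i) := fun i => by
    refine pd_mollify i k (locallyIntegrable_of_memLp hp (LW i)) ?_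
    exact ((h2 i i).cutoff hχ).add ((h1 i).cutoff (hχ.pd i))
      (locallyIntegrable_of_memLp hp (L1 hχ i))
      (locallyIntegrable_of_memLp hp ((L2 i).add (L1 (hχ.pd i) i)))
      (locallyIntegrable_of_memLp hp (L0 (hχ.pd i)))
      (locallyIntegrable_of_memLp hp ((L1 (hχ.pd i) i).add (L0 ((hχ.pd i).pd i))))
  refine ⟨mollify k fun x => χ x * u x, hk, ?_, ?_⟩
  · refine (eLpNorm_le_of_add hp ?_ ?_ (fun x _ => ?_) hR0 hk0).trans hδε
    · exact (aestronglyMeasurable_const.sub (mc hχ)).mul hu.1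
    · exact aestronglyMeasurable_const.mul ((mc hk).sub ((mc hχ).mul hu.1))
    · simp only [Pi.sub_apply]; ring
  · refine (eLpNorm_le_of_add hp ?_ ?_ (fun x hx => ?_) hR1 hk1).trans hδε
    · exact (((aestronglyMeasurable_const.sub (mc hχ)).mul hv.1).add
        ((mc hχ.laplaceBeltrami).mul hu.1).neg).add
        (Finset.aestronglyMeasurable_fun_sum _ fun i _ => aestronglyMeasurable_const.mul
          ((mi.mul (mc (hχ.pd i))).mul (hw i).1))
    · exact (Finset.aestronglyMeasurable_fun_sum _ fun i _ => m1 i k).add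
        (Finset.aestronglyMeasurable_fun_sum _ fun i _ => m2 i k)
    · have hc := (conf_pos hx).ne'
      rw [Pi.sub_apply, laplaceBeltrami_eq hx fun i => (hk.pd i).differentiable x,
        laplaceBeltrami_eq hx fun i => (hχ.pd i).differentiable x, hvz x hx]
      simp only [hpd, hpd2]
      have e1 : ∑ i, a x * (mollify k (Z i) x - Z i x) =
          (conf x ^ 2)⁻¹ * (∑ i, mollify k (Z i) x - ∑ i, Z i x) := by
        rw [← Finset.mul_sum, Finset.sum_sub_distrib]
      have e2 : ∑ i, b i x * (mollify k (W i) x - W i x) =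
          (conf x)⁻¹ * ((n : ℝ) - 2) * (∑ i, x i * mollify k (W i) x - ∑ i, x i * W i x) := by
        rw [← Finset.sum_sub_distrib, Finset.mul_sum]
        exact Finset.sum_congr rfl fun i _ => by simp only [hb]; ring
      have e3 : ∑ i, Z i x = χ x * ∑ i, z i i x + 2 * ∑ i, pd i χ x * w i x +
          u x * ∑ i, pd i (pd i χ) x := by
        simp only [Finset.mul_sum, ← Finset.sum_add_distrib]
        exact Finset.sum_congr rfl fun i _ => by simp only [hZ]; ring
      have e4 : ∑ i, x i * W i x = χ x * ∑ i, x i * w i x + u x * ∑ i, x i * pd i χ x := by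
        simp only [Finset.mul_sum, ← Finset.sum_add_distrib]
        exact Finset.sum_congr rfl fun i _ => by simp only [hW]; ring
      have e5 : ∑ i, (-2) * (((conf x)⁻¹ * pd i χ x) * ((conf x)⁻¹ * w i x)) =
          -2 * (conf x ^ 2)⁻¹ * ∑ i, pd i χ x * w i x := by
        rw [Finset.mul_sum]
        exact Finset.sum_congr rfl fun i _ => by field_simp
      rw [e1, e2, e3, e4, e5]
      field_simp
      ring

/-! ### From test functions to Sobolev functions -/

/-- Hölder with exponents `p / (p - 1)` and `p` on the right side. The weight stays inside the norm
on the left, so that every term is continuous under `L^p` convergence. -/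
theorem eLpNorm_weight_le {p a b C : ℝ} (hp : 1 < p) (ha : 0 < a) (hb : 0 < b) (hC : 0 ≤ C)
    {φ ψ : E n → ℝ} (hφ : IsTest φ) (hψ : IsTestOf 0 ψ) (h0 : ∀ x, 0 ≤ ψ x)
    (h : ∫ x, (a + b * sechSq x) * |φ x| ^ p ∂(vol n) ≤
      ∫ x, C * (|φ x| ^ (p - 1) * ψ x) ∂(vol n)) :
    eLpNorm (fun x => (a + b * sechSq x) ^ (1 / p) * φ x) (ENNReal.ofReal p) (vol n) ^ p ≤
      ENNReal.ofReal C * eLpNorm φ (ENNReal.ofReal p) (vol n) ^ (p - 1) *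
        eLpNorm ψ (ENNReal.ofReal p) (vol n) := by
  have hp0 : 0 < p := by linarith
  have hw : ∀ x : E n, 0 ≤ a + b * sechSq x := fun x => by
    have := sechSq_nonneg x; positivity
  have i1 : IsTestOf 0 (fun x => (a + b * sechSq x) * |φ x| ^ p) := by
    refine (hφ.isTestOf 0).of_contDiffOn (contDiffOn_zero.mpr ?_) fun x hx => by
      simp [hx, Real.zero_rpow hp0.ne']
    exact ((continuous_const.add (continuous_const.mul continuous_sechSq)).mul
      (hφ.continuous.abs.rpow_const fun x => Or.inr hp0.le)).continuousOn
  have i2 : IsTestOf 0 (fun x => C * (|φ x| ^ (p - 1) * ψ x)) := by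
    refine hψ.of_contDiffOn (contDiffOn_zero.mpr ?_) fun x hx => by simp [hx]
    exact (continuous_const.mul ((hφ.continuous.abs.rpow_const fun x => Or.inr (by linarith)).mul
      hψ.1.continuous)).continuousOn
  have e1 : eLpNorm (fun x => (a + b * sechSq x) ^ (1 / p) * φ x) (ENNReal.ofReal p) (vol n) ^ p =
      ENNReal.ofReal (∫ x, (a + b * sechSq x) * |φ x| ^ p ∂(vol n)) := by
    rw [eLpNorm_rpow hp, ofReal_integral_eq_lintegral_ofReal i1.integrable_vol
      (ae_of_all _ fun x => mul_nonneg (hw x) (by positivity))]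
    refine lintegral_congr fun x => ?_
    rw [← ofReal_norm, ENNReal.ofReal_rpow_of_nonneg (norm_nonneg _) hp0.le, norm_mul,
      Real.mul_rpow (norm_nonneg _) (norm_nonneg _), Real.norm_of_nonneg (Real.rpow_nonneg (hw x) _),
      ← Real.rpow_mul (hw x), one_div_mul_cancel hp0.ne', Real.rpow_one, Real.norm_eq_abs]
  have e2 : ENNReal.ofReal (∫ x, C * (|φ x| ^ (p - 1) * ψ x) ∂(vol n)) =
      ENNReal.ofReal C * ∫⁻ x, ‖φ x‖ₑ ^ (p - 1) * ‖ψ x‖ₑ ∂(vol n) := by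
    rw [ofReal_integral_eq_lintegral_ofReal i2.integrable_vol (ae_of_all _ fun x =>
      mul_nonneg hC (mul_nonneg (by positivity) (h0 x))),
      ← lintegral_const_mul' _ _ ENNReal.ofReal_ne_top]
    refine lintegral_congr fun x => ?_
    rw [ENNReal.ofReal_mul hC, ENNReal.ofReal_mul (by positivity), ← ofReal_norm,
      ← ofReal_norm, ENNReal.ofReal_rpow_of_nonneg (norm_nonneg _) (by linarith),
      Real.norm_eq_abs, Real.norm_of_nonneg (h0 x)]
  have hconj : (p / (p - 1)).HolderConjugate p := (Real.HolderConjugate.conjExponent hp).symm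
  rw [e1, mul_assoc]
  refine (ENNReal.ofReal_le_ofReal h).trans (e2.trans_le (mul_le_mul_right ?_ _))
  refine (ENNReal.lintegral_mul_le_Lp_mul_Lq (vol n) hconj
    (hφ.continuous.enorm.measurable.pow_const _).aemeasurable
    hψ.1.continuous.enorm.measurable.aemeasurable).trans_eq ?_
  congr 1
  · rw [eLpNorm_ofReal hp, ← ENNReal.rpow_mul]
    congr 1
    · refine lintegral_congr fun x => ?_
      rw [← ENNReal.rpow_mul]
      congr 1
      field_simp [(by linarith : p - 1 ≠ 0)]
    · field_simp
  · rw [eLpNorm_ofReal hp]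

theorem weight_bounds {p a b : ℝ} (hp : 1 < p) (ha : 0 < a) (hb : 0 < b) (x : E n) :
    0 ≤ (a + b * sechSq x) ^ (1 / p) ∧ (a + b * sechSq x) ^ (1 / p) ≤ (a + b) ^ (1 / p) := by
  have hp0 : 0 < p := by linarith
  have h0 : 0 ≤ a + b * sechSq x := by
    have := sechSq_nonneg x
    positivity
  refine ⟨Real.rpow_nonneg h0 _, Real.rpow_le_rpow h0 ?_ (one_div_pos.mpr hp0).le⟩
  nlinarith [sechSq_le_one x]

theorem continuous_weight {p a b : ℝ} (ha : 0 < a) (hb : 0 < b) :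
    Continuous fun x : E n => (a + b * sechSq x) ^ (1 / p) :=
  (continuous_const.add (continuous_const.mul continuous_sechSq)).rpow_const fun x =>
    Or.inl (add_pos_of_pos_of_nonneg ha (mul_nonneg hb.le (sechSq_nonneg x))).ne'

/-- The weight is at most `a + b`, so an approximation error `ε` costs at most a fixed multiple of
`ε` on the left. Passing to the limit in the weighted inequality, rather than in a strict one,
preserves the gain from `sech²`. -/
theorem eLpNorm_weight_le_of_approx {F : Type*} [NormedAddCommGroup F] {p a b C : ℝ} (hp : 1 < p)
    (ha : 0 < a) (hb : 0 < b) {u : E n → ℝ} {w : E n → F}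
    (hu : MemLp u (ENNReal.ofReal p) (vol n)) (hw : MemLp w (ENNReal.ofReal p) (vol n))
    (happ : ∀ ε : ℝ≥0∞, ε ≠ 0 → ∃ (φ : E n → ℝ) (ψ : E n → F), Continuous φ ∧
      AEStronglyMeasurable ψ (vol n) ∧
      eLpNorm (u - φ) (ENNReal.ofReal p) (vol n) ≤ ε ∧
      eLpNorm (w - ψ) (ENNReal.ofReal p) (vol n) ≤ ε ∧
      eLpNorm (fun x => (a + b * sechSq x) ^ (1 / p) * φ x) (ENNReal.ofReal p) (vol n) ^ p ≤
        ENNReal.ofReal C * eLpNorm φ (ENNReal.ofReal p) (vol n) ^ (p - 1) *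
        eLpNorm ψ (ENNReal.ofReal p) (vol n)) :
    eLpNorm (fun x => (a + b * sechSq x) ^ (1 / p) * u x) (ENNReal.ofReal p) (vol n) ^ p ≤
      ENNReal.ofReal C * eLpNorm u (ENNReal.ofReal p) (vol n) ^ (p - 1) *
        eLpNorm w (ENNReal.ofReal p) (vol n) := by
  have hp0 : 0 < p := by linarith
  have h1p : 1 ≤ ENNReal.ofReal p := (fact_one_le hp).out
  set K : ℝ≥0∞ := ENNReal.ofReal ((a + b) ^ (1 / p)) with hK
  set N := eLpNorm u (ENNReal.ofReal p) (vol n) with hN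
  set M := eLpNorm w (ENNReal.ofReal p) (vol n) with hM
  have hNt : N ≠ ⊤ := hu.2.ne
  have hMt : M ≠ ⊤ := hw.2.ne
  have key : ∀ ε : ℝ≥0∞, ε ≠ 0 →
      eLpNorm (fun x => (a + b * sechSq x) ^ (1 / p) * u x) (ENNReal.ofReal p) (vol n) ≤
      K * ε + (ENNReal.ofReal C * (N + ε) ^ (p - 1) * (M + ε)) ^ (1 / p) := by
    intro ε hε
    obtain ⟨φ, ψ, hφ, hψ, h1, h2, h3⟩ := happ ε hε
    have hφm : AEStronglyMeasurable φ (vol n) := hφ.aestronglyMeasurable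
    have a1 : eLpNorm φ (ENNReal.ofReal p) (vol n) ≤ N + ε := by
      have := eLpNorm_sub_le (p := ENNReal.ofReal p) hu.1 (hu.1.sub hφm) h1p
      rw [sub_sub_cancel] at this
      exact this.trans (add_le_add le_rfl h1)
    have a2 : eLpNorm ψ (ENNReal.ofReal p) (vol n) ≤ M + ε := by
      have := eLpNorm_sub_le (p := ENNReal.ofReal p) hw.1 (hw.1.sub hψ) h1p
      rw [sub_sub_cancel] at this
      exact this.trans (add_le_add le_rfl h2)
    have mρ : AEStronglyMeasurable (fun x : E n => (a + b * sechSq x) ^ (1 / p)) (vol n) :=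
      (continuous_weight ha hb).aestronglyMeasurable
    have a3 : eLpNorm (fun x => (a + b * sechSq x) ^ (1 / p) * (u x - φ x)) (ENNReal.ofReal p)
        (vol n) ≤ K * ε := by
      refine (eLpNorm_le_mul_eLpNorm_of_ae_le_mul (g := u - φ) (c := (a + b) ^ (1 / p))
        (ae_of_all _ fun x => ?_) _).trans (mul_le_mul_right h1 _)
      rw [norm_mul, Pi.sub_apply, Real.norm_of_nonneg (weight_bounds hp ha hb x).1]
      exact mul_le_mul_of_nonneg_right (weight_bounds hp ha hb x).2 (norm_nonneg _)
    have a4 := eLpNorm_add_le (p := ENNReal.ofReal p) (mρ.mul (hu.1.sub hφm)) (mρ.mul hφm) h1p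
    refine ((eLpNorm_congr_ae (ae_of_all _ fun x => ?_)).trans_le a4).trans (add_le_add a3 ?_)
    · simp only [Pi.add_apply, Pi.mul_apply, Pi.sub_apply]; ring
    · rw [← ENNReal.rpow_le_rpow_iff hp0, ← ENNReal.rpow_mul, one_div_mul_cancel hp0.ne',
        ENNReal.rpow_one]
      refine h3.trans ?_
      gcongr
  have hlim : Filter.Tendsto (fun ε : ℝ≥0∞ => K * ε +
      (ENNReal.ofReal C * (N + ε) ^ (p - 1) * (M + ε)) ^ (1 / p)) (nhdsWithin 0 (Ioi 0))
      (nhds (K * 0 + (ENNReal.ofReal C * (N + 0) ^ (p - 1) * (M + 0)) ^ (1 / p))) := by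
    have hid : Filter.Tendsto (fun ε : ℝ≥0∞ => ε) (nhdsWithin 0 (Ioi 0)) (nhds 0) :=
      Filter.tendsto_id.mono_left nhdsWithin_le_nhds
    have t1 : ((N + 0) ^ (p - 1)) ≠ ⊤ := ENNReal.rpow_ne_top_of_nonneg (by linarith) (by simpa)
    refine (ENNReal.Tendsto.const_mul hid (Or.inr ENNReal.ofReal_ne_top)).add ?_
    refine (ENNReal.continuous_rpow_const.tendsto _).comp ?_
    refine ENNReal.Tendsto.mul (ENNReal.Tendsto.const_mul ?_ (Or.inr ENNReal.ofReal_ne_top))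
      (Or.inr (by simpa)) (tendsto_const_nhds.add hid)
      (Or.inr (ENNReal.mul_ne_top ENNReal.ofReal_ne_top t1))
    exact (ENNReal.continuous_rpow_const.tendsto _).comp (tendsto_const_nhds.add hid)
  have := ge_of_tendsto hlim (eventually_nhdsWithin_of_forall fun ε hε => key ε (ne_of_gt hε))
  simp only [mul_zero, zero_add, add_zero] at this
  rwa [← ENNReal.rpow_le_rpow_iff hp0, ← ENNReal.rpow_mul (y := 1 / p), one_div_mul_cancel hp0.ne',
        ENNReal.rpow_one] at this

theorem eLpNorm_weight_eq {p a b : ℝ} (hp : 1 < p) (ha : 0 < a) (hb : 0 < b) {u : E n → ℝ}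
    (hu : MemLp u (ENNReal.ofReal p) (vol n)) :
    eLpNorm (fun x => (a + b * sechSq x) ^ (1 / p) * u x) (ENNReal.ofReal p) (vol n) ^ p =
      ENNReal.ofReal a * eLpNorm u (ENNReal.ofReal p) (vol n) ^ p +
        ∫⁻ x, ENNReal.ofReal (b * sechSq x) * ‖u x‖ₑ ^ p ∂(vol n) := by
  have hp0 : 0 < p := by linarith
  rw [eLpNorm_rpow hp, eLpNorm_rpow hp, ← lintegral_const_mul' _ _ ENNReal.ofReal_ne_top,
    ← lintegral_add_left' ((hu.1.enorm.pow_const p).const_mul _)]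
  refine lintegral_congr fun x => ?_
  have := sechSq_nonneg x
  rw [enorm_mul, ENNReal.mul_rpow_of_nonneg _ _ hp0.le, ← add_mul, ← ENNReal.ofReal_add ha.le
    (by positivity), ← ofReal_norm, Real.norm_of_nonneg (by positivity),
    ENNReal.ofReal_rpow_of_nonneg (by positivity) hp0.le, ← Real.rpow_mul (by positivity),
    one_div_mul_cancel hp0.ne', Real.rpow_one]

/-- The left side exceeds `a ‖u‖_p^p` by `∫ b sech² r |u|^p`, which is positive for nonzero `u`. It
remains to divide by `‖u‖_p^(p-1)`, which is finite and nonzero. -/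
theorem lt_of_weight_le {F : Type*} [NormedAddCommGroup F] {p a b C : ℝ} (hp : 1 < p)
    (ha : 0 < a) (hb : 0 < b) {u : E n → ℝ} {w : E n → F}
    (hu : MemLp u (ENNReal.ofReal p) (vol n)) (hu0 : ¬ u =ᵐ[vol n] 0)
    (h : eLpNorm (fun x => (a + b * sechSq x) ^ (1 / p) * u x) (ENNReal.ofReal p) (vol n) ^ p ≤
      ENNReal.ofReal C * eLpNorm u (ENNReal.ofReal p) (vol n) ^ (p - 1) *
        eLpNorm w (ENNReal.ofReal p) (vol n)) :
    eLpNorm u (ENNReal.ofReal p) (vol n) <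
      ENNReal.ofReal (C / a) * eLpNorm w (ENNReal.ofReal p) (vol n) := by
  have hp0 : 0 < p := by linarith
  rw [eLpNorm_weight_eq hp ha hb hu] at h
  set N := eLpNorm u (ENNReal.ofReal p) (vol n) with hN
  set M := eLpNorm w (ENNReal.ofReal p) (vol n) with hM
  have hNt : N ≠ ⊤ := hu.2.ne
  have hN0 : N ≠ 0 := fun h => hu0 ((eLpNorm_eq_zero_iff hu.1 (by simpa using hp0)).mp h)
  have hpos : ∫⁻ x, ENNReal.ofReal (b * sechSq x) * ‖u x‖ₑ ^ p ∂(vol n) ≠ 0 := by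
    intro h0
    have hm : AEMeasurable (fun x => ENNReal.ofReal (b * sechSq x) * ‖u x‖ₑ ^ p) (vol n) :=
      (continuous_const.mul continuous_sechSq).measurable.ennreal_ofReal.aemeasurable.mul
        (hu.1.enorm.pow_const p)
    rw [lintegral_eq_zero_iff' hm] at h0
    refine hu0 ?_
    filter_upwards [h0, ae_vol_mem_ball] with x hx hxb
    have h2 : 0 < b * sechSq x := mul_pos hb (sechSq_pos hxb)
    simpa [h2, hp0, hp0.not_gt, h2.not_ge] using hx
  have hNp : N ^ p = N ^ (p - 1) * N := by
    conv_rhs => rw [← ENNReal.rpow_one N, ← ENNReal.rpow_mul, one_mul,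
      ← ENNReal.rpow_add _ _ hN0 hNt]
    simp
  have h1 : N ^ (p - 1) ≠ 0 := by simp [hN0, hNt]
  have h2 : N ^ (p - 1) ≠ ⊤ := ENNReal.rpow_ne_top_of_nonneg (by linarith) hNt
  have h3 : N ^ (p - 1) * (ENNReal.ofReal a * N) < N ^ (p - 1) * (ENNReal.ofReal C * M) := by
    have h4 : ENNReal.ofReal a * N ^ p ≠ ⊤ :=
      ENNReal.mul_ne_top ENNReal.ofReal_ne_top (ENNReal.rpow_ne_top_of_nonneg hp0.le hNt)
    calc N ^ (p - 1) * (ENNReal.ofReal a * N) = ENNReal.ofReal a * N ^ p := by rw [hNp]; ring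
      _ < _ := ENNReal.lt_add_right h4 hpos
      _ ≤ _ := h
      _ = _ := by ring
  have h5 := lt_of_mul_lt_mul_left' h3
  have ha0 : ENNReal.ofReal a ≠ 0 := by simpa using ha
  rw [ENNReal.ofReal_div_of_pos ha, ← ENNReal.mul_lt_mul_iff_right ha0 ENNReal.ofReal_ne_top]
  refine h5.trans_eq ?_
  rw [← mul_assoc, ENNReal.mul_div_cancel ha0 ENNReal.ofReal_ne_top]

/-- The sharp first order inequality is strict. -/
theorem eLpNorm_lt_grad {p : ℝ} (hp : 1 < p) (hn : 2 ≤ n) {u : E n → ℝ} {w : Fin n → E n → ℝ}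
    (hu : MemLp u (ENNReal.ofReal p) (vol n)) (h1 : ∀ i, HasWeakPartial i u (w i))
    (hw : ∀ i, MemLp (fun x => (conf x)⁻¹ * w i x) (ENNReal.ofReal p) (vol n))
    (hu0 : ¬ u =ᵐ[vol n] 0) :
    eLpNorm u (ENNReal.ofReal p) (vol n) < ENNReal.ofReal (p / ((n : ℝ) - 1)) *
      eLpNorm (fun x => (conf x)⁻¹ • (WithLp.toLp 2 fun i => w i x : E n))
        (ENNReal.ofReal p) (vol n) := by
  have hnR : (2 : ℝ) ≤ n := by exact_mod_cast hn
  have := fact_one_le hp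
  have hwv : MemLp (fun x => (conf x)⁻¹ • (WithLp.toLp 2 fun i => w i x : E n))
      (ENNReal.ofReal p) (vol n) := by rw [memLp_piLp_iff]; exact hw
  refine lt_of_weight_le (a := (n : ℝ) - 1) (b := 1) hp (by linarith) one_pos hu hu0 ?_
  refine eLpNorm_weight_le_of_approx hp (by linarith) one_pos hu hwv fun ε hε => ?_
  obtain ⟨φ, hφ, h2, h3⟩ := exists_test_approx_grad hp hu h1 hw hε
  refine ⟨φ, _, hφ.continuous, ?_, h2, h3, ?_⟩
  · exact (aestronglyMeasurable_vol contDiffOn_conf_inv.continuousOn).smul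
      hφ.continuous_gradient.aestronglyMeasurable
  · rw [← eLpNorm_norm (fun x => (conf x)⁻¹ • gradient φ x)]
    refine eLpNorm_weight_le hp (by linarith) one_pos (by linarith) hφ hφ.norm_grad
      (fun x => norm_nonneg _) ?_
    simpa only [one_mul] using integral_grad_bound hp hφ

/-- The sharp second order inequality is strict. -/
theorem eLpNorm_lt_laplace {p : ℝ} (hp : 1 < p) (hn : 2 ≤ n) {u v : E n → ℝ} {w : Fin n → E n → ℝ}
    {z : Fin n → Fin n → E n → ℝ}
    (hu : MemLp u (ENNReal.ofReal p) (vol n)) (h1 : ∀ i, HasWeakPartial i u (w i))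
    (hw : ∀ i, MemLp (fun x => (conf x)⁻¹ * w i x) (ENNReal.ofReal p) (vol n))
    (h2 : ∀ i j, HasWeakPartial i (w j) (z i j))
    (hz : ∀ i j, MemLp (fun x => (conf x ^ 2)⁻¹ * z i j x) (ENNReal.ofReal p) (vol n))
    (hv : MemLp v (ENNReal.ofReal p) (vol n))
    (hvz : ∀ x ∈ ball n, v x = (conf x ^ 2)⁻¹ *
        (∑ i, z i i x + ((n : ℝ) - 2) * conf x * ∑ i, x i * w i x))
    (hu0 : ¬ u =ᵐ[vol n] 0) :
    eLpNorm u (ENNReal.ofReal p) (vol n) <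
      ENNReal.ofReal (p * Real.conjExponent p / ((n : ℝ) - 1) ^ 2) *
        eLpNorm v (ENNReal.ofReal p) (vol n) := by
  have hnR : (2 : ℝ) ≤ n := by exact_mod_cast hn
  have hp1 : 0 < p - 1 := by linarith
  have hn1 : (0 : ℝ) < (n : ℝ) - 1 := by linarith
  have ha : 0 < (p - 1) / p ^ 2 * ((n : ℝ) - 1) ^ 2 := by positivity
  have hb : 0 < (p - 1) / p ^ 2 * ((n : ℝ) ^ 2 - 1) := by
    have : (0 : ℝ) < (n : ℝ) ^ 2 - 1 := by nlinarith
    positivity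
  -- The sharp constant is `1 / a`, with `a` the part of the weight without `sech²`.
  have e : p * Real.conjExponent p / ((n : ℝ) - 1) ^ 2 =
      1 / ((p - 1) / p ^ 2 * ((n : ℝ) - 1) ^ 2) := by
    rw [Real.conjExponent]; field_simp
  rw [e]
  refine lt_of_weight_le hp ha hb hu hu0 ?_
  refine eLpNorm_weight_le_of_approx hp ha hb hu hv fun ε hε => ?_
  obtain ⟨φ, hφ, h3, h4⟩ := exists_test_approx_laplace hp hu h1 hw h2 hz hv hvz hε
  refine ⟨φ, _, hφ.continuous, hφ.laplaceBeltrami.continuous.aestronglyMeasurable, h3, h4, ?_⟩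
  rw [← eLpNorm_norm (laplaceBeltrami φ)]
  refine eLpNorm_weight_le hp ha hb zero_le_one hφ ?_ (fun x => norm_nonneg _) ?_
  · exact (hφ.laplaceBeltrami.isTestOf 0).of_contDiffOn (contDiffOn_zero.mpr
      hφ.laplaceBeltrami.continuous.norm.continuousOn) fun x hx => by simp [hx]
  · have := integral_laplace_bound hp (by omega) hφ
    simpa only [one_mul, Real.norm_eq_abs, mul_add, mul_assoc] using this

/-! ### Iterated Laplacians -/

theorem MemSobolev.exists_laplacian {p : ℝ} (hp : 1 < p) (hn : 2 ≤ n) {m : ℕ} {u : E n → ℝ}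
    (h : MemSobolev (m + 2) p u) :
    ∃ v, HasWeakLaplacian u v ∧ MemSobolev m p v ∧
      (¬ u =ᵐ[vol n] 0 → eLpNorm u (ENNReal.ofReal p) (vol n) <
        ENNReal.ofReal (p * Real.conjExponent p / ((n : ℝ) - 1) ^ 2) *
          eLpNorm v (ENNReal.ofReal p) (vol n)) := by
  obtain ⟨w, z, v, h1, hw, h2, hz, hv, hvz⟩ := h.exists_second_partials hp
  refine ⟨v, ?_, hv, eLpNorm_lt_laplace hp hn (h.memLp hp) h1 hw h2 hz (hv.memLp hp) hvz⟩
  have h3 := hasWeakLaplacian_of_hasWeakPartial h1 (fun i => h2 i i) (h1 ⟨0, by omega⟩).1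
  refine h3.congr_ae Filter.EventuallyEq.rfl ?_
  filter_upwards [ae_restrict_mem isOpen_ball.measurableSet] with x hx
  exact (hvz x hx).symm

/-- A weak Laplacian is unique almost everywhere, so the properties of the traced Hessian hold for
every choice of `v`. -/
theorem MemSobolev.of_laplacian {p : ℝ} (hp : 1 < p) (hn : 2 ≤ n) {m : ℕ} {u v : E n → ℝ}
    (h : MemSobolev (m + 2) p u) (hv : HasWeakLaplacian u v) :
    MemSobolev m p v ∧ (¬ u =ᵐ[vol n] 0 → eLpNorm u (ENNReal.ofReal p) (vol n) <
        ENNReal.ofReal (p * Real.conjExponent p / ((n : ℝ) - 1) ^ 2) *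
          eLpNorm v (ENNReal.ofReal p) (vol n)) := by
  obtain ⟨v', h1, h2, h3⟩ := h.exists_laplacian hp hn
  have h4 := h1.ae_unique hv
  exact ⟨h2.congr_ae h4, by rwa [← eLpNorm_congr_ae (ae_vol_of_ae h4)]⟩

theorem MemSobolev.exists_laplacianPow {p : ℝ} (hp : 1 < p) (hn : 2 ≤ n) (k : ℕ) {m : ℕ}
    {u : E n → ℝ} (h : MemSobolev (m + 2 * k) p u) :
    ∃ v, HasWeakLaplacianPow k u v ∧ MemSobolev m p v := by
  induction k generalizing u with
  | zero => exact ⟨u, rfl, h⟩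
  | succ k ih =>
    obtain ⟨v, h1, h2, -⟩ := MemSobolev.exists_laplacian (m := m + 2 * k) hp hn h
    obtain ⟨v', h3, h4⟩ := ih h2
    exact ⟨v', ⟨v, h1, h3⟩, h4⟩

theorem MemSobolev.of_laplacianPow {p : ℝ} (hp : 1 < p) (hn : 2 ≤ n) (k : ℕ) {m : ℕ}
    {u v : E n → ℝ} (h : MemSobolev (m + 2 * k) p u) (hv : HasWeakLaplacianPow k u v) :
    MemSobolev m p v ∧ eLpNorm u (ENNReal.ofReal p) (vol n) ≤
        ENNReal.ofReal ((p * Real.conjExponent p / ((n : ℝ) - 1) ^ 2) ^ k) *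
          eLpNorm v (ENNReal.ofReal p) (vol n) ∧
      (k ≠ 0 → ¬ u =ᵐ[vol n] 0 → eLpNorm u (ENNReal.ofReal p) (vol n) <
        ENNReal.ofReal ((p * Real.conjExponent p / ((n : ℝ) - 1) ^ 2) ^ k) *
          eLpNorm v (ENNReal.ofReal p) (vol n)) := by
  have hc : 0 ≤ p * Real.conjExponent p / ((n : ℝ) - 1) ^ 2 := by
    have := (Real.HolderConjugate.conjExponent hp).symm.pos
    positivity
  induction k generalizing u with
  | zero =>
    obtain rfl : v = u := hv
    exact ⟨h, by simp, fun h => absurd rfl h⟩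
  | succ k ih =>
    obtain ⟨z, h1, h2⟩ := hv
    obtain ⟨h3, h4⟩ := MemSobolev.of_laplacian (m := m + 2 * k) hp hn h h1
    obtain ⟨h5, h6, -⟩ := ih h3 h2
    have h7 : ¬ u =ᵐ[vol n] 0 → eLpNorm u (ENNReal.ofReal p) (vol n) <
        ENNReal.ofReal ((p * Real.conjExponent p / ((n : ℝ) - 1) ^ 2) ^ (k + 1)) *
          eLpNorm v (ENNReal.ofReal p) (vol n) := by
      intro hu
      -- The first Laplacian alone gives strictness; the remaining ones only need the weak
      -- inequality.
      refine (h4 hu).trans_le ?_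
      rw [pow_succ' (_ / _) k, ENNReal.ofReal_mul hc, mul_assoc]
      exact mul_le_mul_right h6 _
    refine ⟨h5, ?_, fun _ => h7⟩
    by_cases hu : u =ᵐ[vol n] 0
    · rw [eLpNorm_congr_ae hu]; simp
    · exact (h7 hu).le

theorem MemSobolev.exists_isNormGradPow {p : ℝ} (hp : 1 < p) (hn : 2 ≤ n) {m : ℕ} {u : E n → ℝ}
    (h : MemSobolev m p u) : ∃ G, IsNormGradPow m u G := by
  rcases Nat.even_or_odd' m with ⟨k, rfl | rfl⟩
  · obtain ⟨v, h1, -⟩ := MemSobolev.exists_laplacianPow (m := 0) (k := k) hp hn (by simpa using h)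
    exact ⟨_, Or.inl ⟨even_two_mul k, v, by simpa using h1, rfl⟩⟩
  · obtain ⟨v, h1, h2⟩ := MemSobolev.exists_laplacianPow (m := 1) (k := k) hp hn
      (by simpa [add_comm] using h)
    obtain ⟨w, h3, -⟩ := h2.exists_partials hp
    refine ⟨_, Or.inr ⟨odd_two_mul_add_one k, v,
      fun x => WithLp.toLp 2 fun i => (conf x ^ 2)⁻¹ * w i x, by simpa using h1, fun i => ?_, rfl⟩⟩
    refine (h3 i).congr_on (fun _ _ => rfl) fun x hx => ?_
    have := (conf_pos hx).ne'
    simp only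
    field_simp

theorem HasWeakGrad.conf_mul_norm_ae_eq {v : E n → ℝ} {X : E n → E n} {w : Fin n → E n → ℝ}
    (hX : HasWeakGrad v X) (hw : ∀ i, HasWeakPartial i v (w i)) :
    (fun x => conf x * ‖X x‖) =ᵐ[vol n]
      fun x => ‖(conf x)⁻¹ • (WithLp.toLp 2 fun i => w i x : E n)‖ := by
  have h1 : ∀ᵐ x ∂(vol n), ∀ i, conf x ^ 2 * X x i = w i x :=
    ae_all_iff.mpr fun i => ae_vol_of_ae ((hX i).ae_unique (hw i))
  filter_upwards [h1, ae_vol_mem_ball] with x hx hb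
  have hc := conf_pos hb
  rw [← Real.norm_of_nonneg hc.le, ← norm_smul]
  congr 1
  ext i
  simp only [PiLp.smul_apply, smul_eq_mul, ← hx i, Real.norm_of_nonneg hc.le]
  field_simp

theorem MemSobolev.of_isNormGradPow {p : ℝ} (hp : 1 < p) (hn : 2 ≤ n) {m : ℕ} (hm : 1 ≤ m)
    {u G : E n → ℝ} (h : MemSobolev m p u) (hG : IsNormGradPow m u G) :
    MemLp G (ENNReal.ofReal p) (vol n) ∧
      (¬ u =ᵐ[vol n] 0 → eLpNorm u (ENNReal.ofReal p) (vol n) <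
        ENNReal.ofReal (sharpConst n m p) * eLpNorm G (ENNReal.ofReal p) (vol n)) := by
  have := fact_one_le hp
  have hnR : (2 : ℝ) ≤ n := by exact_mod_cast hn
  rcases hG with ⟨hm2, w, hw, rfl⟩ | ⟨hm2, v, X, hv, hX, rfl⟩
  · obtain ⟨k, rfl⟩ := hm2.two_dvd
    rw [Nat.mul_div_cancel_left k two_pos] at hw
    obtain ⟨h1, -, h3⟩ := MemSobolev.of_laplacianPow (m := 0) hp hn k (by simpa using h) hw
    refine ⟨(h1.memLp hp).abs, fun hu => ?_⟩
    have := h3 (by omega) hu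
    rwa [← eLpNorm_norm w, ← Nat.mul_div_cancel_left k two_pos,
      ← show sharpConst n (2 * k) p = _ from if_pos hm2] at this
  · obtain ⟨k, rfl⟩ := hm2
    rw [Nat.add_sub_cancel, Nat.mul_div_cancel_left k two_pos] at hv
    obtain ⟨h1, h2, -⟩ := MemSobolev.of_laplacianPow (m := 1) hp hn k
      (by simpa [add_comm] using h) hv
    obtain ⟨w, h3, h4⟩ := h1.exists_partials hp
    have h5 := hX.conf_mul_norm_ae_eq h3
    have hwv : MemLp (fun x => (conf x)⁻¹ • (WithLp.toLp 2 fun i => w i x : E n))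
      (ENNReal.ofReal p) (vol n) := by rw [memLp_piLp_iff]; exact h4
    refine ⟨hwv.norm.ae_eq h5.symm, fun hu => ?_⟩
    have hc : 0 < (p * Real.conjExponent p / ((n : ℝ) - 1) ^ 2) ^ k := by
      have := (Real.HolderConjugate.conjExponent hp).symm.pos
      have : 0 < (n : ℝ) - 1 := by linarith
      positivity
    -- The gradient inequality is strict only for nonzero functions; if `v` vanished, the bound of
    -- `u` by `v` would force `u` to vanish.
    have hv0 : ¬ v =ᵐ[vol n] 0 := by
      intro hv0
      rw [eLpNorm_congr_ae hv0] at h2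
      simp only [eLpNorm_zero, mul_zero, nonpos_iff_eq_zero] at h2
      exact hu ((eLpNorm_eq_zero_iff (h.memLp hp).1 (by simp; linarith)).mp h2)
    have h6 := eLpNorm_lt_grad hp hn (h1.memLp hp) h3 h4 hv0
    rw [eLpNorm_congr_ae h5, eLpNorm_norm, sharpConst,
      if_neg (Nat.not_even_iff_odd.mpr (odd_two_mul_add_one k)), Nat.add_sub_cancel,
      Nat.mul_div_cancel_left k two_pos, mul_comm (p / _), ENNReal.ofReal_mul hc.le, mul_assoc]
    refine h2.trans_lt ?_
    rwa [ENNReal.mul_lt_mul_iff_right (by simpa using hc) ENNReal.ofReal_ne_top]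

/-! ### Powers of the defining function of the ball -/

/-- The functions `(1 - |x|²)^β q` on the ball, with `q` smooth up to the boundary. -/
def IsBoundaryPow (β : ℝ) (f : E n → ℝ) : Prop :=
  ∃ q : E n → ℝ, ContDiff ℝ ∞ q ∧ ∀ x ∈ ball n, f x = (1 - ‖x‖ ^ 2) ^ β * q x

theorem contDiffOn_rpow (β : ℝ) :
    ContDiffOn ℝ ∞ (fun x : E n => (1 - ‖x‖ ^ 2) ^ β) (ball n) :=
  (contDiff_const.sub (contDiff_norm_sq ℝ)).contDiffOn.rpow_const_of_ne
    fun _ hx => (one_sub_normSq_pos hx).ne'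

theorem pd_rpow (i : Fin n) (β : ℝ) {x : E n} (hx : x ∈ ball n) :
    pd i (fun y => (1 - ‖y‖ ^ 2) ^ β) x = -2 * β * (1 - ‖x‖ ^ 2) ^ (β - 1) * x i := by
  have h1 : HasDerivAt (fun t : ℝ => (1 - t) ^ β) (-1 * β * (1 - ‖x‖ ^ 2) ^ (β - 1)) (‖x‖ ^ 2) :=
    ((hasDerivAt_id _).const_sub 1).rpow_const (Or.inl (one_sub_normSq_pos hx).ne')
  rw [pd_comp i h1 (differentiableAt_normSq x), pd_normSq]
  ring

theorem IsBoundaryPow.contDiffOn {β : ℝ} {f : E n → ℝ} (h : IsBoundaryPow β f) :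
    ContDiffOn ℝ ∞ f (ball n) := by
  obtain ⟨q, hq, hf⟩ := h
  exact ((contDiffOn_rpow β).mul hq.contDiffOn).congr hf

theorem IsBoundaryPow.congr {β : ℝ} {f g : E n → ℝ} (h : IsBoundaryPow β f)
    (hg : ∀ x ∈ ball n, g x = f x) : IsBoundaryPow β g := by
  obtain ⟨q, hq, hf⟩ := h
  exact ⟨q, hq, fun x hx => (hg x hx).trans (hf x hx)⟩

theorem IsBoundaryPow.zero (β : ℝ) : IsBoundaryPow β (fun _ : E n => 0) :=
  ⟨fun _ => 0, contDiff_const, by simp⟩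

theorem IsBoundaryPow.add {β : ℝ} {f g : E n → ℝ} (hf : IsBoundaryPow β f)
    (hg : IsBoundaryPow β g) : IsBoundaryPow β (fun x => f x + g x) := by
  obtain ⟨q, hq, hf⟩ := hf
  obtain ⟨r, hr, hg⟩ := hg
  exact ⟨fun x => q x + r x, hq.add hr, fun x hx => by simp only [hf x hx, hg x hx, mul_add]⟩

theorem IsBoundaryPow.sum {ι : Type*} (s : Finset ι) {β : ℝ} {f : ι → E n → ℝ}
    (hf : ∀ j ∈ s, IsBoundaryPow β (f j)) : IsBoundaryPow β (fun x => ∑ j ∈ s, f j x) := by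
  classical
  induction s using Finset.induction_on with
  | empty => simpa using IsBoundaryPow.zero β
  | insert a s ha ih =>
    simp only [Finset.sum_insert ha]
    exact (hf a (Finset.mem_insert_self a s)).add
      (ih fun j hj => hf j (Finset.mem_insert_of_mem hj))

theorem IsBoundaryPow.mul {β γ : ℝ} {f g : E n → ℝ} (hf : IsBoundaryPow β f)
    (hg : IsBoundaryPow γ g) : IsBoundaryPow (β + γ) (fun x => f x * g x) := by
  obtain ⟨q, hq, hf⟩ := hf
  obtain ⟨r, hr, hg⟩ := hg
  refine ⟨fun x => q x * r x, hq.mul hr, fun x hx => ?_⟩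
  simp only [hf x hx, hg x hx, Real.rpow_add (one_sub_normSq_pos hx)]
  ring

theorem IsBoundaryPow.of_contDiff {f : E n → ℝ} (hf : ContDiff ℝ ∞ f) : IsBoundaryPow 0 f :=
  ⟨f, hf, fun x _ => by simp⟩

theorem IsBoundaryPow.rpow (β : ℝ) : IsBoundaryPow β (fun x : E n => (1 - ‖x‖ ^ 2) ^ β) :=
  ⟨fun _ => 1, contDiff_const, by simp⟩

theorem contDiff_pd {f : E n → ℝ} (hf : ContDiff ℝ ∞ f) (i : Fin n) : ContDiff ℝ ∞ (pd i f) :=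
  (hf.fderiv_right (by simp)).clm_apply contDiff_const

theorem contDiff_coord (i : Fin n) : ContDiff ℝ ∞ (fun x : E n => x i) :=
  contDiffOn_univ.mp (contDiffOn_coord i univ)

theorem IsBoundaryPow.pd {β : ℝ} {f : E n → ℝ} (hf : IsBoundaryPow β f) (i : Fin n) :
    IsBoundaryPow (β - 1) (pd i f) := by
  obtain ⟨q, hq, hf⟩ := hf
  refine ⟨fun x => -2 * β * x i * q x + (1 - ‖x‖ ^ 2) * HypBall.pd i q x,
    ((contDiff_const.mul (contDiff_coord i)).mul hq).add
      ((contDiff_const.sub (contDiff_norm_sq ℝ)).mul (contDiff_pd hq i)), fun x hx => ?_⟩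
  have h1 : f =ᶠ[nhds x] fun y => (1 - ‖y‖ ^ 2) ^ β * q y := by
    filter_upwards [isOpen_ball.mem_nhds hx] with y hy using hf y hy
  rw [pd_congr i h1, pd_mul i (ContDiffOn.differentiableAt_ball (contDiffOn_rpow β) hx)
    (hq.differentiable (by simp) x), pd_rpow i β hx]
  have h2 : (1 - ‖x‖ ^ 2) ^ β = (1 - ‖x‖ ^ 2) ^ (β - 1) * (1 - ‖x‖ ^ 2) := by
    rw [← Real.rpow_add_one (one_sub_normSq_pos hx).ne', sub_add_cancel]
  rw [h2]
  ring

theorem IsBoundaryPow.christoffel (l i j : Fin n) : IsBoundaryPow (-1) (christoffel l i j) := by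
  refine ⟨fun x => 2 * ((if l = i then x j else 0) + (if l = j then x i else 0)
      - if i = j then x l else 0), ?_, fun x hx => ?_⟩
  · refine contDiff_const.mul (ContDiff.sub (ContDiff.add ?_ ?_) ?_) <;> split_ifs <;>
      first | exact contDiff_coord _ | exact contDiff_const
  · rw [christoffel_eq l i j hx, Real.rpow_neg_one, conf]
    ring

/-- The covariant derivatives of the function `f`, in coordinates. -/
def covDeriv (f : E n → ℝ) : (k : ℕ) → TensorField n k
  | 0 => fun x => WithLp.toLp 2 fun _ => f x
  | k + 1 => fun x => WithLp.toLp 2 fun J =>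
      pd (J 0) (fun y => covDeriv f k y (Fin.tail J)) x -
        ∑ s, ∑ l, christoffel l (J 0) (Fin.tail J s) x *
          covDeriv f k x (Function.update (Fin.tail J) s l)

/-- Partial derivatives and Christoffel symbols each lower the exponent by one. The factor
`conf^(-k)` in the `g`-norm restores the `k` lost powers, so integrability of `(1 - |x|²)^β` alone
decides membership in every `W^(m,p)`. -/
theorem IsBoundaryPow.covDeriv {β : ℝ} {f : E n → ℝ} (hf : IsBoundaryPow β f) (k : ℕ)
    (J : Fin k → Fin n) : IsBoundaryPow (β - k) (fun x => covDeriv f k x J) := by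
  induction k with
  | zero => simpa [HypBall.covDeriv] using hf
  | succ k ih =>
    have h1 := (ih (Fin.tail J)).pd (J 0)
    have h2 := (IsBoundaryPow.of_contDiff (contDiff_const (c := (-1 : ℝ)))).mul
      (IsBoundaryPow.sum Finset.univ fun s _ => IsBoundaryPow.sum Finset.univ fun l _ =>
        (IsBoundaryPow.christoffel l (J 0) (Fin.tail J s)).mul
          (ih (Function.update (Fin.tail J) s l)))
    have e : β - ((k + 1 : ℕ) : ℝ) = β - k - 1 := by push_cast; ring
    have e2 : 0 + (-1 + (β - k)) = β - (k : ℝ) - 1 := by ring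
    rw [e2] at h2
    rw [e]
    refine (h1.add h2).congr fun x _ => ?_
    simp only [HypBall.covDeriv]
    ring

theorem hasWeakCovDeriv_covDeriv {β : ℝ} {f : E n → ℝ} (hf : IsBoundaryPow β f) (k : ℕ) :
    HasWeakCovDeriv (covDeriv f k) (covDeriv f (k + 1)) := by
  intro i J
  refine (hasWeakPartial_of_contDiffOn i (hf.covDeriv k J).contDiffOn).congr_on (fun _ _ => rfl)
    fun x _ => ?_
  simp [covDeriv]

theorem IsBoundaryPow.memSobolev {p β : ℝ} (hp : 1 < p) {f : E n → ℝ} (hf : IsBoundaryPow β f)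
    (hβ : MemLp (fun x : E n => (1 - ‖x‖ ^ 2) ^ β) (ENNReal.ofReal p) (vol n)) (m : ℕ) :
    MemSobolev m p f := by
  have := fact_one_le hp
  refine ⟨HypBall.covDeriv f, fun _ _ => rfl, fun k _ => hasWeakCovDeriv_covDeriv hf k,
    fun k _ => ?_⟩
  rw [memLp_tensor_iff]
  intro J
  obtain ⟨q, hq, hT⟩ := hf.covDeriv k J
  obtain ⟨C, hC⟩ := (isCompact_closedBall (0 : E n) 1).exists_bound_of_continuousOn
    hq.continuous.continuousOn
  refine (memLp_bdd_mul (b := fun x => (2⁻¹) ^ k * q x) (c := (2⁻¹) ^ k * C)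
    (continuous_const.mul hq.continuous).continuousOn (fun x hx => ?_) hβ).ae_eq ?_
  · rw [abs_mul, abs_of_pos (by positivity : (0 : ℝ) < 2⁻¹ ^ k)]
    exact mul_le_mul_of_nonneg_left (hC x (Metric.ball_subset_closedBall hx)) (by positivity)
  · filter_upwards [ae_vol_mem_ball] with x hx
    have hs := one_sub_normSq_pos hx
    have hTx : (HypBall.covDeriv f k x) J = (1 - ‖x‖ ^ 2) ^ (β - k) * q x := hT x hx
    rw [hTx, Real.rpow_sub_natCast hs.ne', conf, div_pow, inv_pow]
    field_simp

/-- The Laplacian of a power of `1 - |x|²`. -/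
theorem hasWeakLaplacian_rpow (hn : 1 ≤ n) (β : ℝ) :
    HasWeakLaplacian (fun x : E n => (1 - ‖x‖ ^ 2) ^ β) fun x =>
      -(β * ((n : ℝ) - 1 - β)) * (1 - ‖x‖ ^ 2) ^ β +
        β * ((n : ℝ) / 2 - 1 - β) * (1 - ‖x‖ ^ 2) ^ (β + 1) := by
  have h0 := contDiffOn_rpow (n := n) β
  have h1 := fun i : Fin n => hasWeakPartial_of_contDiffOn i h0
  have h2 := fun i : Fin n => hasWeakPartial_of_contDiffOn i (contDiffOn_pd h0 i)
  refine (hasWeakLaplacian_of_hasWeakPartial h1 h2 (h1 ⟨0, hn⟩).1).congr_ae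
    Filter.EventuallyEq.rfl ?_
  filter_upwards [ae_restrict_mem isOpen_ball.measurableSet] with x hx
  have hs := one_sub_normSq_pos hx
  have e2 : ∀ i, pd i (pd i fun y => (1 - ‖y‖ ^ 2) ^ β) x =
      4 * β * (β - 1) * (1 - ‖x‖ ^ 2) ^ (β - 1 - 1) * x i ^ 2 -
        2 * β * (1 - ‖x‖ ^ 2) ^ (β - 1) := fun i => by
    have h3 : (pd i fun y => (1 - ‖y‖ ^ 2) ^ β) =ᶠ[nhds x]
        fun y => -2 * β * ((1 - ‖y‖ ^ 2) ^ (β - 1) * y i) := by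
      filter_upwards [isOpen_ball.mem_nhds hx] with y hy
      rw [pd_rpow i β hy]; ring
    have d1 := ContDiffOn.differentiableAt_ball (contDiffOn_rpow (β - 1)) hx
    have d2 := ContDiffOn.differentiableAt_ball (contDiffOn_coord i (ball n)) hx
    rw [pd_congr i h3, pd_const_mul i _ (d1.fun_mul d2), pd_mul i d1 d2, pd_rpow i _ hx, pd_coord,
      if_pos rfl]
    ring
  have e3 : ∑ i, x i ^ 2 = ‖x‖ ^ 2 := by rw [EuclideanSpace.real_norm_sq_eq]
  have e4 : ∑ i, x i * pd i (fun y => (1 - ‖y‖ ^ 2) ^ β) x =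
      -2 * β * (1 - ‖x‖ ^ 2) ^ (β - 1) * ‖x‖ ^ 2 := by
    trans -2 * β * (1 - ‖x‖ ^ 2) ^ (β - 1) * ∑ i, x i ^ 2
    · rw [Finset.mul_sum]
      exact Finset.sum_congr rfl fun i _ => by rw [pd_rpow i β hx]; ring
    · rw [e3]
  rw [e4]
  simp only [e2]
  rw [Finset.sum_sub_distrib, ← Finset.mul_sum, e3]
  simp only [Finset.sum_const, Finset.card_univ, Fintype.card_fin, nsmul_eq_mul]
  rw [Real.rpow_sub_one hs.ne', Real.rpow_sub_one hs.ne', Real.rpow_add_one hs.ne', conf]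
  field_simp
  ring

theorem HasWeakLaplacian.const_mul {v w : E n → ℝ} (h : HasWeakLaplacian v w) (c : ℝ) :
    HasWeakLaplacian (fun x => c * v x) (fun x => c * w x) := by
  refine ⟨locallyIntegrableOn_smooth_mul h.1 contDiffOn_const,
    locallyIntegrableOn_smooth_mul h.2.1 contDiffOn_const, fun φ hφ => ?_⟩
  simp only [mul_assoc, integral_const_mul, h.2.2 φ hφ]

theorem IsTest.integrable_vol_mul {φ f : E n → ℝ} (hφ : IsTest φ)
    (hf : LocallyIntegrableOn f (ball n) volume) :
    IntegrableOn (fun x => conf x ^ n * (f x * φ x)) (ball n) := by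
  refine ((hφ.smooth_mul (contDiffOn_conf_pow n)).integrable_mul hf).congr (ae_of_all _ fun x => ?_)
  simp only; ring

theorem HasWeakLaplacian.add {v w v' w' : E n → ℝ} (h : HasWeakLaplacian v w)
    (h' : HasWeakLaplacian v' w') :
    HasWeakLaplacian (fun x => v x + v' x) (fun x => w x + w' x) := by
  rw [hasWeakLaplacian_iff] at h h' ⊢
  refine ⟨locallyIntegrableOn_add h.1 h'.1, locallyIntegrableOn_add h.2.1 h'.2.1, fun φ hφ => ?_⟩
  simp only [add_mul, mul_add]
  rw [integral_add (hφ.laplaceBeltrami.integrable_vol_mul h.1)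
    (hφ.laplaceBeltrami.integrable_vol_mul h'.1), integral_add (hφ.integrable_vol_mul h.2.1)
    (hφ.integrable_vol_mul h'.2.1), h.2.2 φ hφ, h'.2.2 φ hφ]

theorem HasWeakLaplacian.sum_range {v w : ℕ → E n → ℝ} (h : ∀ j, HasWeakLaplacian (v j) (w j))
    (k : ℕ) : HasWeakLaplacian (fun x => ∑ j ∈ Finset.range (k + 1), v j x)
      (fun x => ∑ j ∈ Finset.range (k + 1), w j x) := by
  induction k with
  | zero => simpa using h 0
  | succ k ih =>
    simp only [Finset.sum_range_succ _ (k + 1)]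
    exact ih.add (h (k + 1))

theorem HasWeakLaplacianPow.succ {k : ℕ} {v z w : E n → ℝ} (h : HasWeakLaplacianPow k v z)
    (hz : HasWeakLaplacian z w) : HasWeakLaplacianPow (k + 1) v w := by
  induction k generalizing v with
  | zero =>
    obtain rfl : z = v := h
    exact ⟨w, hz, rfl⟩
  | succ k ih =>
    obtain ⟨y, h1, h2⟩ := h
    exact ⟨y, h1, ih h2⟩

/-- Each Laplacian maps the power `β` to a combination of the powers `β` and `β + 1`, so the
coefficients obey a two-term recursion. Only `c 0` matters for sharpness; for the others continuity
in `β` is enough. -/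
theorem exists_laplacianPow_rpow (hn : 1 ≤ n) (k : ℕ) : ∃ c : ℕ → ℝ → ℝ,
    (∀ j, Continuous (c j)) ∧ (∀ β, c 0 β = (-(β * ((n : ℝ) - 1 - β))) ^ k) ∧
    (∀ j, k < j → ∀ β, c j β = 0) ∧
    ∀ β, HasWeakLaplacianPow k (fun x : E n => (1 - ‖x‖ ^ 2) ^ β)
      (fun x => ∑ j ∈ Finset.range (k + 1), c j β * (1 - ‖x‖ ^ 2) ^ (β + j)) := by
  induction k with
  | zero =>
    refine ⟨fun j _ => if j = 0 then 1 else 0, fun j => continuous_const, by simp,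
      fun j hj _ => if_neg hj.ne', fun β => ?_⟩
    simp [HasWeakLaplacianPow]
  | succ k ih =>
    obtain ⟨c, hc, hc0, hck, hL⟩ := ih
    set a : ℝ → ℝ := fun β => -(β * ((n : ℝ) - 1 - β)) with ha
    set b : ℝ → ℝ := fun β => β * ((n : ℝ) / 2 - 1 - β) with hb
    have ca : Continuous a := by fun_prop
    have cb : Continuous b := by fun_prop
    refine ⟨fun j β => match j with
      | 0 => a β * c 0 β
      | j + 1 => a (β + (j + 1 : ℕ)) * c (j + 1) β + b (β + j) * c j β, ?_, fun β => ?_,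
      ?_, fun β => (hL β).succ ?_⟩
    · rintro (_ | j)
      · exact ca.mul (hc 0)
      · exact ((ca.comp (by fun_prop)).mul (hc (j + 1))).add ((cb.comp (by fun_prop)).mul (hc j))
    · simp only [hc0, ha, pow_succ']
    · rintro (_ | j) hj β
      · omega
      · simp [hck j (by omega), hck (j + 1) (by omega)]
    · have h1 : HasWeakLaplacian
          (fun x : E n => ∑ j ∈ Finset.range (k + 1), c j β * (1 - ‖x‖ ^ 2) ^ (β + j))
          (fun x => ∑ j ∈ Finset.range (k + 1), c j β * (a (β + j) * (1 - ‖x‖ ^ 2) ^ (β + j) +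
            b (β + j) * (1 - ‖x‖ ^ 2) ^ (β + j + 1))) := HasWeakLaplacian.sum_range
        (fun j : ℕ => (hasWeakLaplacian_rpow hn (β + j)).const_mul (c j β)) k
      clear_value a b
      convert h1 using 2 with x
      rw [Finset.sum_range_succ']
      -- The term `j = k + 1` may be added since its coefficient is zero; then the term `j = 0` is
      -- split off to match the recursion.
      have e1 : ∑ j ∈ Finset.range (k + 1), c j β * (a (β + j) * (1 - ‖x‖ ^ 2) ^ (β + j)) =
          ∑ j ∈ Finset.range (k + 1), c (j + 1) β * (a (β + (j + 1 : ℕ)) *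
            (1 - ‖x‖ ^ 2) ^ (β + (j + 1 : ℕ))) + c 0 β * (a β * (1 - ‖x‖ ^ 2) ^ β) := by
        rw [← add_zero (∑ j ∈ Finset.range (k + 1), c j β * _),
          ← zero_mul (a (β + (k + 1 : ℕ)) * (1 - ‖x‖ ^ 2) ^ (β + (k + 1 : ℕ))),
          ← hck (k + 1) (by omega) β, ← Finset.sum_range_succ, Finset.sum_range_succ']
        simp
      simp only [mul_add, Finset.sum_add_distrib, add_mul]
      rw [e1, Nat.cast_zero, add_zero, add_right_comm]
      congr 1
      · congr 1
        · exact Finset.sum_congr rfl fun j _ => by ring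
        · ring
      · refine Finset.sum_congr rfl fun j _ => ?_
        rw [Nat.cast_succ, ← add_assoc β]
        ring

/-- The absolute value of `∇^m` of a power, up to powers of higher order. -/
theorem exists_isNormGradPow_rpow {p : ℝ} (hp : 1 < p) (hn : 2 ≤ n) (m : ℕ) : ∃ d D : ℝ → ℝ,
    Continuous d ∧ Continuous D ∧ (∀ β, 0 ≤ d β) ∧ (∀ β, 0 ≤ D β) ∧
    sharpConst n m p * d (((n : ℝ) - 1) / p) = 1 ∧
    ∀ β, ∃ G : E n → ℝ, IsNormGradPow m (fun x : E n => (1 - ‖x‖ ^ 2) ^ β) G ∧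
      ∀ x ∈ ball n, |G x| ≤ d β * (1 - ‖x‖ ^ 2) ^ β + D β * (1 - ‖x‖ ^ 2) ^ (β + 1) := by
  have hnR : (2 : ℝ) ≤ n := by exact_mod_cast hn
  have hn1 : (0 : ℝ) < (n : ℝ) - 1 := by linarith
  have hp1 : 0 < p - 1 := by linarith
  have hp0 : 0 < p := by linarith
  have hpow : ∀ β : ℝ, ∀ x ∈ ball n, ∀ j : ℕ,
      (1 - ‖x‖ ^ 2) ^ (β + (j + 1 : ℕ)) ≤ (1 - ‖x‖ ^ 2) ^ (β + 1) := fun β x hx j => by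
    refine Real.rpow_le_rpow_of_exponent_ge (one_sub_normSq_pos hx)
      (by nlinarith [sq_nonneg ‖x‖]) ?_
    push_cast
    have : (0 : ℝ) ≤ j := j.cast_nonneg
    linarith
  have hsum : ∀ (k : ℕ) (e : ℕ → ℝ) (β : ℝ), ∀ x ∈ ball n,
      |∑ j ∈ Finset.range (k + 1), e j * (1 - ‖x‖ ^ 2) ^ (β + j)| ≤
        |e 0| * (1 - ‖x‖ ^ 2) ^ β +
          (∑ j ∈ Finset.range k, |e (j + 1)|) * (1 - ‖x‖ ^ 2) ^ (β + 1) := by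
    intro k e β x hx
    have hs := one_sub_normSq_pos hx
    refine (Finset.abs_sum_le_sum_abs _ _).trans ?_
    rw [Finset.sum_range_succ', add_comm, Finset.sum_mul]
    refine add_le_add (by simp [abs_mul, abs_of_pos (Real.rpow_pos_of_pos hs β)])
      (Finset.sum_le_sum fun j _ => ?_)
    rw [abs_mul, abs_of_pos (Real.rpow_pos_of_pos hs _)]
    exact mul_le_mul_of_nonneg_left (hpow β x hx j) (abs_nonneg _)
  -- At `β₀ = (n - 1) / p` the factor `β (n - 1 - β)` is the reciprocal of the second order
  -- constant.
  have hlam : ((n : ℝ) - 1) / p * ((n : ℝ) - 1 - ((n : ℝ) - 1) / p) *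
      (p * Real.conjExponent p / ((n : ℝ) - 1) ^ 2) = 1 := by
    rw [Real.conjExponent]
    field_simp
  have hlamk : ∀ k : ℕ, (p * Real.conjExponent p / ((n : ℝ) - 1) ^ 2) ^ k *
      |(-(((n : ℝ) - 1) / p * ((n : ℝ) - 1 - ((n : ℝ) - 1) / p))) ^ k| = 1 := by
    intro k
    have h1 : 0 < p * Real.conjExponent p / ((n : ℝ) - 1) ^ 2 := by
      rw [Real.conjExponent]; positivity
    have h2 : 0 < ((n : ℝ) - 1) / p * ((n : ℝ) - 1 - ((n : ℝ) - 1) / p) :=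
      pos_of_mul_pos_left (by rw [hlam]; exact one_pos) h1.le
    rw [abs_pow, abs_neg, abs_of_pos h2, ← mul_pow, mul_comm, hlam, one_pow]
  rcases Nat.even_or_odd' m with ⟨k, rfl | rfl⟩
  · obtain ⟨c, hc, hc0, -, hL⟩ := exists_laplacianPow_rpow (n := n) (by omega) k
    refine ⟨fun β => |c 0 β|, fun β => ∑ j ∈ Finset.range k, |c (j + 1) β|, (hc 0).abs,
      continuous_finsetSum _ fun j _ => (hc (j + 1)).abs, fun β => abs_nonneg _,
      fun β => Finset.sum_nonneg fun j _ => abs_nonneg _, ?_, fun β =>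
      ⟨_, Or.inl ⟨even_two_mul k, _, by simpa using hL β, rfl⟩, fun x hx => ?_⟩⟩
    · rw [sharpConst, if_pos (even_two_mul k), Nat.mul_div_cancel_left k two_pos]
      simp only [hc0]
      exact hlamk k
    · rw [abs_abs]
      exact hsum k (fun j => c j β) β x hx
  · obtain ⟨c, hc, hc0, -, hL⟩ := exists_laplacianPow_rpow (n := n) (by omega) k
    -- The gradient of `(1 - |x|²)^γ` is radial with `g`-norm `|γ| |x| (1 - |x|²)^γ`; this supplies
    -- the factor `γ = β + j`, while `|x|` is bounded by `1` at the end.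
    set e : ℝ → ℕ → ℝ := fun β j => (β + j) * c j β with he
    have ce : ∀ j, Continuous fun β => e β j := fun j => by
      have := hc j
      fun_prop
    set h : ℝ → E n → ℝ := fun β x =>
      -(conf x * ∑ j ∈ Finset.range (k + 1), e β j * (1 - ‖x‖ ^ 2) ^ (β + j)) with hh
    refine ⟨fun β => |e β 0|, fun β => ∑ j ∈ Finset.range k, |e β (j + 1)|, (ce 0).abs,
      continuous_finsetSum _ fun j _ => (ce (j + 1)).abs, fun β => abs_nonneg _,
      fun β => Finset.sum_nonneg fun j _ => abs_nonneg _, ?_, fun β =>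
      ⟨_, Or.inr ⟨odd_two_mul_add_one k, _, fun x => (conf x ^ 2)⁻¹ • (h β x • x),
        by simpa using hL β, fun i => ?_, rfl⟩, fun x hx => ?_⟩⟩
    · rw [sharpConst, if_neg (Nat.not_even_iff_odd.mpr (odd_two_mul_add_one k)), Nat.add_sub_cancel,
        Nat.mul_div_cancel_left k two_pos]
      simp only [he, hc0, Nat.cast_zero, add_zero, abs_mul]
      rw [mul_mul_mul_comm, hlamk k, abs_of_pos (by positivity)]
      field_simp
    · refine (hasWeakPartial_of_contDiffOn i ?_).congr_on (fun _ _ => rfl) fun x hx => ?_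
      · exact ContDiffOn.sum fun j _ => contDiffOn_const.mul (contDiffOn_rpow _)
      · have hs := one_sub_normSq_pos hx
        have hd : ∀ j : ℕ, DifferentiableAt ℝ (fun y : E n => (1 - ‖y‖ ^ 2) ^ (β + j)) x :=
          fun j => ContDiffOn.differentiableAt_ball (contDiffOn_rpow _) hx
        have hcx := (conf_pos hx).ne'
        rw [pd_sum i fun j _ => (hd j).const_mul _]
        simp only [PiLp.smul_apply, smul_eq_mul]
        rw [mul_inv_cancel_left₀ (pow_ne_zero 2 hcx), hh]
        simp only [Finset.mul_sum, ← Finset.sum_neg_distrib, Finset.sum_mul]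
        refine Finset.sum_congr rfl fun j _ => ?_
        rw [pd_const_mul i _ (hd j), pd_rpow i _ hx, Real.rpow_sub_one hs.ne', conf]
        simp only [he]
        field_simp
    · have hcx := conf_pos hx
      have hx1 : ‖x‖ ≤ 1 := (mem_ball_zero_iff.mp hx).le
      refine le_trans ?_ (hsum k (e β) β x hx)
      rw [norm_smul, norm_smul, abs_of_nonneg (by positivity), Real.norm_of_nonneg (by positivity),
        hh, norm_neg, norm_mul, Real.norm_of_nonneg hcx.le]
      have : conf x * ((conf x ^ 2)⁻¹ * (conf x * ‖∑ j ∈ Finset.range (k + 1),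
          e β j * (1 - ‖x‖ ^ 2) ^ (β + j)‖ * ‖x‖)) =
          ‖∑ j ∈ Finset.range (k + 1), e β j * (1 - ‖x‖ ^ 2) ^ (β + j)‖ * ‖x‖ := by
        field_simp
      rw [this]
      exact mul_le_of_le_one_right (norm_nonneg _) hx1

/-! ### Norms of powers -/

theorem integral_one_sub_sq_rpow {γ a : ℝ} (hγ : -1 < γ) (ha : 0 ≤ a) (ha1 : a ≤ 1) :
    IntegrableOn (fun y : ℝ => y * (1 - y ^ 2) ^ γ) (Ioc a 1) ∧
      ∫ y in Ioc a 1, y * (1 - y ^ 2) ^ γ = (1 - a ^ 2) ^ (γ + 1) / (2 * (γ + 1)) := by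
  have h1 : 0 < γ + 1 := by linarith
  have hc : ContinuousOn (fun y : ℝ => -((1 - y ^ 2) ^ (γ + 1) / (2 * (γ + 1)))) (Icc a 1) :=
    ((((continuous_const.sub (continuous_pow 2)).rpow_const fun _ =>
      Or.inr h1.le).div_const _).neg).continuousOn
  have hd : ∀ y ∈ Ioo a 1, HasDerivAt (fun y : ℝ => -((1 - y ^ 2) ^ (γ + 1) / (2 * (γ + 1))))
      (y * (1 - y ^ 2) ^ γ) y := fun y hy => by
    have hy0 : 0 < y := ha.trans_lt hy.1
    have hy1 : 1 - y ^ 2 ≠ 0 := by nlinarith [hy.2]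
    have := ((((hasDerivAt_pow 2 y).const_sub 1).rpow_const (p := γ + 1)
      (Or.inl hy1)).div_const (2 * (γ + 1))).fun_neg
    refine this.congr_deriv ?_
    rw [add_sub_cancel_right]
    push_cast
    field_simp
  have hi := intervalIntegral.integrableOn_deriv_of_nonneg hc hd fun y hy =>
    mul_nonneg (ha.trans hy.1.le) (Real.rpow_nonneg (by nlinarith [hy.1, hy.2]) _)
  refine ⟨hi, ?_⟩
  rw [← intervalIntegral.integral_of_le ha1, intervalIntegral.integral_eq_sub_of_hasDerivAt_of_le
    ha1 hc hd ((intervalIntegrable_iff_integrableOn_Ioc_of_le ha1).mpr hi)]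
  simp [Real.zero_rpow h1.ne']

theorem integrableOn_radial_rpow (hn : 2 ≤ n) {γ : ℝ} (hγ : -1 < γ) :
    IntegrableOn (fun y : ℝ => y ^ (n - 1) * (1 - y ^ 2) ^ γ) (Ioo 0 1) := by
  have h1 := ((integral_one_sub_sq_rpow hγ le_rfl zero_le_one).1.mono_set Ioo_subset_Ioc_self)
  refine (h1.bdd_mul (c := 1) (f := fun y => y ^ (n - 2)) (continuous_pow _).aestronglyMeasurable
    ?_).congr (ae_of_all _ fun y => ?_)
  · filter_upwards [ae_restrict_mem measurableSet_Ioo] with y hy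
    rw [Real.norm_of_nonneg (pow_nonneg hy.1.le _)]
    exact pow_le_one₀ hy.1.le hy.2.le
  · beta_reduce
    rw [← mul_assoc, ← pow_succ, show n - 2 + 1 = n - 1 by omega]

theorem integrableOn_ball_rpow (hn : 2 ≤ n) {γ : ℝ} (hγ : -1 < γ) :
    IntegrableOn (fun x : E n => (1 - ‖x‖ ^ 2) ^ γ) (ball n) := by
  have : Nonempty (Fin n) := ⟨⟨0, by omega⟩⟩
  rw [integrableOn_fun_norm_addHaar volume (f := fun y => (1 - y ^ 2) ^ γ)]
  simpa using integrableOn_radial_rpow hn hγ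

/-- In polar coordinates, restrict to radii `y` in `(1/2, 1)`, where `y^(n-1) ≥ (1/2)^(n-2) y`. The
remaining integral is `(3/4)^(γ+1) / (2 (γ+1))`, and `(3/4)^(γ+1) ≥ 3/4` gives the constant `3/8`.
-/
theorem exists_integral_ball_rpow_ge (hn : 2 ≤ n) : ∃ K > 0, ∀ γ : ℝ, -1 < γ → γ < 0 →
    K / (γ + 1) ≤ ∫ x in ball n, (1 - ‖x‖ ^ 2) ^ γ := by
  have : Nonempty (Fin n) := ⟨⟨0, by omega⟩⟩
  have hn0 : (0 : ℝ) < n := by exact_mod_cast (by omega : 0 < n)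
  have hω : 0 < (volume : Measure (E n)).real (ball n) :=
    ENNReal.toReal_pos (Metric.measure_ball_pos _ _ one_pos).ne' measure_ball_lt_top.ne
  refine ⟨n * ((volume : Measure (E n)).real (ball n) * ((1 / 2) ^ (n - 2) * (3 / 8))),
    by positivity, fun γ h0 h1 => ?_⟩
  have hγ : 0 < γ + 1 := by linarith
  have e1 : ∫ x in ball n, (1 - ‖x‖ ^ 2) ^ γ = n * ((volume : Measure (E n)).real (ball n) *
      ∫ y in Ioo (0 : ℝ) 1, y ^ (n - 1) * (1 - y ^ 2) ^ γ) := by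
    have h2 : (fun x : E n => (ball n).indicator (fun x => (1 - ‖x‖ ^ 2) ^ γ) x) =
        fun x => (Iio (1 : ℝ)).indicator (fun y => (1 - y ^ 2) ^ γ) ‖x‖ := by
      funext x
      simp [indicator]
    rw [← integral_indicator isOpen_ball.measurableSet, h2, integral_fun_norm_addHaar volume]
    simp only [finrank_euclideanSpace, Fintype.card_fin, nsmul_eq_mul, smul_eq_mul]
    congr 2
    rw [← Ioi_inter_Iio, ← setIntegral_indicator measurableSet_Iio]
    refine setIntegral_congr_fun measurableSet_Ioi fun y _ => ?_
    simp only [indicator]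
    split_ifs <;> simp
  have e2 : (1 / 2) ^ (n - 2) * (3 / 8) / (γ + 1) ≤
      ∫ y in Ioo (0 : ℝ) 1, y ^ (n - 1) * (1 - y ^ 2) ^ γ := by
    obtain ⟨i1, i2⟩ := integral_one_sub_sq_rpow h0 (by norm_num : (0 : ℝ) ≤ 1 / 2) (by norm_num)
    have hsub : Ioo (1 / 2 : ℝ) 1 ⊆ Ioo 0 1 := Ioo_subset_Ioo_left (by norm_num)
    have hi := integrableOn_radial_rpow hn h0
    calc (1 / 2) ^ (n - 2) * (3 / 8) / (γ + 1)
        ≤ (1 / 2) ^ (n - 2) * ((1 - (1 / 2 : ℝ) ^ 2) ^ (γ + 1) / (2 * (γ + 1))) := by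
          have : (3 / 4 : ℝ) ≤ (3 / 4 : ℝ) ^ (γ + 1) := by
            conv_lhs => rw [← Real.rpow_one (3 / 4 : ℝ)]
            exact Real.rpow_le_rpow_of_exponent_ge (by norm_num) (by norm_num) (by linarith)
          rw [mul_div_assoc]
          refine mul_le_mul_of_nonneg_left ?_ (by positivity)
          rw [show (1 - (1 / 2 : ℝ) ^ 2) = 3 / 4 by norm_num, div_le_div_iff₀ hγ (by linarith)]
          nlinarith
      _ = ∫ y in Ioo (1 / 2 : ℝ) 1, (1 / 2) ^ (n - 2) * (y * (1 - y ^ 2) ^ γ) := by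
          rw [integral_const_mul, ← i2, integral_Ioc_eq_integral_Ioo]
      _ ≤ ∫ y in Ioo (1 / 2 : ℝ) 1, y ^ (n - 1) * (1 - y ^ 2) ^ γ := by
          refine setIntegral_mono_on ((i1.mono_set Ioo_subset_Ioc_self).const_mul _)
            (hi.mono_set hsub) measurableSet_Ioo fun y hy => ?_
          have hy1 : 0 ≤ 1 - y ^ 2 := by nlinarith [hy.1, hy.2]
          rw [show n - 1 = n - 2 + 1 by omega, pow_succ y (n - 2), mul_assoc]
          have hy2 : 0 ≤ y * (1 - y ^ 2) ^ γ :=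
            mul_nonneg (by linarith [hy.1]) (Real.rpow_nonneg hy1 _)
          exact mul_le_mul_of_nonneg_right (pow_le_pow_left₀ (by norm_num) hy.1.le _) hy2
      _ ≤ _ := by
          refine setIntegral_mono_set hi ?_ hsub.eventuallyLE
          filter_upwards [ae_restrict_mem measurableSet_Ioo] with y hy
          exact mul_nonneg (pow_nonneg hy.1.le _)
            (Real.rpow_nonneg (by nlinarith [hy.1, hy.2]) _)
  rw [e1, mul_div_assoc, mul_div_assoc]
  gcongr

/-- The volume density turns the exponent `β p` into `β p - n`, which exceeds the integrability
threshold `-1` exactly when `β > (n - 1) / p`. -/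
theorem eLpNorm_rpow_eq {p : ℝ} (hp : 1 < p) (hn : 2 ≤ n) {β : ℝ} (hβ : ((n : ℝ) - 1) / p < β) :
    eLpNorm (fun x : E n => (1 - ‖x‖ ^ 2) ^ β) (ENNReal.ofReal p) (vol n) ^ p =
      ENNReal.ofReal (2 ^ n * ∫ x in ball n, (1 - ‖x‖ ^ 2) ^ (β * p - n)) := by
  have hp0 : 0 < p := by linarith
  have h1 : -1 < β * p - n := by rw [div_lt_iff₀ hp0] at hβ; linarith
  rw [eLpNorm_rpow hp, lintegral_vol, ENNReal.ofReal_mul (by positivity),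
    ofReal_integral_eq_lintegral_ofReal (integrableOn_ball_rpow hn h1),
    ← lintegral_const_mul' _ _ ENNReal.ofReal_ne_top]
  · refine setLIntegral_congr_fun isOpen_ball.measurableSet fun x hx => ?_
    have hs := one_sub_normSq_pos hx
    rw [← ofReal_norm, ENNReal.ofReal_rpow_of_nonneg (norm_nonneg _) hp0.le,
      Real.norm_of_nonneg (Real.rpow_nonneg hs.le _), ← Real.rpow_mul hs.le,
      ← ENNReal.ofReal_mul (pow_nonneg (conf_pos hx).le _), ← ENNReal.ofReal_mul (by positivity),
      Real.rpow_sub_natCast hs.ne', conf, div_pow]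
    congr 1
    ring
  · filter_upwards [ae_restrict_mem isOpen_ball.measurableSet] with x hx
    exact Real.rpow_nonneg (one_sub_normSq_pos hx).le _

theorem memLp_rpow {p : ℝ} (hp : 1 < p) (hn : 2 ≤ n) {β : ℝ} (hβ : ((n : ℝ) - 1) / p < β) :
    MemLp (fun x : E n => (1 - ‖x‖ ^ 2) ^ β) (ENNReal.ofReal p) (vol n) := by
  refine ⟨aestronglyMeasurable_vol (contDiffOn_rpow β).continuousOn, ?_⟩
  have h : eLpNorm (fun x : E n => (1 - ‖x‖ ^ 2) ^ β) (ENNReal.ofReal p) (vol n) ^ p ≠ ⊤ := by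
    rw [eLpNorm_rpow_eq hp hn hβ]; exact ENNReal.ofReal_ne_top
  rw [lt_top_iff_ne_top]
  intro htop
  exact h (by rw [htop, ENNReal.top_rpow_of_pos (by linarith)])

/-- With `β₀` the critical exponent, `β p - n + 1 = (β - β₀) p`, so the `p`-th power of the norm is
at least a constant times `1 / (β - β₀)`. -/
theorem tendsto_eLpNorm_rpow {p : ℝ} (hp : 1 < p) (hn : 2 ≤ n) :
    Filter.Tendsto (fun β => (eLpNorm (fun x : E n => (1 - ‖x‖ ^ 2) ^ β) (ENNReal.ofReal p)
      (vol n)).toReal) (nhdsWithin (((n : ℝ) - 1) / p) (Ioi (((n : ℝ) - 1) / p))) Filter.atTop := by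
  have hp0 : 0 < p := by linarith
  obtain ⟨K, hK, hb⟩ := exists_integral_ball_rpow_ge hn
  set β₀ := ((n : ℝ) - 1) / p with hβ₀
  have e0 : β₀ * p = n - 1 := by rw [hβ₀]; field_simp
  have h1 : Filter.Tendsto (fun β : ℝ => 2 ^ n * (K / p) * (β - β₀)⁻¹) (nhdsWithin β₀ (Ioi β₀))
      Filter.atTop := by
    refine Filter.Tendsto.const_mul_atTop (by positivity) (tendsto_inv_nhdsGT_zero.comp ?_)
    refine tendsto_nhdsWithin_iff.mpr ⟨?_, eventually_nhdsWithin_of_forall fun β hβ =>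
      show 0 < β - β₀ from sub_pos.mpr hβ⟩
    have : Filter.Tendsto (fun β : ℝ => β - β₀) (nhds β₀) (nhds (β₀ - β₀)) :=
      Filter.tendsto_id.sub_const _
    rw [sub_self] at this
    exact this.mono_left nhdsWithin_le_nhds
  have h2 := (tendsto_rpow_atTop (by positivity : 0 < 1 / p)).comp h1
  refine Filter.tendsto_atTop_mono' _ ?_ h2
  have h3 : ∀ᶠ β in nhdsWithin β₀ (Ioi β₀), β < β₀ + 1 / p :=
    nhdsWithin_le_nhds (eventually_lt_nhds (by linarith [one_div_pos.mpr hp0]))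
  filter_upwards [h3, self_mem_nhdsWithin] with β hβ1 (hβ0 : β₀ < β)
  have hβp : β * p - n + 1 = (β - β₀) * p := by rw [sub_mul, e0]; ring
  have hpos : 0 < (β - β₀) * p := mul_pos (sub_pos.mpr hβ0) hp0
  have hlt : (β - β₀) * p < 1 := by
    have := mul_lt_mul_of_pos_right (sub_lt_iff_lt_add'.mpr hβ1) hp0
    rwa [one_div_mul_cancel hp0.ne'] at this
  have h4 := hb (β * p - n) (by linarith) (by linarith)
  have h5 : (eLpNorm (fun x : E n => (1 - ‖x‖ ^ 2) ^ β) (ENNReal.ofReal p) (vol n)).toReal ^ p =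
      2 ^ n * ∫ x in ball n, (1 - ‖x‖ ^ 2) ^ (β * p - n) := by
    rw [ENNReal.toReal_rpow, eLpNorm_rpow_eq hp hn hβ0, ENNReal.toReal_ofReal]
    exact mul_nonneg (by positivity) ((div_pos hK (by linarith)).le.trans h4)
  simp only [Function.comp]
  have h6 : 0 ≤ 2 ^ n * (K / p) * (β - β₀)⁻¹ :=
    mul_nonneg (by positivity) (inv_nonneg.mpr (sub_pos.mpr hβ0).le)
  rw [← Real.rpow_le_rpow_iff (Real.rpow_nonneg h6 _) ENNReal.toReal_nonneg hp0,
    ← Real.rpow_mul h6, one_div_mul_cancel hp0.ne', Real.rpow_one, h5, mul_assoc]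
  refine mul_le_mul_of_nonneg_left (le_trans (le_of_eq ?_) h4) (by positivity)
  rw [hβp, ← div_eq_mul_inv, div_div, mul_comm p]

/-- Near `β₀` the main term is at most `θ N(β)` with a fixed `θ < 1`, while the error involves only
`N(β + 1) ≤ N(β₀ + 1)`. Since `N(β) → ∞`, it is eventually smaller than `(1 - θ) N(β)`. -/
theorem exists_eLpNorm_gt {p : ℝ} (hp : 1 < p) (hn : 2 ≤ n) (m : ℕ) {c : ℝ}
    (hc : c < sharpConst n m p) :
    ∃ u G : E n → ℝ, MemSobolev m p u ∧ ¬ u =ᵐ[vol n] 0 ∧ IsNormGradPow m u G ∧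
      ENNReal.ofReal c * eLpNorm G (ENNReal.ofReal p) (vol n) <
        eLpNorm u (ENNReal.ofReal p) (vol n) := by
  obtain ⟨d, D, hd, hD, hd0, hD0, hdC, hG⟩ := exists_isNormGradPow_rpow (n := n) hp hn m
  have hp0 : 0 < p := by linarith
  have h1p : 1 ≤ ENNReal.ofReal p := (fact_one_le hp).out
  set β₀ := ((n : ℝ) - 1) / p with hβ₀
  set N : ℝ → ℝ := fun β => (eLpNorm (fun x : E n => (1 - ‖x‖ ^ 2) ^ β) (ENNReal.ofReal p)
    (vol n)).toReal with hN
  have hdpos : 0 < d β₀ := by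
    refine lt_of_le_of_ne (hd0 _) fun h => ?_
    rw [← h, mul_zero] at hdC
    exact zero_ne_one hdC
  -- A negative `c` is replaced by `0`, in accordance with `ENNReal.ofReal`, so that multiplication
  -- by it preserves inequalities.
  set c' := max c 0 with hc'
  have hc0 : 0 ≤ c' := le_max_right _ _
  have hθ : c' * d β₀ < 1 := by
    rw [← hdC]
    refine mul_lt_mul_of_pos_right (max_lt hc ?_) hdpos
    exact pos_of_mul_pos_left (by rw [hdC]; exact one_pos) hdpos.le
  obtain ⟨θ, hθ1, hθ2⟩ := exists_between hθ
  have hNt : ∀ β, β₀ < β → eLpNorm (fun x : E n => (1 - ‖x‖ ^ 2) ^ β) (ENNReal.ofReal p)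
    (vol n) = ENNReal.ofReal (N β) := fun β hβ =>
    (ENNReal.ofReal_toReal (memLp_rpow hp hn hβ).2.ne).symm
  have ev1 : ∀ᶠ β in nhdsWithin β₀ (Ioi β₀), c' * d β < θ :=
    nhdsWithin_le_nhds (((continuous_const.mul hd).tendsto β₀).eventually_lt_const hθ1)
  have ev2 : ∀ᶠ β in nhdsWithin β₀ (Ioi β₀), c' * D β < c' * D β₀ + 1 :=
    nhdsWithin_le_nhds (((continuous_const.mul hD).tendsto β₀).eventually_lt_const (lt_add_one _))
  have ev3 := (tendsto_eLpNorm_rpow hp hn).eventually_gt_atTop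
    ((c' * D β₀ + 1) * N (β₀ + 1) / (1 - θ))
  obtain ⟨β, ⟨⟨h1, h2⟩, h3⟩, hβ : β₀ < β⟩ := (((ev1.and ev2).and ev3).and
    self_mem_nhdsWithin).exists
  obtain ⟨G, hGn, hGb⟩ := hG β
  have hN0 : ∀ β, 0 ≤ N β := fun β => ENNReal.toReal_nonneg
  have hmono : N (β + 1) ≤ N (β₀ + 1) := by
    refine ENNReal.toReal_mono (memLp_rpow hp hn (by linarith)).2.ne (eLpNorm_mono_ae ?_)
    filter_upwards [ae_vol_mem_ball] with x hx
    have hs := one_sub_normSq_pos hx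
    rw [Real.norm_of_nonneg (Real.rpow_nonneg hs.le _),
      Real.norm_of_nonneg (Real.rpow_nonneg hs.le _)]
    exact Real.rpow_le_rpow_of_exponent_ge hs (by nlinarith [sq_nonneg ‖x‖]) (by linarith)
  have hDp : 0 ≤ c' * D β₀ + 1 := by have := mul_nonneg hc0 (hD0 β₀); linarith
  have h3' : (c' * D β₀ + 1) * N (β₀ + 1) < N β * (1 - θ) := by
    rwa [div_lt_iff₀ (by linarith)] at h3
  have hNpos : 0 < N β := by
    have := mul_nonneg hDp (hN0 (β₀ + 1))
    exact pos_of_mul_pos_left (this.trans_lt h3') (by linarith)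
  refine ⟨_, G, (IsBoundaryPow.rpow β).memSobolev hp (memLp_rpow hp hn hβ) m, fun h0 => ?_, hGn, ?_⟩
  · have : N β = 0 := by simp only [hN]; rw [eLpNorm_congr_ae h0]; simp
    exact hNpos.ne' this
  · have hGle : eLpNorm G (ENNReal.ofReal p) (vol n) ≤
        ENNReal.ofReal (d β * N β + D β * N (β + 1)) := by
      have m1 : AEStronglyMeasurable (fun x : E n => d β * (1 - ‖x‖ ^ 2) ^ β) (vol n) :=
        aestronglyMeasurable_const.mul (memLp_rpow hp hn hβ).1
      have m2 : AEStronglyMeasurable (fun x : E n => D β * (1 - ‖x‖ ^ 2) ^ (β + 1)) (vol n) :=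
        aestronglyMeasurable_const.mul (memLp_rpow hp hn (by linarith)).1
      have h4 : eLpNorm G (ENNReal.ofReal p) (vol n) ≤ eLpNorm ((fun x : E n =>
          d β * (1 - ‖x‖ ^ 2) ^ β) + fun x => D β * (1 - ‖x‖ ^ 2) ^ (β + 1))
          (ENNReal.ofReal p) (vol n) := by
        refine eLpNorm_mono_ae ?_
        filter_upwards [ae_vol_mem_ball] with x hx
        rw [Real.norm_eq_abs, Real.norm_eq_abs]
        exact (hGb x hx).trans (le_abs_self _)
      refine h4.trans ((eLpNorm_add_le m1 m2 h1p).trans_eq ?_)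
      have e1 : ∀ (a γ : ℝ), 0 ≤ a → β₀ < γ → eLpNorm (fun x : E n => a * (1 - ‖x‖ ^ 2) ^ γ)
          (ENNReal.ofReal p) (vol n) = ENNReal.ofReal (a * N γ) := fun a γ ha hγ => by
        rw [ENNReal.ofReal_mul ha, ← hNt γ hγ, ← Real.enorm_of_nonneg ha]
        exact eLpNorm_const_smul a _ _ _
      rw [e1 _ _ (hd0 β) hβ, e1 _ _ (hD0 β) (by linarith),
        ENNReal.ofReal_add (mul_nonneg (hd0 _) (hN0 _)) (mul_nonneg (hD0 _) (hN0 _))]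
    calc ENNReal.ofReal c * eLpNorm G (ENNReal.ofReal p) (vol n)
        ≤ ENNReal.ofReal c' * ENNReal.ofReal (d β * N β + D β * N (β + 1)) :=
          mul_le_mul' (ENNReal.ofReal_le_ofReal (le_max_left _ _)) hGle
      _ = ENNReal.ofReal (c' * (d β * N β + D β * N (β + 1))) := (ENNReal.ofReal_mul hc0).symm
      _ < ENNReal.ofReal (N β) := by
          refine (ENNReal.ofReal_lt_ofReal_iff hNpos).mpr ?_
          have g1 : c' * d β * N β ≤ θ * N β := mul_le_mul_of_nonneg_right h1.le hNpos.le
          have g2 : c' * D β * N (β + 1) ≤ (c' * D β₀ + 1) * N (β₀ + 1) :=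
            mul_le_mul h2.le hmono (hN0 _) hDp
          nlinarith
      _ = _ := (hNt β hβ).symm

end HypBall

end

theorem theorem1p1 (n m : ℕ) (hn : 2 ≤ n) (hm : 1 ≤ m) (p : ℝ) (hp : 1 < p) :
    -- the inequality, which is strict for every nonzero function
    (∀ u : HypBall.E n → ℝ, HypBall.MemSobolev m p u →
      (∃ G, HypBall.IsNormGradPow m u G) ∧
      ∀ G, HypBall.IsNormGradPow m u G →
        MemLp G (ENNReal.ofReal p) (HypBall.vol n) ∧
        eLpNorm u (ENNReal.ofReal p) (HypBall.vol n) ≤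
          ENNReal.ofReal (HypBall.sharpConst n m p) *
            eLpNorm G (ENNReal.ofReal p) (HypBall.vol n) ∧
        (¬ u =ᵐ[HypBall.vol n] 0 →
          eLpNorm u (ENNReal.ofReal p) (HypBall.vol n) ≠
            ENNReal.ofReal (HypBall.sharpConst n m p) *
              eLpNorm G (ENNReal.ofReal p) (HypBall.vol n))) ∧
    -- the constant cannot be lowered
    (∀ c : ℝ, c < HypBall.sharpConst n m p →
      ∃ u G : HypBall.E n → ℝ, HypBall.MemSobolev m p u ∧ ¬ u =ᵐ[HypBall.vol n] 0 ∧
        HypBall.IsNormGradPow m u G ∧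
        ENNReal.ofReal c * eLpNorm G (ENNReal.ofReal p) (HypBall.vol n) <
          eLpNorm u (ENNReal.ofReal p) (HypBall.vol n)) := by
  refine ⟨fun u hu => ⟨hu.exists_isNormGradPow hp hn, fun G hG => ?_⟩,
    fun c hc => HypBall.exists_eLpNorm_gt hp hn m hc⟩
  obtain ⟨h1, h2⟩ := hu.of_isNormGradPow hp hn hm hG
  refine ⟨h1, ?_, fun hu0 => (h2 hu0).ne⟩
  by_cases hu0 : u =ᵐ[HypBall.vol n] 0
  · simp [eLpNorm_congr_ae hu0]
  · exact (h2 hu0).le
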